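/- For integers $1\le p\le n$ and a vector ${\bf v}=(v_1,\dots,v_p)$ of integers with $0\le v_i\le i$, a $(p,{\bf v},n)$-superselector of size $m$ is an $m\times n$ binary matrix $M$ such that for every $i\in\{1,\dots,p\}$ and every set $S$ of $i$ columns, the submatrix of $M$ formed by the columns in $S$ contains at least $v_i$ distinct rows of the $i\times i$ identity matrix. Theorem. There is a deterministic algorithm which, given any integers $n\ge 2$ and $1\le p\le n$ and any vector ${\bf v}=(v_1,\dots,v_p)$ of integers with $0\le v_i\le i$, outputs a $(p,{\bf v},n)$-superselector of size $$m=O\Big(\max_{j=1,\dots,p}k_j\log\frac nj\Big),\qquad k_j=\min\Big\{\frac{3pej}{j-v_j+1},\ \frac{e\,j^2}{\log_2 e}\Big\},$$ in time $O(p^3n^{p+1}\log n)$. The constants implied by the two $O(\cdot)$ are absolute. Time is the number of steps of a random access machine whose words have $O(p\log n)$ bits, and which performs each elementary operation on words (addition, subtraction, multiplication, integer division, comparison, memory access) in one step. -/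

import Mathlib

/-! Selectors and super-selectors. -/

/-- `M` is a `(p, k, n)`-selector: for every set `S` of `p` columns, the submatrix `M(S)` contains
at least `k` of the rows of the `p × p` identity matrix. The columns of `M(S)` are indexed by `S`
itself, so that the identity row belonging to `c ∈ S` has a `1` in column `c` and a `0` in every
other column of `S`. -/
def IsSelector {m n : ℕ} (p k : ℕ) (M : Matrix (Fin m) (Fin n) Bool) : Prop :=
  ∀ S : Finset (Fin n), S.card = p →
    k ≤ {c : Fin n | c ∈ S ∧ ∃ r : Fin m, ∀ d ∈ S, M r d = decide (d = c)}.ncard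

/-- `M` is a `(p, v, n)`-super-selector: an `(i, v i, n)`-selector for each `i = 1, …, p`. -/
def IsSuperSelector {m n : ℕ} (p : ℕ) (v : ℕ → ℕ) (M : Matrix (Fin m) (Fin n) Bool) : Prop :=
  ∀ i : ℕ, 1 ≤ i → i ≤ p → IsSelector i (v i) M

/-- `k_j = min {3 p e j / (j - v_j + 1), e j ^ 2 / log₂ e}`. -/
noncomputable def sizeCoeff (p : ℕ) (v : ℕ → ℕ) (j : ℕ) : ℝ :=
  min (3 * (p : ℝ) * Real.exp 1 * (j : ℝ) / ((j : ℝ) - (v j : ℝ) + 1))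
    (Real.exp 1 * (j : ℝ) ^ 2 / Real.logb 2 (Real.exp 1))

/-- `max_{j = 1, …, p} k_j log (n / j)`; the index `i : Fin p` stands for `j = i + 1`. -/
noncomputable def sizeBound (n p : ℕ) (v : ℕ → ℕ) : ℝ :=
  ⨆ i : Fin p, sizeCoeff p v (i.val + 1) * Real.log ((n : ℝ) / ((i.val + 1 : ℕ) : ℝ))

/-! A word RAM, presented as a structured programming language with a step count. -/

namespace RAM

/-- The memory: registers, and random access arrays. A program names its registers and arrays by
constants, hence uses finitely many of them; only positions within an array are computed. -/
structure State where
  reg : ℕ → ℕ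
  arr : ℕ → ℕ → ℕ

/-- Elementary operations on words. -/
inductive Op where
  | add | sub | mul | div | lt | eq

/-- Subtraction is truncated at `0`, division rounds down (with `x / 0 = 0`), and the comparisons
return `1` for true and `0` for false. -/
def Op.eval : Op → ℕ → ℕ → ℕ
  | .add, x, y => x + y
  | .sub, x, y => x - y
  | .mul, x, y => x * y
  | .div, x, y => x / y
  | .lt, x, y => if x < y then 1 else 0
  | .eq, x, y => if x = y then 1 else 0

/-- Expressions: constants, registers, array entries, elementary operations. -/
inductive Expr where
  | const (k : ℕ)
  | reg (r : ℕ)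
  | get (a : ℕ) (i : Expr)
  | bin (o : Op) (x y : Expr)

/-- The value of an expression. -/
def Expr.eval (σ : State) : Expr → ℕ
  | .const k => k
  | .reg r => σ.reg r
  | .get a i => σ.arr a (i.eval σ)
  | .bin o x y => o.eval (x.eval σ) (y.eval σ)

/-- The cost of evaluating an expression: one step for each constant, each register access, each
array access and each elementary operation in it. -/
def Expr.cost : Expr → ℕ
  | .const _ => 1
  | .reg _ => 1
  | .get _ i => i.cost + 1
  | .bin _ x y => x.cost + y.cost + 1

/-- All values that occur in the evaluation, final and intermediate, are at most `W`. -/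
def Expr.Fits (W : ℕ) (σ : State) : Expr → Prop
  | .const k => k ≤ W
  | .reg r => σ.reg r ≤ W
  | .get a i => i.Fits W σ ∧ σ.arr a (i.eval σ) ≤ W
  | .bin o x y => x.Fits W σ ∧ y.Fits W σ ∧ o.eval (x.eval σ) (y.eval σ) ≤ W

/-- Programs. -/
inductive Cmd where
  | skip
  | set (r : ℕ) (e : Expr)
  | put (a : ℕ) (i e : Expr)
  | seq (c d : Cmd)
  | ite (b : Expr) (c d : Cmd)
  | loop (b : Expr) (c : Cmd)

/-- Assignment of the value `x` to the register `r`. -/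
def State.setReg (σ : State) (r x : ℕ) : State :=
  { σ with reg := Function.update σ.reg r x }

/-- Assignment of the value `x` to position `i` of the array `a`. -/
def State.setArr (σ : State) (a i x : ℕ) : State :=
  { σ with arr := Function.update σ.arr a (Function.update (σ.arr a) i x) }

/-- `Exec W c σ t τ`: started in the state `σ`, the program `c` halts after exactly `t` steps in
the state `τ`, and no value occurring on the way exceeds `W`. A program that would produce a larger
value is stuck, so that a word of the machine holds a number from `0` to `W`. The expression `b` in
`ite b c d` (if `b ≠ 0` then `c` else `d`) and in `loop b c` (while `b ≠ 0` do `c`) is a test. -/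
inductive Exec (W : ℕ) : Cmd → State → ℕ → State → Prop where
  | skip (σ : State) : Exec W .skip σ 1 σ
  | set (σ : State) (r : ℕ) (e : Expr) (he : e.Fits W σ) :
      Exec W (.set r e) σ (e.cost + 1) (σ.setReg r (e.eval σ))
  | put (σ : State) (a : ℕ) (i e : Expr) (hi : i.Fits W σ) (he : e.Fits W σ) :
      Exec W (.put a i e) σ (i.cost + e.cost + 1) (σ.setArr a (i.eval σ) (e.eval σ))
  | seq {c d : Cmd} {σ τ ρ : State} {t u : ℕ} (hc : Exec W c σ t τ) (hd : Exec W d τ u ρ) :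
      Exec W (.seq c d) σ (t + u) ρ
  | ite_true {b : Expr} {c d : Cmd} {σ τ : State} {t : ℕ} (hb : b.Fits W σ) (h : b.eval σ ≠ 0)
      (hc : Exec W c σ t τ) : Exec W (.ite b c d) σ (b.cost + 1 + t) τ
  | ite_false {b : Expr} {c d : Cmd} {σ τ : State} {t : ℕ} (hb : b.Fits W σ) (h : b.eval σ = 0)
      (hd : Exec W d σ t τ) : Exec W (.ite b c d) σ (b.cost + 1 + t) τ
  | loop_true {b : Expr} {c : Cmd} {σ τ ρ : State} {t u : ℕ} (hb : b.Fits W σ) (h : b.eval σ ≠ 0)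
      (hc : Exec W c σ t τ) (hl : Exec W (.loop b c) τ u ρ) :
      Exec W (.loop b c) σ (b.cost + 1 + t + u) ρ
  | loop_false {b : Expr} {c : Cmd} {σ : State} (hb : b.Fits W σ) (h : b.eval σ = 0) :
      Exec W (.loop b c) σ (b.cost + 1) σ

/-- The machine is deterministic: the running time and the final state are determined by the program
and the initial state. -/
theorem Exec.deterministic {W : ℕ} {c : Cmd} {σ τ τ' : State} {t t' : ℕ}
    (h : Exec W c σ t τ) (h' : Exec W c σ t' τ') : t = t' ∧ τ = τ' := by
  induction h generalizing t' τ' with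
  | skip => cases h'; exact ⟨rfl, rfl⟩
  | set => cases h'; exact ⟨rfl, rfl⟩
  | put => cases h'; exact ⟨rfl, rfl⟩
  | seq _ _ ih₁ ih₂ =>
    cases h' with
    | seq hc hd =>
      obtain ⟨rfl, rfl⟩ := ih₁ hc
      obtain ⟨rfl, rfl⟩ := ih₂ hd
      exact ⟨rfl, rfl⟩
  | ite_true _ h _ ih =>
    cases h' with
    | ite_true _ _ hc => obtain ⟨rfl, rfl⟩ := ih hc; exact ⟨rfl, rfl⟩
    | ite_false _ h0 _ => exact absurd h0 h
  | ite_false _ h _ ih =>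
    cases h' with
    | ite_true _ h0 _ => exact absurd h h0
    | ite_false _ _ hd => obtain ⟨rfl, rfl⟩ := ih hd; exact ⟨rfl, rfl⟩
  | loop_true _ h _ _ ih₁ ih₂ =>
    cases h' with
    | loop_true _ _ hc hl =>
      obtain ⟨rfl, rfl⟩ := ih₁ hc
      obtain ⟨rfl, rfl⟩ := ih₂ hl
      exact ⟨rfl, rfl⟩
    | loop_false _ h0 => exact absurd h0 h
  | loop_false _ h =>
    cases h' with
    | loop_true _ h0 _ _ => exact absurd h h0
    | loop_false _ _ => exact ⟨rfl, rfl⟩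

/-- The input `(n, p, v₁, …, v_p)`: register `0` holds `n`, register `1` holds `p`, position `j` of
array `0` holds `v_j` for `j = 1, …, p`, and everything else is `0`. -/
def input (n p : ℕ) (v : ℕ → ℕ) : State where
  reg := fun r => if r = 0 then n else if r = 1 then p else 0
  arr := fun a j => if a = 0 ∧ 1 ≤ j ∧ j ≤ p then v j else 0

/-- The state `τ` holds the `m × n` binary matrix `M` as output: register `0` holds the number `m`
of rows, and array `1` holds the entries as zeros and ones, row after row. -/
def Outputs (τ : State) {m n : ℕ} (M : Matrix (Fin m) (Fin n) Bool) : Prop :=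
  τ.reg 0 = m ∧
    ∀ (r : Fin m) (c : Fin n), τ.arr 1 (r.val * n + c.val) = if M r c then 1 else 0

end RAM

/-!
The program chooses the rows of the matrix greedily, by the method of conditional expectations, from
a small family of hash functions.

A row isolates an entry of a tuple of distinct columns if, among the columns of the tuple, it has its
only one there. A list of rows is a `(j, v, n)`-selector as soon as it isolates, in every injective
`j`-tuple, one of the first `K = j - v + 1` entries (`isSelector_of_alive_eq_empty`). Call the tuples
for which this has not yet happened alive. The candidates are the `4 P q` rows
`x ↦ [(a x mod q) mod 4 P = s]`, where `P` is the largest level `j` under consideration and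
`n ≤ q ≤ 2 n` is prime. For each tuple and each position, at least `q / 4` of them isolate the entry
there (`le_card_isolating`).

Give the tuples of level `j` a weight `β j`, initially `n ^ (p + 4 - j)`. The first `K j` positions
play symmetric roles, so that the weight which a row removes is the sum of `β j * K j` over the alive
tuples whose first entry it isolates (`card_alive_append`). The best row removes at least the
fraction `K j / (16 P)` of the weight of each level, in the sum over all levels (`sum_le_score`).
Hence the total weight does not grow if each `β j` is then multiplied by `1 + K j / (16 P)`; rounding
down costs at most half of the increment (`WellWeighted.step`). If a tuple of level `j` is alive
after `r` rows, so are the at least `j ! / 2 ^ j` tuples that arise from it by permuting the first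
`K j` and the other entries, and `(1 + K j / (32 P)) ^ r * j ! / 2 ^ j` is at most `(P + 1) * n ^ j`.
If `2 P ≤ n`, this gives `r ≤ 512 * (P * j / K j) * log (n / j)` (`WellWeighted.length_le`).

Let `J` be the last `j` with `j (j - v_j + 1) ≤ 4 p`. If `2 p ≤ n`, one run with the single level
`J` and `K J = 1` isolates all members of all sets of at most `J` columns with `O(J ^ 2 log (n / J))`
rows. For `j = J` the second term of the minimum `k_j` is the smaller one up to a constant factor, so
this is within the bound (`sq_mul_log_le_sizeBound`). A second run with `P = p` serves the levels
`j > J`, where the first term is the smaller one up to a constant factor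
(`div_mul_log_le_sizeBound`). If `n < 2 p`, the identity matrix is small enough, by the term
`j = ⌊p / 2⌋` of the maximum (`cast_le_sizeBound`).

A tuple contributes to at most one score for each multiplier `a`, so one round takes time
`O(n ^ P * P * q)`, which is `O(p * n ^ (p + 1))`, and there are `O(p ^ 2 log n)` rounds. All numbers
that occur are at most `n ^ (2 p + 20)`. The program is verified with a Hoare logic that keeps track
of the time (`RAM.Runs`), in which every piece of the program leaves alone the registers and arrays
that it does not mention as targets (`RAM.Frame`), and where loop-free pieces are treated by symbolic
evaluation (`RAM.wp`).
-/

/-! ### Reasoning about programs -/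

namespace RAM

/-- Does the program contain an assignment to the register `r`? -/
def Cmd.wr : Cmd → ℕ → Bool
  | .skip, _ => false
  | .set s _, r => r == s
  | .put _ _ _, _ => false
  | .seq c d, r => c.wr r || d.wr r
  | .ite _ c d, r => c.wr r || d.wr r
  | .loop _ c, r => c.wr r

/-- Does the program contain an assignment to the array `a`? -/
def Cmd.wa : Cmd → ℕ → Bool
  | .skip, _ => false
  | .set _ _, _ => false
  | .put b _ _, a => a == b
  | .seq c d, a => c.wa a || d.wa a
  | .ite _ c d, a => c.wa a || d.wa a
  | .loop _ c, a => c.wa a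

@[simp] theorem State.setReg_reg (σ : State) (r x s : ℕ) :
    (σ.setReg r x).reg s = if s = r then x else σ.reg s := by
  simp [State.setReg, Function.update_apply]

@[simp] theorem State.setReg_arr (σ : State) (r x : ℕ) : (σ.setReg r x).arr = σ.arr := rfl

@[simp] theorem State.setArr_reg (σ : State) (a i x : ℕ) : (σ.setArr a i x).reg = σ.reg := rfl

@[simp] theorem State.setArr_arr (σ : State) (a i x b : ℕ) :
    (σ.setArr a i x).arr b = if b = a then Function.update (σ.arr a) i x else σ.arr b := by
  simp [State.setArr, Function.update_apply]

/-- The two states agree on all registers and arrays that `c` does not assign to. -/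
def Frame (c : Cmd) (σ τ : State) : Prop :=
  (∀ r, c.wr r = false → τ.reg r = σ.reg r) ∧ ∀ a, c.wa a = false → τ.arr a = σ.arr a

theorem Frame.refl (c : Cmd) (σ : State) : Frame c σ σ := ⟨fun _ _ => rfl, fun _ _ => rfl⟩

theorem Frame.trans {c : Cmd} {σ τ ρ : State} (h : Frame c σ τ) (h' : Frame c τ ρ) :
    Frame c σ ρ :=
  ⟨fun r hr => (h'.1 r hr).trans (h.1 r hr), fun a ha => (h'.2 a ha).trans (h.2 a ha)⟩

theorem Frame.mono {c d : Cmd} {σ τ : State} (h : Frame c σ τ)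
    (hr : ∀ r, d.wr r = false → c.wr r = false) (ha : ∀ a, d.wa a = false → c.wa a = false) :
    Frame d σ τ :=
  ⟨fun r h' => h.1 r (hr r h'), fun a h' => h.2 a (ha a h')⟩

theorem Exec.frame {W t : ℕ} {c : Cmd} {σ τ : State} (h : Exec W c σ t τ) : Frame c σ τ := by
  induction h with
  | skip => exact Frame.refl _ _
  | set σ r e he =>
    refine ⟨fun s hs => ?_, fun _ _ => rfl⟩
    have : s ≠ r := by simpa [Cmd.wr] using hs
    simp [this]
  | put σ a i e hi he =>
    refine ⟨fun _ _ => rfl, fun b hb => ?_⟩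
    have : b ≠ a := by simpa [Cmd.wa] using hb
    simp [this]
  | seq _ _ ih₁ ih₂ =>
    refine Frame.trans (ih₁.mono ?_ ?_) (ih₂.mono ?_ ?_) <;> intro r hr <;>
      simp_all [Cmd.wr, Cmd.wa]
  | ite_true _ _ _ ih =>
    refine ih.mono ?_ ?_ <;> intro r hr <;> simp_all [Cmd.wr, Cmd.wa]
  | ite_false _ _ _ ih =>
    refine ih.mono ?_ ?_ <;> intro r hr <;> simp_all [Cmd.wr, Cmd.wa]
  | loop_true _ _ _ _ ih₁ ih₂ =>
    refine Frame.trans (ih₁.mono ?_ ?_) ih₂ <;> intro r hr <;> simp_all [Cmd.wr, Cmd.wa]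
  | loop_false => exact Frame.refl _ _

/-- Started in `σ`, the program `c` halts within `T` steps in a state that satisfies `Q`, and no
value on the way exceeds `W`. -/
def Runs (W : ℕ) (c : Cmd) (σ : State) (T : ℕ) (Q : State → Prop) : Prop :=
  ∃ t τ, Exec W c σ t τ ∧ t ≤ T ∧ Q τ

namespace Runs

variable {W T T' : ℕ} {c d : Cmd} {b : Expr} {σ : State} {Q Q' : State → Prop}

theorem mono (h : Runs W c σ T Q) (hT : T ≤ T') (hQ : ∀ τ, Q τ → Q' τ) : Runs W c σ T' Q' := by
  obtain ⟨t, τ, he, ht, hq⟩ := h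
  exact ⟨t, τ, he, ht.trans hT, hQ τ hq⟩

theorem frame (h : Runs W c σ T Q) : Runs W c σ T fun τ => Q τ ∧ Frame c σ τ := by
  obtain ⟨t, τ, he, ht, hq⟩ := h
  exact ⟨t, τ, he, ht, hq, he.frame⟩

theorem seq (h : Runs W c σ T fun τ => Frame c σ τ → Runs W d τ T' Q) :
    Runs W (.seq c d) σ (T + T') Q := by
  obtain ⟨t, τ, he, ht, h'⟩ := h
  obtain ⟨u, ρ, he', hu, hq⟩ := h' he.frame
  exact ⟨t + u, ρ, .seq he he', Nat.add_le_add ht hu, hq⟩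

theorem ite (hb : b.Fits W σ) (hc : b.eval σ ≠ 0 → Runs W c σ T Q)
    (hd : b.eval σ = 0 → Runs W d σ T Q) : Runs W (.ite b c d) σ (b.cost + 1 + T) Q := by
  by_cases h : b.eval σ = 0
  · obtain ⟨t, τ, he, ht, hq⟩ := hd h
    exact ⟨_, τ, .ite_false hb h he, by omega, hq⟩
  · obtain ⟨t, τ, he, ht, hq⟩ := hc h
    exact ⟨_, τ, .ite_true hb h he, by omega, hq⟩

/-- The rule for loops: `I k` holds after `k` iterations, the next of which takes at most `T k`
steps, and there are at most `N` of them. -/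
theorem loop (N : ℕ) (T : ℕ → ℕ) (I : ℕ → State → Prop) (h0 : I 0 σ)
    (hb : ∀ k τ, k ≤ N → I k τ → b.Fits W τ)
    (hlt : ∀ k τ, k ≤ N → I k τ → b.eval τ ≠ 0 → k < N)
    (hstep : ∀ k τ, k < N → I k τ → b.eval τ ≠ 0 → Frame c σ τ → Runs W c τ (T k) (I (k + 1))) :
    Runs W (.loop b c) σ (∑ k ∈ Finset.range N, (T k + (b.cost + 1)) + (b.cost + 1))
      fun τ => (∃ k ≤ N, I k τ) ∧ b.eval τ = 0 := by
  have key : ∀ l k τ, k + l = N → I k τ → Frame c σ τ →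
      Runs W (.loop b c) τ (∑ i ∈ Finset.Ico k N, (T i + (b.cost + 1)) + (b.cost + 1))
        fun τ => (∃ k ≤ N, I k τ) ∧ b.eval τ = 0 := by
    intro l
    induction l with
    | zero =>
      intro k τ hk hI hf
      have h : b.eval τ = 0 := by
        by_contra h
        have := hlt k τ (by omega) hI h
        omega
      exact ⟨_, τ, .loop_false (hb k τ (by omega) hI) h, by omega, ⟨k, by omega, hI⟩, h⟩
    | succ l ih =>
      intro k τ hk hI hf
      have hkN : k < N := by omega
      by_cases h : b.eval τ = 0
      · exact ⟨_, τ, .loop_false (hb k τ (by omega) hI) h, by omega, ⟨k, by omega, hI⟩, h⟩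
      · obtain ⟨t, ρ, he, ht, hI'⟩ := hstep k τ hkN hI h hf
        obtain ⟨u, π, he', hu, hq⟩ := ih (k + 1) ρ (by omega) hI' (hf.trans he.frame)
        refine ⟨_, π, .loop_true (hb k τ (by omega) hI) h he he', ?_, hq⟩
        rw [Finset.sum_eq_sum_Ico_succ_bot hkN]
        omega
  have := key N 0 σ (by omega) h0 (Frame.refl _ _)
  rwa [← Finset.range_eq_Ico] at this

end Runs

/-- The weakest precondition of a program without loops. -/
def wp (W : ℕ) : Cmd → (State → Prop) → State → Prop
  | .skip, Q, σ => Q σ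
  | .set r e, Q, σ => e.Fits W σ ∧ Q (σ.setReg r (e.eval σ))
  | .put a i e, Q, σ => i.Fits W σ ∧ e.Fits W σ ∧ Q (σ.setArr a (i.eval σ) (e.eval σ))
  | .seq c d, Q, σ => wp W c (wp W d Q) σ
  | .ite b c d, Q, σ => b.Fits W σ ∧ (b.eval σ ≠ 0 → wp W c Q σ) ∧ (b.eval σ = 0 → wp W d Q σ)
  | .loop _ _, _, _ => False

/-- A bound for the number of steps of a program without loops. -/
def Cmd.maxCost : Cmd → ℕ
  | .skip => 1
  | .set _ e => e.cost + 1
  | .put _ i e => i.cost + e.cost + 1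
  | .seq c d => c.maxCost + d.maxCost
  | .ite b c d => b.cost + 1 + max c.maxCost d.maxCost
  | .loop _ _ => 0

theorem Runs.of_wp {W : ℕ} {c : Cmd} {σ : State} {Q : State → Prop} (h : wp W c Q σ) :
    Runs W c σ c.maxCost Q := by
  induction c generalizing σ Q with
  | skip => exact ⟨1, σ, .skip σ, le_rfl, h⟩
  | set r e => exact ⟨_, _, .set σ r e h.1, le_rfl, h.2⟩
  | put a i e => exact ⟨_, _, .put σ a i e h.1 h.2.1, le_rfl, h.2.2⟩
  | seq c d ih₁ ih₂ => exact Runs.seq ((ih₁ h).mono le_rfl fun τ hτ _ => ih₂ hτ)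
  | ite b c d ih₁ ih₂ =>
    exact Runs.ite h.1 (fun hb => (ih₁ (h.2.1 hb)).mono (le_max_left _ _) fun _ => id)
      fun hb => (ih₂ (h.2.2 hb)).mono (le_max_right _ _) fun _ => id
  | loop => exact h.elim

/-- `for i = 0, …, b - 1 do c`, where `i` and `b` are registers. -/
def forUp (i b : ℕ) (c : Cmd) : Cmd :=
  .seq (.set i (.const 0)) (.loop (.bin .lt (.reg i) (.reg b))
    (.seq c (.set i (.bin .add (.reg i) (.const 1)))))

/-- The rule for counting loops. The counter and its bound must not be assigned to by the body. -/
theorem Runs.forUp {W i b : ℕ} {c : Cmd} {σ : State} (N : ℕ) (T : ℕ → ℕ)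
    (I : ℕ → State → Prop) (hN : σ.reg b = N) (hW : N ≤ W) (hW' : 1 ≤ W) (hi : c.wr i = false)
    (hb : c.wr b = false) (hib : b ≠ i) (h0 : I 0 (σ.setReg i 0))
    (hstep : ∀ k τ, k < N → τ.reg i = k → Frame (RAM.forUp i b c) σ τ → I k τ →
      Runs W c τ (T k) fun ρ => I (k + 1) (ρ.setReg i (k + 1))) :
    Runs W (RAM.forUp i b c) σ (∑ k ∈ Finset.range N, (T k + 8) + 6) (I N) := by
  have hcost : (Expr.bin .lt (.reg i) (.reg b)).cost = 3 := rfl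
  have hfb : ∀ τ, Frame (.seq c (.set i (.bin .add (.reg i) (.const 1)))) (σ.setReg i 0) τ →
      τ.reg b = N := by
    intro τ h
    rw [h.1 b (by simp [Cmd.wr, hb, hib])]
    simp [hib, hN]
  have hloop := Runs.loop (W := W) (b := .bin .lt (.reg i) (.reg b))
    (c := .seq c (.set i (.bin .add (.reg i) (.const 1)))) (σ := σ.setReg i 0) N (fun k => T k + 4)
    (fun k τ => I k τ ∧ τ.reg i = k ∧
      Frame (.seq c (.set i (.bin .add (.reg i) (.const 1)))) (σ.setReg i 0) τ)
    ⟨h0, by simp, Frame.refl _ _⟩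
    (by
      rintro k τ hk ⟨_, hτ, hf⟩
      have := hfb τ hf
      refine ⟨?_, ?_, ?_⟩
      · change τ.reg i ≤ W
        omega
      · change τ.reg b ≤ W
        omega
      · simp only [Op.eval]
        split <;> omega)
    (by
      rintro k τ hk ⟨_, hτ, hf⟩ h
      have := hfb τ hf
      by_contra h'
      apply h
      simp [Expr.eval, Op.eval, hτ, this, h'])
    (by
      rintro k τ hk ⟨hI, hτ, hf⟩ - -
      have hfr : Frame (RAM.forUp i b c) σ τ := by
        refine ⟨fun r hr => ?_, fun a ha => ?_⟩
        · simp only [RAM.forUp, Cmd.wr, Bool.or_eq_false_iff] at hr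
          have h1 : r ≠ i := by simpa using hr.1
          rw [hf.1 r (by simp [Cmd.wr, hr])]
          simp [h1]
        · simp only [RAM.forUp, Cmd.wa, Bool.or_eq_false_iff] at ha
          rw [hf.2 a (by simp [Cmd.wa, ha])]
          rfl
      refine Runs.seq (T := T k) (T' := 4) ((hstep k τ hk hτ hfr hI).mono le_rfl ?_)
      intro ρ hρ hfρ
      have hρi : ρ.reg i = k := by rw [hfρ.1 i hi, hτ]
      refine (Runs.of_wp (c := .set i (.bin .add (.reg i) (.const 1)))
        (Q := fun π => π = ρ.setReg i (k + 1)) ?_).frame.mono (le_of_eq rfl) ?_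
      · refine ⟨⟨?_, hW', ?_⟩, ?_⟩
        · change ρ.reg i ≤ W
          omega
        · change ρ.reg i + 1 ≤ W
          omega
        · simp [Expr.eval, Op.eval, hρi]
      · rintro π ⟨rfl, hfπ⟩
        refine ⟨hρ, by simp, hf.trans (Frame.trans (hfρ.mono ?_ ?_) (hfπ.mono ?_ ?_))⟩ <;>
          intro r hr <;> simp_all [Cmd.wr, Cmd.wa])
  have hset : Runs W (.set i (.const 0)) σ 2 fun π => π = σ.setReg i 0 :=
    Runs.of_wp (c := .set i (.const 0)) ⟨Nat.zero_le _, rfl⟩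
  refine (Runs.seq (T' := ∑ k ∈ Finset.range N, (T k + 4 + (3 + 1)) + (3 + 1))
    (hset.mono le_rfl ?_)).mono ?_ fun _ => id
  · rintro π rfl -
    refine hloop.mono (le_of_eq (by simp [hcost])) ?_
    rintro τ ⟨⟨k, hk, hI, hτ, hf⟩, h⟩
    have h1 := hfb τ hf
    have : k = N := by
      by_contra hne
      have : k < N := by omega
      simp [Expr.eval, Op.eval, hτ, h1, this] at h
    exact this ▸ hI
  · have : ∀ k, T k + 4 + (3 + 1) = T k + 8 := fun k => by omega
    simp only [this]
    omega

/-- The remainder of a division. -/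
def Expr.mod (x y : Expr) : Expr := .bin .sub x (.bin .mul (.bin .div x y) y)

@[simp] theorem Expr.eval_mod (σ : State) (x y : Expr) :
    (x.mod y).eval σ = x.eval σ % y.eval σ := by
  have := Nat.div_add_mod' (x.eval σ) (y.eval σ)
  simp only [Expr.mod, Expr.eval, Op.eval]
  omega

theorem Expr.Fits.le {W : ℕ} {σ : State} {x : Expr} (h : x.Fits W σ) : x.eval σ ≤ W := by
  cases x with
  | const k => exact h
  | reg r => exact h
  | get a i => exact h.2
  | bin o x y => exact h.2.2

@[simp] theorem Expr.fits_mod {W : ℕ} {σ : State} {x y : Expr} :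
    (x.mod y).Fits W σ ↔ x.Fits W σ ∧ y.Fits W σ := by
  refine ⟨fun h => ⟨h.1, h.2.1.2.1⟩, fun h => ⟨h.1, ⟨⟨h.1, h.2, ?_⟩, h.2, ?_⟩, ?_⟩⟩
  · exact (Nat.div_le_self _ _).trans h.1.le
  · exact (Nat.div_mul_le_self _ _).trans h.1.le
  · exact (Nat.sub_le _ _).trans h.1.le

end RAM

/-! ### Tuples of columns that no row has isolated -/

/-- Among the entries of the tuple `f`, the row has a one exactly at position `i`. -/
def Isolates {n j : ℕ} (row : Fin n → Bool) (f : Fin j → Fin n) (i : Fin j) : Prop :=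
  ∀ l, row (f l) = decide (l = i)

instance {n j : ℕ} (row : Fin n → Bool) (f : Fin j → Fin n) (i : Fin j) :
    Decidable (Isolates row f i) :=
  inferInstanceAs (Decidable (∀ l, row (f l) = decide (l = i)))

/-- The injective `j`-tuples of columns whose first `k` entries are not isolated by any row of `L`;
none if `k = 0`. For `1 ≤ v ≤ j` and `k = j - v + 1` there are none iff the rows of `L` form a
selector for `j` and `v`. -/
def alive (n j k : ℕ) (L : List (Fin n → Bool)) : Finset (Fin j → Fin n) :=
  {f | 0 < k ∧ f.Injective ∧ ∀ row ∈ L, ∀ i : Fin j, i.val < k → ¬ Isolates row f i}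

theorem mem_alive {n j k : ℕ} {L : List (Fin n → Bool)} {f : Fin j → Fin n} :
    f ∈ alive n j k L ↔
      0 < k ∧ f.Injective ∧ ∀ row ∈ L, ∀ i : Fin j, i.val < k → ¬ Isolates row f i := by
  simp [alive]

theorem Isolates.unique {n j : ℕ} {row : Fin n → Bool} {f : Fin j → Fin n} {i i' : Fin j}
    (h : Isolates row f i) (h' : Isolates row f i') : i = i' := by
  have := h i
  rw [h' i] at this
  simpa using this

theorem isolates_comp {n j : ℕ} {row : Fin n → Bool} {f : Fin j → Fin n} {i : Fin j}
    (e : Equiv.Perm (Fin j)) : Isolates row (f ∘ e) i ↔ Isolates row f (e i) := by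
  constructor
  · intro h l
    have := h (e.symm l)
    simp only [Function.comp, Equiv.apply_symm_apply] at this
    rw [this]
    simp [Equiv.symm_apply_eq]
  · intro h l
    simp [Function.comp, h (e l)]

theorem comp_mem_alive {n j k : ℕ} {L : List (Fin n → Bool)} {f : Fin j → Fin n}
    {e : Equiv.Perm (Fin j)} (he : ∀ i, (e i).val < k ↔ i.val < k) (hf : f ∈ alive n j k L) :
    f ∘ e ∈ alive n j k L := by
  rw [mem_alive] at hf ⊢
  refine ⟨hf.1, hf.2.1.comp e.injective, fun row hrow i hi => ?_⟩
  rw [isolates_comp]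
  exact hf.2.2 row hrow _ ((he i).2 hi)

theorem swap_val_lt_iff {j k : ℕ} {i i' : Fin j} (hi : i.val < k) (hi' : i'.val < k) (l : Fin j) :
    (Equiv.swap i i' l).val < k ↔ l.val < k := by
  rcases eq_or_ne l i with rfl | h
  · simp [hi, hi']
  · rcases eq_or_ne l i' with rfl | h'
    · simp [hi, hi']
    · rw [Equiv.swap_apply_of_ne_of_ne h h']

/-- The first `k` positions play symmetric roles. -/
theorem card_isolates_eq {n j k : ℕ} (L : List (Fin n → Bool)) (row : Fin n → Bool) {i i' : Fin j}
    (hi : i.val < k) (hi' : i'.val < k) :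
    (alive n j k L |>.filter fun f => Isolates row f i).card =
      (alive n j k L |>.filter fun f => Isolates row f i').card := by
  have hs := swap_val_lt_iff hi hi'
  refine Finset.card_nbij' (fun f => f ∘ Equiv.swap i i') (fun f => f ∘ Equiv.swap i i') ?_ ?_ ?_ ?_
  · intro f hf
    simp only [Finset.coe_filter, Set.mem_ofPred_eq] at hf ⊢
    exact ⟨comp_mem_alive hs hf.1, by rw [isolates_comp]; simpa using hf.2⟩
  · intro f hf
    simp only [Finset.coe_filter, Set.mem_ofPred_eq] at hf ⊢
    exact ⟨comp_mem_alive hs hf.1, by rw [isolates_comp]; simpa using hf.2⟩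
  · intro f _
    ext l
    simp
  · intro f _
    ext l
    simp

theorem alive_append {n j k : ℕ} (L : List (Fin n → Bool)) (row : Fin n → Bool) :
    alive n j k (L ++ [row]) =
      (alive n j k L).filter fun f => ¬ ∃ i : Fin j, i.val < k ∧ Isolates row f i := by
  ext f
  simp only [mem_alive, Finset.mem_filter, List.mem_append, List.mem_singleton, or_imp,
    forall_and, forall_eq, not_exists, not_and]
  tauto

/-- The row isolates the first entry of the tuple. -/
def HeadIsolated {n j : ℕ} (row : Fin n → Bool) (f : Fin j → Fin n) : Prop :=
  ∃ i : Fin j, i.val = 0 ∧ Isolates row f i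

instance {n j : ℕ} (row : Fin n → Bool) (f : Fin j → Fin n) : Decidable (HeadIsolated row f) :=
  inferInstanceAs (Decidable (∃ i : Fin j, i.val = 0 ∧ Isolates row f i))

/-- By symmetry, a new row removes `k` times as many tuples as it isolates first entries of. -/
theorem card_alive_append {n j k : ℕ} (hk : k ≤ j) (L : List (Fin n → Bool))
    (row : Fin n → Bool) :
    (alive n j k (L ++ [row])).card + k * ((alive n j k L).filter (HeadIsolated row)).card =
      (alive n j k L).card := by
  rcases Nat.eq_zero_or_pos k with rfl | hk0
  · simp [alive]
  rw [alive_append]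
  have h1 := Finset.card_filter_add_card_filter_not (s := alive n j k L)
    (fun f => ∃ i : Fin j, i.val < k ∧ Isolates row f i)
  have h2 : (alive n j k L).filter (fun f => ∃ i : Fin j, i.val < k ∧ Isolates row f i) =
      (Finset.univ.filter fun i : Fin j => i.val < k).biUnion
        fun i => (alive n j k L).filter fun f => Isolates row f i := by
    ext f
    simp only [Finset.mem_filter, Finset.mem_biUnion, Finset.mem_univ, true_and]
    exact ⟨fun ⟨h, i, hi, hf⟩ => ⟨i, hi, h, hf⟩, fun ⟨i, hi, h, hf⟩ => ⟨h, i, hi, hf⟩⟩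
  have h3 : (alive n j k L).filter (HeadIsolated row) =
      (alive n j k L).filter fun f => Isolates row f ⟨0, hk0.trans_le hk⟩ := by
    refine Finset.filter_congr fun f _ => ?_
    exact ⟨fun ⟨i, hi, h⟩ => by rwa [show (⟨0, hk0.trans_le hk⟩ : Fin j) = i from Fin.ext hi.symm],
      fun h => ⟨_, rfl, h⟩⟩
  have h4 : ((alive n j k L).filter
      (fun f => ∃ i : Fin j, i.val < k ∧ Isolates row f i)).card =
      k * ((alive n j k L).filter (HeadIsolated row)).card := by
    rw [h2, h3, Finset.card_biUnion]
    · rw [Finset.sum_congr rfl fun i hi => card_isolates_eq L row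
        (i' := ⟨0, hk0.trans_le hk⟩) (Finset.mem_filter.1 hi).2 hk0]
      rw [Finset.sum_const, smul_eq_mul]
      congr 1
      rw [Fin.card_filter_val_lt]
      omega
    · intro i _ i' _ hne
      rw [Function.onFun, Finset.disjoint_left]
      intro f hf hf'
      exact hne ((Finset.mem_filter.1 hf).2.unique (Finset.mem_filter.1 hf').2)
  omega

/-- One surviving tuple yields many: its first `k` entries and its other entries may be permuted
among themselves. -/
theorem factorial_le_card_alive {n j k : ℕ} (hk : k ≤ j) {L : List (Fin n → Bool)}
    (h : (alive n j k L).Nonempty) : j.factorial ≤ 2 ^ j * (alive n j k L).card := by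
  obtain ⟨f, hf⟩ := h
  have hinj : f.Injective := (mem_alive.1 hf).2.1
  have hcard1 : Fintype.card {i : Fin j // i.val < k} = k := by
    rw [Fintype.card_subtype, Fin.card_filter_val_lt]
    omega
  have hcard2 : Fintype.card {i : Fin j // ¬ i.val < k} = j - k := by
    rw [Fintype.card_subtype_compl, hcard1, Fintype.card_fin]
  have h1 : Fintype.card (Equiv.Perm {i : Fin j // i.val < k} ×
      Equiv.Perm {i : Fin j // ¬ i.val < k}) ≤ (alive n j k L).card := by
    rw [← Finset.card_univ]
    refine Finset.card_le_card_of_injOn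
      (fun e => f ∘ Equiv.Perm.subtypeCongrHom (fun i : Fin j => i.val < k) e) ?_ ?_
    · intro e _
      refine comp_mem_alive (fun i => ?_) hf
      by_cases hi : i.val < k
      · simp only [hi, iff_true]
        rw [Equiv.Perm.subtypeCongrHom_apply,
          Equiv.Perm.subtypeCongr.left_apply (p := fun i : Fin j => i.val < k) _ _ hi]
        exact (e.1 ⟨i, hi⟩).2
      · simp only [hi, iff_false]
        rw [Equiv.Perm.subtypeCongrHom_apply,
          Equiv.Perm.subtypeCongr.right_apply (p := fun i : Fin j => i.val < k) _ _ hi]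
        exact (e.2 ⟨i, hi⟩).2
    · intro e _ e' _ hee
      refine Equiv.Perm.subtypeCongrHom_injective (fun i : Fin j => i.val < k) ?_
      ext i
      have := congrFun hee i
      exact congrArg Fin.val (hinj this)
  rw [Fintype.card_prod, Fintype.card_perm, Fintype.card_perm, hcard1, hcard2] at h1
  rw [← Nat.choose_mul_factorial_mul_factorial hk, mul_assoc]
  exact Nat.mul_le_mul (Nat.choose_le_two_pow _ _) h1

/-- If no tuple survives for `k = j + 1 - v`, every set of `j` columns has at least `v` isolated
members: otherwise the tuples that list `k` non-isolated members first survive. -/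
theorem isSelector_of_alive_eq_empty {n m j v : ℕ} (hv : v ≤ j)
    {L : List (Fin n → Bool)}
    (h : alive n j (j + 1 - v) L = ∅) {M : Matrix (Fin m) (Fin n) Bool}
    (hM : ∀ row ∈ L, ∃ r, M r = row) : IsSelector j v M := by
  intro S hS
  by_contra hlt
  push Not at hlt
  classical
  set G : Finset (Fin n) :=
    S.filter fun c => ∃ r : Fin m, ∀ d ∈ S, M r d = decide (d = c) with hG
  have hGc : {c : Fin n | c ∈ S ∧ ∃ r : Fin m, ∀ d ∈ S, M r d = decide (d = c)}.ncard = G.card := by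
    rw [← Set.ncard_coe_finset]
    congr 1
    ext c
    simp [hG]
  rw [hGc] at hlt
  have hGS : G ⊆ S := Finset.filter_subset _ _
  have hsd := Finset.card_sdiff_add_card_eq_card hGS
  set k := j + 1 - v with hk
  obtain ⟨B, hBsub, hBk⟩ := Finset.exists_subset_card_eq (show k ≤ (S \ G).card by omega)
  have hBS : B ⊆ S := hBsub.trans Finset.sdiff_subset
  have hCc := Finset.card_sdiff_add_card_eq_card hBS
  -- enumerate `B` first and the rest of `S` afterwards
  let e1 : Fin k → Fin n := fun i => (B.equivFinOfCardEq hBk).symm i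
  let e2 : Fin (j - k) → Fin n := fun i =>
    ((S \ B).equivFinOfCardEq (show (S \ B).card = j - k by omega)).symm i
  have he1 : ∀ i, e1 i ∈ B := fun i => Subtype.coe_prop _
  have he2 : ∀ i, e2 i ∈ S \ B := fun i => Subtype.coe_prop _
  let f : Fin j → Fin n := fun i => Fin.append e1 e2 (Fin.cast (by omega) i)
  have hfS : ∀ i, f i ∈ S := by
    intro i
    change Fin.append e1 e2 _ ∈ S
    generalize Fin.cast _ i = i'
    induction i' using Fin.addCases with
    | left i => rw [Fin.append_left]; exact hBS (he1 i)
    | right i => rw [Fin.append_right]; exact (Finset.mem_sdiff.1 (he2 i)).1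
  have hfinj : f.Injective := by
    refine Function.Injective.comp (g := Fin.append e1 e2) ?_ (Fin.cast_injective _)
    rw [Fin.append_injective_iff]
    refine ⟨fun a b hab => (B.equivFinOfCardEq hBk).symm.injective (Subtype.ext hab),
      fun a b hab => (Equiv.injective _) (Subtype.ext hab), fun a b hab => ?_⟩
    exact (Finset.mem_sdiff.1 (he2 b)).2 (hab ▸ he1 a)
  have hfB : ∀ i : Fin j, i.val < k → f i ∈ B := by
    intro i hi
    have : f i = e1 ⟨i, hi⟩ := by
      change Fin.append e1 e2 _ = _
      rw [← Fin.append_left e1 e2]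
      rfl
    rw [this]
    exact he1 _
  have hsurj : ∀ d ∈ S, ∃ l, f l = d := by
    have : Finset.univ.image f = S := by
      refine Finset.eq_of_subset_of_card_le ?_ ?_
      · intro d hd
        obtain ⟨l, -, rfl⟩ := Finset.mem_image.1 hd
        exact hfS l
      · rw [Finset.card_image_of_injective _ hfinj]
        simp [hS]
    intro d hd
    rw [← this] at hd
    obtain ⟨l, -, hl⟩ := Finset.mem_image.1 hd
    exact ⟨l, hl⟩
  have hf : f ∈ alive n j k L := by
    rw [mem_alive]
    refine ⟨by omega, hfinj, fun row hrow i hi hiso => ?_⟩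
    obtain ⟨r, rfl⟩ := hM row hrow
    have h1 := Finset.mem_sdiff.1 (hBsub (hfB i hi))
    apply h1.2
    rw [hG, Finset.mem_filter]
    refine ⟨h1.1, r, fun d hd => ?_⟩
    obtain ⟨l, rfl⟩ := hsurj d hd
    rw [hiso l]
    simp [hfinj.eq_iff]
  rw [h] at hf
  exact absurd hf (Finset.notMem_empty _)

/-- A matrix that isolates every member of every set of `j` columns does so for smaller sets. -/
theorem isSelector_of_le {n m j i v : ℕ} {M : Matrix (Fin m) (Fin n) Bool} (h : IsSelector j j M)
    (hij : i ≤ j) (hj : j ≤ n) (hv : v ≤ i) : IsSelector i v M := by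
  intro S hS
  obtain ⟨S', hSS', hS'⟩ := Finset.exists_superset_card_eq (s := S) (n := j) (by omega) (by simpa)
  have h1 := h S' hS'
  have h2 : {c : Fin n | c ∈ S' ∧ ∃ r : Fin m, ∀ d ∈ S', M r d = decide (d = c)} = S' := by
    refine Set.eq_of_subset_of_ncard_le (fun c hc => hc.1) ?_
    rw [Set.ncard_coe_finset, hS']
    exact h1
  have h3 : (S : Set (Fin n)) ⊆
      {c : Fin n | c ∈ S ∧ ∃ r : Fin m, ∀ d ∈ S, M r d = decide (d = c)} := by
    intro c hc
    have : c ∈ (S' : Set (Fin n)) := hSS' hc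
    rw [← h2] at this
    obtain ⟨-, r, hr⟩ := this
    exact ⟨hc, r, fun d hd => hr d (hSS' hd)⟩
  have := Set.ncard_le_ncard h3 (Set.toFinite _)
  rw [Set.ncard_coe_finset] at this
  omega

/-! ### Hashing -/

/-- The row of the columns with hash value `s` under `x ↦ (a x mod q) mod R`. -/
def hashRow (n q R a s : ℕ) : Fin n → Bool := fun x => decide (a * x.val % q % R = s)

/-- For a prime `q`, two columns collide for at most `2 (q - 1) / R` of the multipliers `a`. -/
theorem card_collisions_le {q R x y : ℕ} (hq : q.Prime) (hx : x < q) (hy : y < q)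
    (hxy : x ≠ y) :
    ((Finset.Ioo 0 q).filter fun a => a * x % q % R = a * y % q % R).card ≤
      2 * ((q - 1) / R) := by
  wlog hlt : y < x generalizing x y
  · have := this hy hx hxy.symm (by omega)
    simpa only [eq_comm] using this
  have hq0 := hq.pos
  set D := (Finset.Ioc 0 (q - 1)).filter (R ∣ ·) with hD
  have hDcard : D.card = (q - 1) / R := Nat.Ioc_filter_dvd_card_eq_div _ _
  set z : ℕ → ℕ := fun a => a * (x - y) % q with hz
  have hzinj : Set.InjOn z (Finset.Ioo 0 q) := by
    intro a ha b hb hab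
    simp only [Finset.coe_Ioo, Set.mem_Ioo] at ha hb
    have h1 : a * (x - y) ≡ b * (x - y) [MOD q] := hab
    have hcop : Nat.gcd q (x - y) = 1 := (Nat.Prime.coprime_iff_not_dvd hq).2 fun hd =>
      absurd (Nat.le_of_dvd (by omega) hd) (by omega)
    have h2 := Nat.ModEq.cancel_right_of_coprime hcop h1
    rwa [Nat.ModEq, Nat.mod_eq_of_lt ha.2, Nat.mod_eq_of_lt hb.2] at h2
  have hzpos : ∀ a ∈ Finset.Ioo 0 q, 0 < z a := by
    intro a ha
    rw [Finset.mem_Ioo] at ha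
    rw [Nat.pos_iff_ne_zero]
    intro h0
    rcases (Nat.Prime.dvd_mul hq).1 (Nat.dvd_of_mod_eq_zero h0) with h | h
    · exact absurd (Nat.le_of_dvd ha.1 h) (by omega)
    · exact absurd (Nat.le_of_dvd (by omega) h) (by omega)
  have hzlt : ∀ a, z a < q := fun a => Nat.mod_lt _ hq0
  have hsub : ((Finset.Ioo 0 q).filter fun a => a * x % q % R = a * y % q % R) ⊆
      ((Finset.Ioo 0 q).filter fun a => z a ∈ D) ∪
        ((Finset.Ioo 0 q).filter fun a => q - z a ∈ D) := by
    intro a ha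
    rw [Finset.mem_filter] at ha
    have hp := hzpos a ha.1
    have hl := hzlt a
    have hxq := Nat.mod_lt (a * x) hq0
    have hyq := Nat.mod_lt (a * y) hq0
    have hsum : (a * y % q + z a) % q = a * x % q := by
      rw [hz, ← Nat.add_mod, ← Nat.mul_add]
      congr 2
      omega
    simp only [Finset.mem_union, Finset.mem_filter, hD, Finset.mem_Ioc]
    rcases Nat.lt_or_ge (a * y % q + z a) q with hc | hc
    · rw [Nat.mod_eq_of_lt hc] at hsum
      refine Or.inl ⟨ha.1, ⟨hp, by omega⟩, ?_⟩
      have := (Nat.modEq_iff_dvd' (n := R) (show a * y % q ≤ a * x % q by omega)).1 ha.2.symm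
      rwa [← hsum, Nat.add_sub_cancel_left] at this
    · have h1 : (a * y % q + z a) % q = a * y % q + z a - q := by
        rw [Nat.mod_eq_sub_mod hc, Nat.mod_eq_of_lt (by omega)]
      refine Or.inr ⟨ha.1, ⟨by omega, by omega⟩, ?_⟩
      have := (Nat.modEq_iff_dvd' (n := R) (show a * x % q ≤ a * y % q by omega)).1 ha.2
      rwa [show a * y % q - a * x % q = q - z a by omega] at this
  have hc1 : ((Finset.Ioo 0 q).filter fun a => z a ∈ D).card ≤ D.card :=
    Finset.card_le_card_of_injOn z (fun a ha => (Finset.mem_filter.1 ha).2)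
      (hzinj.mono fun a ha => (Finset.mem_filter.1 ha).1)
  have hc2 : ((Finset.Ioo 0 q).filter fun a => q - z a ∈ D).card ≤ D.card := by
    refine Finset.card_le_card_of_injOn (fun a => q - z a) (fun a ha => (Finset.mem_filter.1 ha).2)
      fun a ha b hb hab => ?_
    refine hzinj (Finset.mem_filter.1 ha).1 (Finset.mem_filter.1 hb).1 ?_
    have h1 := hzlt a
    have h2 := hzlt b
    simp only at hab
    omega
  calc _ ≤ _ := Finset.card_le_card hsub
    _ ≤ _ := Finset.card_union_le _ _
    _ ≤ _ := by omega

/-- At least a quarter of the multipliers separate a given entry of a tuple from all the others. -/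
theorem le_card_isolating {n q P j : ℕ} (hq : q.Prime) (hnq : n ≤ q) (hj : j ≤ P)
    {f : Fin j → Fin n} (hf : f.Injective) (i : Fin j) :
    q ≤ 4 * ∑ a ∈ Finset.range q, ∑ s ∈ Finset.range (4 * P),
      if Isolates (hashRow n q (4 * P) a s) f i then 1 else 0 := by
  set R := 4 * P with hR
  have hP : 0 < P := (Nat.zero_lt_of_lt i.2).trans_le hj
  set good := (Finset.Ioo 0 q).filter fun a =>
    ∀ l, l ≠ i → a * (f l).val % q % R ≠ a * (f i).val % q % R with hgood
  have hbad : (Finset.Ioo 0 q).filter (fun a => ¬ ∀ l, l ≠ i →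
      a * (f l).val % q % R ≠ a * (f i).val % q % R) ⊆
      (Finset.univ.erase i).biUnion fun l => (Finset.Ioo 0 q).filter fun a =>
        a * (f l).val % q % R = a * (f i).val % q % R := by
    intro a ha
    simp only [Finset.mem_filter, Finset.mem_biUnion, Finset.mem_erase, Finset.mem_univ] at ha ⊢
    obtain ⟨ha, h⟩ := ha
    push Not at h
    obtain ⟨l, hl, h⟩ := h
    exact ⟨l, ⟨hl, trivial⟩, ha, h⟩
  have hbadc : ((Finset.Ioo 0 q).filter (fun a => ¬ ∀ l, l ≠ i →
      a * (f l).val % q % R ≠ a * (f i).val % q % R)).card ≤ (j - 1) * (2 * ((q - 1) / R)) := by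
    refine (Finset.card_le_card hbad).trans (Finset.card_biUnion_le.trans ?_)
    refine (Finset.sum_le_card_nsmul _ _ (2 * ((q - 1) / R)) fun l hl => ?_).trans ?_
    · refine card_collisions_le hq ((f l).2.trans_le hnq) ((f i).2.trans_le hnq) fun h => ?_
      exact (Finset.mem_erase.1 hl).1 (hf (Fin.ext h))
    · simp
  have htot := Finset.card_filter_add_card_filter_not (s := Finset.Ioo 0 q) (fun a => ∀ l, l ≠ i →
      a * (f l).val % q % R ≠ a * (f i).val % q % R)
  rw [← hgood, Nat.card_Ioo] at htot
  have hdiv : R * ((q - 1) / R) ≤ q - 1 := Nat.mul_div_le _ _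
  have h2 : 2 * ((j - 1) * (2 * ((q - 1) / R))) ≤ R * ((q - 1) / R) := by
    calc 2 * ((j - 1) * (2 * ((q - 1) / R))) = 4 * (j - 1) * ((q - 1) / R) := by ring
      _ ≤ _ := Nat.mul_le_mul_right _ (by omega)
  have hq2 := hq.two_le
  have hsum : good.card ≤ ∑ a ∈ Finset.range q, ∑ s ∈ Finset.range R,
      if Isolates (hashRow n q R a s) f i then 1 else 0 := by
    rw [Finset.card_eq_sum_ones]
    calc ∑ _a ∈ good, 1 ≤ ∑ a ∈ good, ∑ s ∈ Finset.range R,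
        (if Isolates (hashRow n q R a s) f i then 1 else 0) := by
          refine Finset.sum_le_sum fun a ha => ?_
          refine le_trans ?_ (Finset.single_le_sum (f := fun s =>
            if Isolates (hashRow n q R a s) f i then 1 else 0) (fun _ _ => Nat.zero_le _)
            (Finset.mem_range.2 (Nat.mod_lt (a * (f i).val % q) (show 0 < R by omega))))
          rw [if_pos]
          intro l
          rcases eq_or_ne l i with rfl | hl
          · simp [hashRow]
          · simp [hashRow, hl, (Finset.mem_filter.1 ha).2 l hl]
      _ ≤ _ := by
          refine Finset.sum_le_sum_of_subset fun a ha => ?_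
          have := (Finset.mem_Ioo.1 (Finset.mem_filter.1 ha).1).2
          exact Finset.mem_range.2 this
  omega

/-! ### The greedy choice of a row -/

theorem sum_range_mul_div_mod (q R : ℕ) (F : ℕ → ℕ → ℕ) :
    ∑ g ∈ Finset.range (q * R), F (g / R) (g % R) =
      ∑ a ∈ Finset.range q, ∑ s ∈ Finset.range R, F a s := by
  induction q with
  | zero => simp
  | succ q ih =>
    rw [Finset.sum_range_succ, ← ih, Nat.succ_mul, Finset.sum_range_add]
    congr 1
    refine Finset.sum_congr rfl fun s hs => ?_
    have hs := Finset.mem_range.1 hs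
    rw [Nat.add_comm, Nat.add_mul_div_right _ _ (by omega), Nat.div_eq_of_lt hs, Nat.zero_add,
      Nat.add_mul_mod_self_right, Nat.mod_eq_of_lt hs]

/-- The weighted number of surviving tuples whose first entry the row `hashRow n q R a s` isolates,
where `g = a R + s`, `R = 4 P`. A tuple of level `j` has weight `β j`; the factor `K j` accounts
for the first `K j` positions, which are symmetric. -/
def score (n q P : ℕ) (K β : ℕ → ℕ) (L : List (Fin n → Bool)) (g : ℕ) : ℕ :=
  ∑ j ∈ Finset.range (P + 1), β j * K j *
    ((alive n j (K j) L).filter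
      (HeadIsolated (hashRow n q (4 * P) (g / (4 * P)) (g % (4 * P))))).card

/-- A row of maximal score removes at least the average weight: every surviving tuple has its first
entry isolated by at least `q / 4` of the `4 P q` rows. -/
theorem sum_le_score {n q P g : ℕ} {K β : ℕ → ℕ} {L : List (Fin n → Bool)} (hq : q.Prime)
    (hnq : n ≤ q) (hK : ∀ j ≤ P, K j ≤ j)
    (hmax : ∀ g' < q * (4 * P), score n q P K β L g' ≤ score n q P K β L g) :
    ∑ j ∈ Finset.range (P + 1), β j * K j * (alive n j (K j) L).card ≤
      16 * P * score n q P K β L g := by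
  have h1 : ∀ j ∈ Finset.range (P + 1), q * (alive n j (K j) L).card ≤
      4 * ∑ g' ∈ Finset.range (q * (4 * P)), ((alive n j (K j) L).filter
        (HeadIsolated (hashRow n q (4 * P) (g' / (4 * P)) (g' % (4 * P))))).card := by
    intro j hj
    have hjP : j ≤ P := Nat.lt_succ_iff.1 (Finset.mem_range.1 hj)
    rcases Nat.eq_zero_or_pos (K j) with h0 | h0
    · simp [alive, h0]
    have hj0 : 0 < j := h0.trans_le (hK j hjP)
    rw [sum_range_mul_div_mod q (4 * P) fun a s => ((alive n j (K j) L).filter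
        (HeadIsolated (hashRow n q (4 * P) a s))).card]
    simp only [Finset.card_filter]
    rw [Finset.sum_congr rfl fun a _ => Finset.sum_comm, Finset.sum_comm, Finset.mul_sum,
      mul_comm q, ← smul_eq_mul, ← Finset.sum_const]
    refine Finset.sum_le_sum fun f hf => ?_
    refine (le_card_isolating hq hnq hjP (mem_alive.1 hf).2.1 ⟨0, hj0⟩).trans ?_
    refine Nat.mul_le_mul_left _ (Finset.sum_le_sum fun a _ => Finset.sum_le_sum fun s _ => ?_)
    split_ifs with h2 h3
    · exact le_rfl
    · exact absurd ⟨⟨0, hj0⟩, rfl, h2⟩ h3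
    · exact Nat.zero_le _
    · exact le_rfl
  have h2 : q * ∑ j ∈ Finset.range (P + 1), β j * K j * (alive n j (K j) L).card ≤
      4 * ∑ g' ∈ Finset.range (q * (4 * P)), score n q P K β L g' := by
    simp only [score]
    rw [Finset.sum_comm, Finset.mul_sum, Finset.mul_sum]
    refine Finset.sum_le_sum fun j hj => ?_
    rw [← Finset.mul_sum]
    calc q * (β j * K j * (alive n j (K j) L).card)
        = β j * K j * (q * (alive n j (K j) L).card) := by ring
      _ ≤ _ := Nat.mul_le_mul_left _ (h1 j hj)
      _ = _ := by ring
  have h3 : ∑ g' ∈ Finset.range (q * (4 * P)), score n q P K β L g' ≤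
      q * (4 * P) * score n q P K β L g := by
    refine (Finset.sum_le_card_nsmul _ _ _ fun g' hg' => hmax g' (Finset.mem_range.1 hg')).trans ?_
    simp
  refine Nat.le_of_mul_le_mul_left (h2.trans ((Nat.mul_le_mul_left 4 h3).trans (le_of_eq ?_))) hq.pos
  ring

/-- The weights for the next round: those of the levels with surviving tuples grow by the factor
`1 + K j / (16 P)`, rounded down. -/
def nextWeight (n P : ℕ) (K β : ℕ → ℕ) (L : List (Fin n → Bool)) (j : ℕ) : ℕ :=
  if (alive n j (K j) L).card = 0 then β j else β j + β j * K j / (16 * P)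

/-- The invariant of the greedy algorithm: the total weight of the surviving tuples has not grown,
and the weights of levels with surviving tuples have grown exponentially. -/
structure WellWeighted (n p P : ℕ) (K β : ℕ → ℕ) (L : List (Fin n → Bool)) : Prop where
  sum_le : ∑ j ∈ Finset.range (P + 1), β j * (alive n j (K j) L).card ≤ (P + 1) * n ^ (p + 4)
  le_weight : ∀ j ≤ P, (alive n j (K j) L).Nonempty →
    n ^ (p + 4 - j) * (32 * P + K j) ^ L.length ≤ β j * (32 * P) ^ L.length
  weight_le : ∀ j ≤ P, K j ≠ 0 → β j ≤ (P + 1) * n ^ (p + 4)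

theorem card_alive_le (n j k : ℕ) (L : List (Fin n → Bool)) : (alive n j k L).card ≤ n ^ j := by
  refine (Finset.card_le_univ _).trans ?_
  simp

theorem WellWeighted.init {n p P : ℕ} {K β : ℕ → ℕ} (hn : 0 < n) (hP : P ≤ p)
    (hβ : ∀ j ≤ P, K j ≠ 0 → β j = n ^ (p + 4 - j)) : WellWeighted n p P K β [] where
  sum_le := by
    refine (Finset.sum_le_card_nsmul _ _ (n ^ (p + 4)) fun j hj => ?_).trans (by simp)
    have hjP : j ≤ P := Nat.lt_succ_iff.1 (Finset.mem_range.1 hj)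
    rcases eq_or_ne (K j) 0 with h0 | h0
    · simp [alive, h0]
    · rw [hβ j hjP h0]
      refine (Nat.mul_le_mul_left _ (card_alive_le n j _ _)).trans (le_of_eq ?_)
      rw [← pow_add]
      congr 1
      omega
  le_weight := by
    intro j hj h
    obtain ⟨f, hf⟩ := h
    simp [hβ j hj (mem_alive.1 hf).1.ne']
  weight_le := by
    intro j hj h
    rw [hβ j hj h]
    exact (Nat.pow_le_pow_right hn (by omega)).trans (Nat.le_mul_of_pos_left _ (by omega))

theorem WellWeighted.congr {n p P : ℕ} {K β β' : ℕ → ℕ} {L : List (Fin n → Bool)}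
    (h : WellWeighted n p P K β L) (hβ : ∀ j ≤ P, K j ≠ 0 → β' j = β j) :
    WellWeighted n p P K β' L where
  sum_le := by
    refine le_trans (le_of_eq (Finset.sum_congr rfl fun j hj => ?_)) h.sum_le
    have hjP : j ≤ P := Nat.lt_succ_iff.1 (Finset.mem_range.1 hj)
    by_cases hK : K j = 0
    · simp [alive, hK]
    · rw [hβ j hjP hK]
  le_weight := by
    intro j hj ha
    rw [hβ j hj (mem_alive.1 ha.choose_spec).1.ne']
    exact h.le_weight j hj ha
  weight_le := by
    intro j hj hK
    rw [hβ j hj hK]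
    exact h.weight_le j hj hK

/-- The weights are so large that rounding down in `nextWeight` costs at most half of the growth. This
is what the exponent `p + 4` in the initial weights is for. -/
theorem WellWeighted.le_weight' {n p P j : ℕ} {K β : ℕ → ℕ} {L : List (Fin n → Bool)}
    (h : WellWeighted n p P K β L) (hn : 2 ≤ n) (hP : 1 ≤ P) (hPn : 2 * P ≤ n) (hPp : P ≤ p)
    (hj : j ≤ P) (ha : (alive n j (K j) L).Nonempty) : 16 * P ≤ β j := by
  have h1 := h.le_weight j hj ha
  have h2 : (32 * P) ^ L.length ≤ (32 * P + K j) ^ L.length := Nat.pow_le_pow_left (by omega) _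
  have h3 : n ^ (p + 4 - j) ≤ β j := by
    refine Nat.le_of_mul_le_mul_right ?_ (show 0 < (32 * P) ^ L.length by positivity)
    exact (Nat.mul_le_mul_left _ h2).trans h1
  have h4 : n ^ 4 ≤ n ^ (p + 4 - j) := Nat.pow_le_pow_right (by omega) (by omega)
  have h5 : 8 * n ≤ n ^ 4 := by
    have : 2 ^ 3 ≤ n ^ 3 := Nat.pow_le_pow_left hn 3
    calc 8 * n = 2 ^ 3 * n := by norm_num
      _ ≤ n ^ 3 * n := Nat.mul_le_mul_right _ this
      _ = n ^ 4 := by ring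
  omega

/-- The row of maximal score pays for the growth of the weights. -/
theorem WellWeighted.step {n p q P g : ℕ} {K β : ℕ → ℕ} {L : List (Fin n → Bool)}
    (h : WellWeighted n p P K β L) (hn : 2 ≤ n) (hP : 1 ≤ P) (hPn : 2 * P ≤ n) (hPp : P ≤ p)
    (hq : q.Prime) (hnq : n ≤ q) (hK : ∀ j ≤ P, K j ≤ j)
    (hmax : ∀ g' < q * (4 * P), score n q P K β L g' ≤ score n q P K β L g)
    {row : Fin n → Bool} (hrow : row = hashRow n q (4 * P) (g / (4 * P)) (g % (4 * P))) :
    WellWeighted n p P K (nextWeight n P K β (L ++ [row])) (L ++ [row]) := by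
  have hcard : ∀ j ≤ P, (alive n j (K j) (L ++ [row])).card ≤ (alive n j (K j) L).card := by
    intro j hj
    rw [alive_append]
    exact Finset.card_filter_le _ _
  have hsplit : ∑ j ∈ Finset.range (P + 1), β j * (alive n j (K j) (L ++ [row])).card +
      score n q P K β L g = ∑ j ∈ Finset.range (P + 1), β j * (alive n j (K j) L).card := by
    rw [score, ← Finset.sum_add_distrib]
    refine Finset.sum_congr rfl fun j hj => ?_
    have := card_alive_append (hK j (Nat.lt_succ_iff.1 (Finset.mem_range.1 hj))) L row
    rw [← this, hrow]
    ring
  have hscore := sum_le_score hq hnq hK hmax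
  have hsum : ∑ j ∈ Finset.range (P + 1),
      nextWeight n P K β (L ++ [row]) j * (alive n j (K j) (L ++ [row])).card ≤
      ∑ j ∈ Finset.range (P + 1), β j * (alive n j (K j) L).card := by
    have h1 : ∀ j ∈ Finset.range (P + 1), 16 * P *
        (nextWeight n P K β (L ++ [row]) j * (alive n j (K j) (L ++ [row])).card) ≤
        16 * P * (β j * (alive n j (K j) (L ++ [row])).card) +
          β j * K j * (alive n j (K j) L).card := by
      intro j hj
      have hc := hcard j (Nat.lt_succ_iff.1 (Finset.mem_range.1 hj))
      unfold nextWeight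
      split_ifs with h0
      · rw [h0]
        simp
      · have h2 := Nat.mul_div_le (β j * K j) (16 * P)
        calc _ = 16 * P * (β j * (alive n j (K j) (L ++ [row])).card) +
              16 * P * (β j * K j / (16 * P)) * (alive n j (K j) (L ++ [row])).card := by ring
          _ ≤ _ := Nat.add_le_add_left (Nat.mul_le_mul h2 hc) _
    have h2 := Finset.sum_le_sum h1
    rw [Finset.sum_add_distrib, ← Finset.mul_sum, ← Finset.mul_sum] at h2
    refine Nat.le_of_mul_le_mul_left (h2.trans ?_) (show 0 < 16 * P by omega)
    rw [← hsplit, Nat.mul_add]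
    omega
  have hsum' := hsum.trans h.sum_le
  refine ⟨hsum', fun j hj ha => ?_, fun j hj h0 => ?_⟩
  · have ha' : (alive n j (K j) L).Nonempty := by
      rw [← Finset.card_pos] at ha ⊢
      exact ha.trans_le (hcard j hj)
    have h1 := h.le_weight j hj ha'
    have h2 := h.le_weight' hn hP hPn hPp hj ha'
    have hk0 : 0 < K j := (mem_alive.1 ha.choose_spec).1
    have h3 : β j * (32 * P + K j) ≤ nextWeight n P K β (L ++ [row]) j * (32 * P) := by
      rw [nextWeight, if_neg (Finset.card_pos.2 ha).ne']
      have h4 : 16 * P ≤ β j * K j := h2.trans (Nat.le_mul_of_pos_right _ hk0)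
      have h5 := Nat.lt_mul_div_succ (β j * K j) (show 0 < 16 * P by omega)
      have h6 : 1 ≤ β j * K j / (16 * P) := (Nat.one_le_div_iff (by omega)).2 h4
      nlinarith
    rw [List.length_append, List.length_singleton, pow_succ, pow_succ]
    calc n ^ (p + 4 - j) * ((32 * P + K j) ^ L.length * (32 * P + K j))
        = n ^ (p + 4 - j) * (32 * P + K j) ^ L.length * (32 * P + K j) := by ring
      _ ≤ β j * (32 * P) ^ L.length * (32 * P + K j) := Nat.mul_le_mul_right _ h1
      _ = β j * (32 * P + K j) * (32 * P) ^ L.length := by ring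
      _ ≤ nextWeight n P K β (L ++ [row]) j * (32 * P) * (32 * P) ^ L.length :=
          Nat.mul_le_mul_right _ h3
      _ = _ := by ring
  · by_cases ha : (alive n j (K j) (L ++ [row])).card = 0
    · rw [nextWeight, if_pos ha]
      exact h.weight_le j hj h0
    · refine le_trans ?_ hsum'
      refine le_trans ?_ (Finset.single_le_sum (f := fun j => nextWeight n P K β (L ++ [row]) j *
        (alive n j (K j) (L ++ [row])).card) (fun _ _ => Nat.zero_le _)
        (Finset.mem_range.2 (Nat.lt_succ_of_le hj)))
      exact Nat.le_mul_of_pos_right _ (Nat.pos_of_ne_zero ha)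

/-- As long as tuples of level `j` survive, there are few rows: at least `j! / 2 ^ j` tuples survive,
and their total weight is bounded by the initial one. -/
theorem WellWeighted.length_le {n p P j : ℕ} {K β : ℕ → ℕ} {L : List (Fin n → Bool)}
    (h : WellWeighted n p P K β L) (hn : 2 ≤ n) (hP : 1 ≤ P) (hPn : 2 * P ≤ n) (hPp : P ≤ p)
    (hK : ∀ j ≤ P, K j ≤ j) (hj : j ≤ P) (ha : (alive n j (K j) L).Nonempty) :
    (L.length : ℝ) ≤ 512 * (P * j / K j * Real.log (n / j)) := by
  have hk0 : 0 < K j := (mem_alive.1 ha.choose_spec).1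
  have hkj := hK j hj
  have hj0 : 0 < j := by omega
  have h1 := h.le_weight j hj ha
  have h2 := factorial_le_card_alive hkj ha
  have h3 : β j * (alive n j (K j) L).card ≤ (P + 1) * n ^ (p + 4) :=
    (Finset.single_le_sum (f := fun j => β j * (alive n j (K j) L).card)
      (fun _ _ => Nat.zero_le _) (Finset.mem_range.2 (Nat.lt_succ_of_le hj))).trans h.sum_le
  set r := L.length
  set k := K j
  set A := (alive n j k L).card
  have h4 : (32 * P + k) ^ r * j.factorial ≤ (P + 1) * (2 * n) ^ j * (32 * P) ^ r := by
    refine Nat.le_of_mul_le_mul_left ?_ (show 0 < n ^ (p + 4 - j) by positivity)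
    calc n ^ (p + 4 - j) * ((32 * P + k) ^ r * j.factorial)
        = n ^ (p + 4 - j) * (32 * P + k) ^ r * j.factorial := by ring
      _ ≤ β j * (32 * P) ^ r * (2 ^ j * A) := Nat.mul_le_mul h1 h2
      _ = β j * A * (2 ^ j * (32 * P) ^ r) := by ring
      _ ≤ (P + 1) * n ^ (p + 4) * (2 ^ j * (32 * P) ^ r) := Nat.mul_le_mul_right _ h3
      _ = (P + 1) * (n ^ (p + 4 - j) * n ^ j) * (2 ^ j * (32 * P) ^ r) := by
          rw [← pow_add, show p + 4 - j + j = p + 4 by omega]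
      _ = _ := by rw [mul_pow]; ring
  have hPr : (1 : ℝ) ≤ P := by exact_mod_cast hP
  have hjr : (1 : ℝ) ≤ j := by exact_mod_cast hj0
  have hkr : (1 : ℝ) ≤ k := by exact_mod_cast hk0
  have hkP : (k : ℝ) ≤ P := by exact_mod_cast hkj.trans hj
  have hnr : (2 : ℝ) ≤ n := by exact_mod_cast hn
  have hnj : (2 : ℝ) * j ≤ n := by
    have : 2 * j ≤ n := by omega
    exact_mod_cast this
  set l := Real.log (n / j) with hl
  have hlog2 : (1 : ℝ) / 2 ≤ Real.log 2 := by linarith [Real.log_two_gt_d9]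
  have hl2 : Real.log 2 ≤ l :=
    Real.log_le_log (by norm_num) ((le_div_iff₀ (by linarith)).2 hnj)
  have hln : Real.log n = l + Real.log j := by
    rw [hl, Real.log_div (by linarith) (by linarith)]
    ring
  have hlogj : Real.log j ≤ j := (Real.log_le_sub_one_of_pos (by linarith)).trans (by linarith)
  have hlogP : Real.log (P + 1) ≤ l + j := by
    have : Real.log (P + 1) ≤ Real.log n := by
      refine Real.log_le_log (by linarith) ?_
      have : P + 1 ≤ n := by omega
      exact_mod_cast this
    linarith
  -- `j ! ≥ (j / e) ^ j` turns `log n` into `log (n / j)`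
  have hfac : (j : ℝ) * Real.log j - j ≤ Real.log (j.factorial : ℝ) := by
    have h5 := Real.pow_div_factorial_le_exp (j : ℝ) (by linarith) j
    have h6 := Real.log_le_log (by positivity) h5
    rw [Real.log_exp, Real.log_div (by positivity) (by positivity), Real.log_pow] at h6
    linarith
  have h5 : (32 * (P : ℝ) + k) ^ r * (j.factorial : ℝ) ≤
      (P + 1) * (2 * n) ^ j * (32 * (P : ℝ)) ^ r := by exact_mod_cast h4
  have h6 := Real.log_le_log (by positivity) h5
  rw [Real.log_mul (by positivity) (by positivity), Real.log_mul (by positivity) (by positivity),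
    Real.log_mul (by positivity) (by positivity), Real.log_pow, Real.log_pow, Real.log_pow,
    Real.log_mul (by norm_num) (by linarith)] at h6
  have h7 : (k : ℝ) / (64 * P) ≤ Real.log (32 * P + k) - Real.log (32 * P) := by
    rw [← Real.log_div (by positivity) (by positivity)]
    refine le_trans ?_ (Real.one_sub_inv_le_log_of_pos (by positivity))
    rw [inv_div, one_sub_div (by positivity), div_le_div_iff₀ (by positivity) (by positivity)]
    nlinarith
  have h8 : (r : ℝ) * (k / (64 * P)) ≤ 8 * (j * l) := by
    have h9 : (r : ℝ) * (k / (64 * P)) ≤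
        r * (Real.log (32 * P + k) - Real.log (32 * P)) :=
      mul_le_mul_of_nonneg_left h7 (Nat.cast_nonneg _)
    have h10 : Real.log 2 < 0.7 := by linarith [Real.log_two_lt_d9]
    have h11 : l ≤ j * l := le_mul_of_one_le_left (by linarith) hjr
    have h12 : (j : ℝ) ≤ 2 * (j * l) := by nlinarith
    have h13 : (j : ℝ) * Real.log 2 ≤ j * 0.7 :=
      mul_le_mul_of_nonneg_left h10.le (by linarith)
    have h14 : (j : ℝ) * Real.log n = j * l + j * Real.log j := by rw [hln]; ring
    nlinarith
  have h9 : (r : ℝ) = r * (k / (64 * P)) * (64 * P / k) := by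
    field_simp
  rw [h9]
  calc (r : ℝ) * (k / (64 * P)) * (64 * P / k) ≤ 8 * (j * l) * (64 * P / k) :=
        mul_le_mul_of_nonneg_right h8 (by positivity)
    _ = 512 * (P * j / k * l) := by ring

/-! ### The program -/

namespace RAM

/-!
The arrays: `0` holds the input `v`, `1` the output, `2` the numbers `K j`, `3` the weights, `4` the
marks of the removed tuples (zero for the survivors), and `5` the scores. Register `1` holds the
input `p`. The names of the other registers stand for what they hold:

* `rN`, `rPr`, `rX`: `n` (at the end the number of rows), the prime `q`, and `n ^ (p + 4)`;
* `rQ`, `rL`, `rR`, `rGt`: the largest level `P`, `P + 1`, `4 P`, and the number `4 P q` of candidate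
  rows;
* `rM`: the number of rows written;
* `rJ`, `rPw`, `rBk`: the current level `j`, `n ^ j`, and `K j` times the weight of level `j`;
* `rC`, `rCur`, `rCurr`: the code of the current tuple, and what is left of it while its entries are
  read off;
* `rA`, `rH`, `rG`: a multiplier, a hash value or an entry of a row, and the index `4 P a + s` of a
  candidate row;
* `rBest`, `rArg`: the maximal score and where it is attained;
* `rTot`, `rLev`: the numbers of survivors, overall and at the current level;
* `rCnt`, `rCntk`, `rI`, `rII`: counters. Outside of `greedy`, `rL` is a loop bound and `rI` also the
  trial divisor.
-/

notation "rN" => (0 : ℕ)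
notation "rQ" => (2 : ℕ)
notation "rPr" => (3 : ℕ)
notation "rR" => (4 : ℕ)
notation "rM" => (5 : ℕ)
notation "rJ" => (6 : ℕ)
notation "rPw" => (7 : ℕ)
notation "rC" => (8 : ℕ)
notation "rCur" => (9 : ℕ)
notation "rA" => (10 : ℕ)
notation "rH" => (11 : ℕ)
notation "rCnt" => (12 : ℕ)
notation "rI" => (13 : ℕ)
notation "rTot" => (14 : ℕ)
notation "rLev" => (15 : ℕ)
notation "rBest" => (16 : ℕ)
notation "rArg" => (17 : ℕ)
notation "rG" => (18 : ℕ)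
notation "rL" => (19 : ℕ)
notation "rBk" => (20 : ℕ)
notation "rX" => (21 : ℕ)
notation "rCntk" => (22 : ℕ)
notation "rCurr" => (23 : ℕ)
notation "rII" => (24 : ℕ)
notation "rGt" => (25 : ℕ)

/-- The hash value of `x` under the multiplier `a`. -/
def Expr.hash (a x : Expr) : Expr := ((Expr.bin .mul a x).mod (.reg rPr)).mod (.reg rR)

/-- The position of the current tuple in the array of removed tuples. -/
def Expr.slot : Expr := .bin .add (.bin .mul (.reg rC) (.reg rL)) (.reg rJ)

/-- Counts the entries of the tuple that have the same hash value as the first one. -/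
def headCount : Cmd :=
  .seq (.seq (.set rH (.hash (.reg rA) (.mod (.reg rC) (.reg rN))))
    (.seq (.set rCnt (.const 0)) (.set rCur (.reg rC))))
  (forUp rI rJ (.seq
    (.set rCnt (.bin .add (.reg rCnt)
      (.bin .eq (.hash (.reg rA) (.mod (.reg rCur) (.reg rN))) (.reg rH))))
    (.set rCur (.bin .div (.reg rCur) (.reg rN)))))

/-- For all multipliers, adds the contribution of one tuple to the scores. For each multiplier there
is at most one row that isolates the first entry: that of the hash value of this entry, if no other
entry shares it. -/
def scoreTuple : Cmd :=
  forUp rA rPr (.seq headCount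
    (.put 5 (.bin .add (.bin .mul (.reg rA) (.reg rR)) (.reg rH))
      (.bin .add (.get 5 (.bin .add (.bin .mul (.reg rA) (.reg rR)) (.reg rH)))
        (.bin .mul (.reg rBk) (.bin .eq (.reg rCnt) (.const 1))))))

/-- Runs `c` for every active level `j`, with `n ^ j` in a register. -/
def forLevels (c : Cmd) : Cmd :=
  .seq (.set rPw (.const 1))
    (forUp rJ rL (.seq (.ite (.get 2 (.reg rJ)) c .skip)
      (.set rPw (.bin .mul (.reg rPw) (.reg rN)))))

/-- Runs `c` for every surviving tuple of the current level. -/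
def forAlive (c : Cmd) : Cmd :=
  forUp rC rPw (.ite (.bin .eq (.get 4 .slot) (.const 0)) c .skip)

/-- Computes the scores of all rows. -/
def computeScores : Cmd :=
  .seq (forUp rG rGt (.put 5 (.reg rG) (.const 0)))
    (forLevels (.seq (.set rBk (.bin .mul (.get 3 (.reg rJ)) (.get 2 (.reg rJ))))
      (forAlive scoreTuple)))

/-- Finds a row of maximal score. -/
def findBest : Cmd :=
  .seq (.seq (.set rBest (.get 5 (.const 0))) (.set rArg (.const 0)))
    (forUp rG rGt (.ite (.bin .lt (.reg rBest) (.get 5 (.reg rG)))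
      (.seq (.set rBest (.get 5 (.reg rG))) (.set rArg (.reg rG))) .skip))

/-- Writes the chosen row. -/
def writeRow : Cmd :=
  .seq (.seq (.set rA (.bin .div (.reg rArg) (.reg rR))) (.set rH (.mod (.reg rArg) (.reg rR))))
    (forUp rI rN (.put 1 (.bin .add (.bin .mul (.reg rM) (.reg rN)) (.reg rI))
      (.bin .eq (.hash (.reg rA) (.reg rI)) (.reg rH))))

/-- Counts the ones of the new row among the entries and among the first `K j` entries of the
tuple. -/
def rowCount : Cmd :=
  .seq (.seq (.set rCnt (.const 0)) (.seq (.set rCntk (.const 0)) (.set rCur (.reg rC))))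
    (forUp rI rJ (.seq
      (.set rH (.get 1 (.bin .add (.bin .mul (.reg rM) (.reg rN)) (.mod (.reg rCur) (.reg rN)))))
      (.seq (.set rCnt (.bin .add (.reg rCnt) (.reg rH)))
      (.seq (.set rCntk (.bin .add (.reg rCntk)
          (.bin .mul (.reg rH) (.bin .lt (.reg rI) (.get 2 (.reg rJ))))))
        (.set rCur (.bin .div (.reg rCur) (.reg rN)))))))

/-- Removes the tuple if the new row isolates one of its first `K j` entries, and counts it
otherwise. -/
def updateTuple : Cmd :=
  .seq rowCount
    (.seq (.put 4 .slot
        (.bin .mul (.bin .eq (.reg rCnt) (.const 1)) (.bin .eq (.reg rCntk) (.const 1))))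
      (.set rLev (.bin .add (.reg rLev) (.bin .sub (.const 1) (.get 4 .slot)))))

/-- Updates the set of surviving tuples and the weights. -/
def update : Cmd :=
  .seq (.set rTot (.const 0))
    (forLevels (.seq (.seq (.set rLev (.const 0)) (forAlive updateTuple))
      (.seq (.set rTot (.bin .add (.reg rTot) (.reg rLev)))
        (.ite (.reg rLev) (.put 3 (.reg rJ) (.bin .add (.get 3 (.reg rJ))
          (.bin .div (.bin .mul (.get 3 (.reg rJ)) (.get 2 (.reg rJ)))
            (.bin .mul (.const 4) (.reg rR))))) .skip))))

/-- Counts the pairs of equal entries of the tuple. -/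
def pairCount : Cmd :=
  .seq (.seq (.set rCnt (.const 0)) (.set rCur (.reg rC)))
    (forUp rI rJ (.seq (.seq (.set rCurr (.reg rC))
      (forUp rII rJ (.seq
        (.set rCnt (.bin .add (.reg rCnt)
          (.bin .eq (.mod (.reg rCur) (.reg rN)) (.mod (.reg rCurr) (.reg rN)))))
        (.set rCurr (.bin .div (.reg rCurr) (.reg rN))))))
      (.set rCur (.bin .div (.reg rCur) (.reg rN)))))

/-- Initially the injective tuples are the surviving ones; they are those with exactly `j` pairs of
equal entries. -/
def initTuple : Cmd :=
  .seq pairCount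
    (.seq (.put 4 .slot (.bin .sub (.const 1) (.bin .eq (.reg rCnt) (.reg rJ))))
      (.set rTot (.bin .add (.reg rTot) (.bin .eq (.reg rCnt) (.reg rJ)))))

/-- Sets up the surviving tuples and the weights. -/
def init : Cmd :=
  .seq (.seq (.set rL (.bin .add (.reg rQ) (.const 1)))
    (.seq (.set rR (.bin .mul (.const 4) (.reg rQ)))
    (.seq (.set rGt (.bin .mul (.reg rPr) (.reg rR))) (.set rTot (.const 0)))))
    (forLevels (.seq (.put 3 (.reg rJ) (.bin .div (.reg rX) (.reg rPw)))
      (forUp rC rPw initTuple)))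

/-- The greedy algorithm: appends rows until no tuple survives. -/
def greedy : Cmd :=
  .seq init (.loop (.reg rTot)
    (.seq computeScores (.seq findBest (.seq writeRow (.seq update
      (.set rM (.bin .add (.reg rM) (.const 1))))))))

/-- The numbers that the greedy algorithm depends on: the range `4 P` and the modulus `q` of the
hash functions, and the numbers `K j` of positions that count at level `j`, which is inactive if
`K j = 0`. -/
structure Params (W n p P q : ℕ) (K : ℕ → ℕ) : Prop where
  two_le : 2 ≤ n
  one_le : 1 ≤ P
  two_mul_le : 2 * P ≤ n
  le_p : P ≤ p
  prime : q.Prime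
  le_q : n ≤ q
  q_le : q ≤ 2 * n
  K_le : ∀ j ≤ P, K j ≤ j
  le_W : n ^ (2 * p + 20) ≤ W

/-- The registers and the array that hold the parameters. -/
structure Ctx (n p P q : ℕ) (K : ℕ → ℕ) (σ : State) : Prop where
  n_eq : σ.reg rN = n
  P_eq : σ.reg rQ = P
  q_eq : σ.reg rPr = q
  R_eq : σ.reg rR = 4 * P
  L_eq : σ.reg rL = P + 1
  G_eq : σ.reg rGt = q * (4 * P)
  X_eq : σ.reg rX = n ^ (p + 4)
  K_eq : ∀ j ≤ P, σ.arr 2 j = K j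

/-- Does the program leave the parameters alone? -/
def Cmd.keeps (c : Cmd) : Bool :=
  !(c.wr rN || c.wr rQ || c.wr rPr || c.wr rR || c.wr rL || c.wr rGt || c.wr rX || c.wa 2)

theorem Ctx.of_frame {n p P q : ℕ} {K : ℕ → ℕ} {σ τ : State} {c : Cmd} (h : Ctx n p P q K σ)
    (hf : Frame c σ τ) (hc : c.keeps = true) : Ctx n p P q K τ := by
  simp only [Cmd.keeps, Bool.not_eq_true', Bool.or_eq_false_iff] at hc
  obtain ⟨⟨⟨⟨⟨⟨⟨h1, h2⟩, h3⟩, h4⟩, h5⟩, h6⟩, h7⟩, h8⟩ := hc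
  exact ⟨(hf.1 _ h1).trans h.n_eq, (hf.1 _ h2).trans h.P_eq, (hf.1 _ h3).trans h.q_eq,
    (hf.1 _ h4).trans h.R_eq, (hf.1 _ h5).trans h.L_eq, (hf.1 _ h6).trans h.G_eq,
    (hf.1 _ h7).trans h.X_eq, fun j hj => by rw [hf.2 _ h8, h.K_eq j hj]⟩

theorem eval_hash (σ : State) (a x : Expr) :
    (Expr.hash a x).eval σ = a.eval σ * x.eval σ % σ.reg rPr % σ.reg rR := by
  simp [Expr.hash, Expr.eval, Op.eval]

theorem fits_hash {W : ℕ} {σ : State} {a x : Expr} (ha : a.Fits W σ) (hx : x.Fits W σ)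
    (hax : a.eval σ * x.eval σ ≤ W) (hq : σ.reg rPr ≤ W) (hR : σ.reg rR ≤ W) :
    (Expr.hash a x).Fits W σ := by
  simp only [Expr.hash, Expr.fits_mod]
  exact ⟨⟨⟨ha, hx, hax⟩, hq⟩, hR⟩

theorem Params.le_pow {W n p P q : ℕ} {K : ℕ → ℕ} (h : Params W n p P q K) {e x : ℕ}
    (he : e ≤ 2 * p + 20) (hx : x ≤ n ^ e) : x ≤ W :=
  hx.trans ((Nat.pow_le_pow_right (by have := h.two_le; omega) he).trans h.le_W)

/-- Bounds for the simplest quantities. -/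
theorem Params.bounds {W n p P q : ℕ} {K : ℕ → ℕ} (h : Params W n p P q K) :
    n ≤ W ∧ P + 1 ≤ n ∧ 4 * P ≤ W ∧ q ≤ W ∧ q * n ≤ W ∧ q * (4 * P) ≤ W ∧ n * n ≤ W ∧ 2 ≤ W ∧
      16 * P ≤ W := by
  have h2 := h.two_le
  have hP := h.one_le
  have hPn := h.two_mul_le
  have hq := h.q_le
  have h8 : n ^ 10 = n ^ 8 * n * n := by ring
  have h9 : 2 ^ 8 ≤ n ^ 8 := Nat.pow_le_pow_left h2 8
  have h10 : n ^ 10 ≤ W := h.le_pow (e := 10) (by omega) le_rfl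
  have h11 : 256 * n * n ≤ n ^ 10 := by
    rw [h8]
    exact Nat.mul_le_mul_right _ (Nat.mul_le_mul_right _ (by omega))
  have h12 : q * n ≤ 2 * n * n := Nat.mul_le_mul_right _ hq
  have h13 : q * (4 * P) ≤ 2 * n * (2 * n) := Nat.mul_le_mul hq (by omega)
  have h14 : 2 * n ≤ n * n := Nat.mul_le_mul_right _ h2
  refine ⟨?_, ?_, ?_, ?_, ?_, ?_, ?_, ?_, ?_⟩ <;> nlinarith

/-- The tuple with code `c`: its entries are the digits of `c` in base `n`. -/
def tuple {n : ℕ} (hn : 0 < n) (j c : ℕ) : Fin j → Fin n := fun l => ⟨c / n ^ l.val % n,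
  Nat.mod_lt _ hn⟩

theorem sum_tuple {n : ℕ} (hn : 0 < n) (j : ℕ) (F : (Fin j → Fin n) → ℕ) :
    ∑ c ∈ Finset.range (n ^ j), F (tuple hn j c) = ∑ f, F f := by
  rw [← Fin.sum_univ_eq_sum_range (fun c => F (tuple hn j c))]
  refine Fintype.sum_equiv finFunctionFinEquiv.symm _ _ fun c => ?_
  congr 1

/-- The number of entries among the first `k` of the tuple with code `c` that have the same hash
value as the first one. -/
def hashHits (n q R a c k : ℕ) : ℕ :=
  ∑ i ∈ Finset.range k, if a * (c / n ^ i % n) % q % R = a * (c % n) % q % R then 1 else 0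

theorem hashHits_succ (n q R a c k : ℕ) : hashHits n q R a c (k + 1) = hashHits n q R a c k +
    if a * (c / n ^ k % n) % q % R = a * (c % n) % q % R then 1 else 0 :=
  Finset.sum_range_succ _ _

theorem sum_ite_le (p : ℕ → Prop) [DecidablePred p] (k : ℕ) :
    ∑ i ∈ Finset.range k, (if p i then 1 else 0) ≤ k := by
  refine (Finset.sum_le_card_nsmul _ _ 1 fun i _ => ?_).trans (by simp)
  split_ifs <;> omega

theorem div_pow_succ (n c k : ℕ) : c / n ^ k / n = c / n ^ (k + 1) := by
  rw [Nat.div_div_eq_div_mul, pow_succ]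

section

attribute [local simp] wp Expr.eval Expr.Fits Op.eval div_pow_succ

theorem headCount_spec {W n p P q j c a : ℕ} {K : ℕ → ℕ} {σ : State} (hp : Params W n p P q K)
    (hσ : Ctx n p P q K σ) (hj : σ.reg rJ = j) (hjP : j ≤ P) (hc : σ.reg rC = c) (hcW : c ≤ W)
    (ha : σ.reg rA = a) (haq : a < q) :
    Runs W headCount σ (100 * (j + 1)) fun τ =>
      τ.reg rH = a * (c % n) % q % (4 * P) ∧ τ.reg rCnt = hashHits n q (4 * P) a c j := by
  obtain ⟨b1, b2, b3, b4, b5, b6, b7, b8, b9⟩ := hp.bounds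
  have hn0 : 0 < n := by have := hp.two_le; omega
  have hax : ∀ x, a * (x % n) ≤ W := fun x =>
    (Nat.mul_le_mul haq.le (Nat.mod_lt x hn0).le).trans b5
  have hh : ∀ x, x % q % (4 * P) ≤ W := fun x =>
    (Nat.mod_lt _ (by have := hp.one_le; omega)).le.trans b3
  refine (Runs.seq (T := 90) (T' := 68 * j + 6)
    ((Runs.of_wp (Q := fun τ => τ.reg rH = a * (c % n) % q % (4 * P) ∧ τ.reg rCnt = 0 ∧
      τ.reg rCur = c) ?_).mono (by decide) ?_)).mono (by omega) fun _ => id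
  · simp only [wp]
    refine ⟨fits_hash ?_ ?_ ?_ ?_ ?_, ?_⟩ <;>
      simp [eval_hash, hσ.n_eq, hσ.q_eq, hσ.R_eq, ha, hc, hax, b1, b3, b4, hcW, haq.le.trans b4]
  · rintro τ ⟨h1, h2, h3⟩ hf
    have hτ := hσ.of_frame hf rfl
    have hjτ : τ.reg rJ = j := (hf.1 rJ rfl).trans hj
    have haτ : τ.reg rA = a := (hf.1 rA rfl).trans ha
    refine (Runs.forUp (N := j) (T := fun _ => 60) (I := fun k ρ =>
      ρ.reg rH = a * (c % n) % q % (4 * P) ∧ ρ.reg rCur = c / n ^ k ∧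
      ρ.reg rCnt = hashHits n q (4 * P) a c k)
      hjτ (by omega) (by omega) rfl rfl (by decide) ?_ ?_).mono ?_ ?_
    · simp [h1, h2, h3, hashHits]
    · rintro k ρ hk hkρ hfρ ⟨i1, i2, i3⟩
      have hρ := hτ.of_frame hfρ rfl
      have haρ : ρ.reg rA = a := (hfρ.1 rA rfl).trans haτ
      have hcc : ∀ k, c / n ^ k ≤ W := fun k => (Nat.div_le_self _ _).trans hcW
      have hcn : hashHits n q (4 * P) a c (k + 1) ≤ W := (sum_ite_le _ _).trans (by omega)
      have hcn' := hashHits_succ n q (4 * P) a c k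
      refine (Runs.of_wp ?_).mono (by decide) fun _ => id
      simp only [wp]
      refine ⟨⟨?_, ⟨fits_hash ?_ ?_ ?_ ?_ ?_, ?_, ?_⟩, ?_⟩, ?_⟩ <;>
        simp [eval_hash, hρ.n_eq, hρ.q_eq, hρ.R_eq, haρ, i1, i2, i3, hax, hh, hcc, b1, b3, b4,
          ← hcn', hcn, haq.le.trans b4]
      · omega
      · split_ifs <;> omega
    · simp
      omega
    · rintro ρ ⟨i1, i2, i3⟩
      exact ⟨i1, i3⟩

end

/-! ### Scoring a tuple -/

theorem sum_ite_eq_one_iff (p : ℕ → Prop) [DecidablePred p] (j : ℕ) :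
    ∑ i ∈ Finset.range j, (if p i then 1 else 0) = 1 ↔ ∃ i < j, ∀ l < j, p l ↔ l = i := by
  rw [← Finset.card_filter, Finset.card_eq_one]
  refine exists_congr fun i => ⟨fun h => ?_, fun ⟨hi, h⟩ => ?_⟩
  · have key : ∀ l, (l < j ∧ p l) ↔ l = i := by
      intro l
      rw [← Finset.mem_singleton, ← h, Finset.mem_filter, Finset.mem_range]
    have hi := (key i).2 rfl
    exact ⟨hi.1, fun l hl => ⟨fun hp => (key l).1 ⟨hl, hp⟩, fun h' => h' ▸ hi.2⟩⟩
  · ext l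
    rw [Finset.mem_filter, Finset.mem_range, Finset.mem_singleton]
    exact ⟨fun h' => (h l h'.1).1 h'.2, fun h' => ⟨h' ▸ hi, (h l (h' ▸ hi)).2 h'⟩⟩

/-- There is exactly one hit, and it is among the first `k`. -/
theorem sum_ite_eq_one_and_iff (p : ℕ → Prop) [DecidablePred p] {j k : ℕ} (hk : k ≤ j) :
    (∑ i ∈ Finset.range j, (if p i then 1 else 0) = 1 ∧
      ∑ i ∈ Finset.range j, (if p i ∧ i < k then 1 else 0) = 1) ↔
      ∃ i < k, ∀ l < j, p l ↔ l = i := by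
  rw [sum_ite_eq_one_iff, sum_ite_eq_one_iff]
  constructor
  · rintro ⟨⟨i, hi, h⟩, i', hi', h'⟩
    have h2 := (h' i' hi').2 rfl
    have h1 : i' = i := (h i' hi').1 h2.1
    exact ⟨i, h1 ▸ h2.2, h⟩
  · rintro ⟨i, hi, h⟩
    refine ⟨⟨i, by omega, h⟩, i, by omega, fun l hl => ?_⟩
    rw [h l hl]
    exact ⟨fun h' => h'.1, fun h' => ⟨h', h' ▸ hi⟩⟩

theorem headIsolated_iff {n q R a s j c : ℕ} (hn : 0 < n) (hj : 0 < j) :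
    HeadIsolated (hashRow n q R a s) (tuple hn j c) ↔
      a * (c % n) % q % R = s ∧ hashHits n q R a c j = 1 := by
  rw [hashHits, sum_ite_eq_one_iff]
  constructor
  · rintro ⟨i, hi, h⟩
    have h0 : a * (c % n) % q % R = s := by
      have := h i
      simpa [hashRow, tuple, hi] using this
    refine ⟨h0, 0, hj, fun l hl => ?_⟩
    have := h ⟨l, hl⟩
    simp only [hashRow, tuple, Fin.ext_iff, hi] at this
    rw [h0]
    exact decide_eq_decide.1 this
  · rintro ⟨h0, i, hi, h⟩
    have hi0 : 0 = i := (h 0 hj).1 (by simp)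
    refine ⟨⟨0, hj⟩, rfl, fun l => ?_⟩
    have := h l.1 l.2
    rw [← hi0] at this
    subst h0
    simp only [hashRow, tuple, Fin.ext_iff]
    exact decide_eq_decide.2 this

section

attribute [local simp] wp Expr.eval Expr.Fits Op.eval div_pow_succ

theorem scoreTuple_spec {W n p P q j c bk : ℕ} {K : ℕ → ℕ} {σ : State} (hp : Params W n p P q K)
    (hn : 0 < n)
    (hσ : Ctx n p P q K σ) (hj : σ.reg rJ = j) (hj0 : 0 < j) (hjP : j ≤ P) (hc : σ.reg rC = c)
    (hcW : c ≤ W) (hbk : σ.reg rBk = bk) (hW : ∀ g < q * (4 * P), σ.arr 5 g + bk ≤ W) :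
    Runs W scoreTuple σ (200 * (P + 1) * q) fun τ => ∀ g < q * (4 * P),
      τ.arr 5 g = σ.arr 5 g + if HeadIsolated (hashRow n q (4 * P) (g / (4 * P)) (g % (4 * P)))
        (tuple hn j c) then bk else 0 := by
  obtain ⟨b1, b2, b3, b4, b5, b6, b7, b8, b9⟩ := hp.bounds
  have hP := hp.one_le
  have hq0 := hp.prime.pos
  refine (Runs.forUp (N := q) (T := fun _ => 100 * (P + 1) + 60) (I := fun k ρ =>
    ∀ g < q * (4 * P), ρ.arr 5 g = σ.arr 5 g + if g / (4 * P) < k ∧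
      HeadIsolated (hashRow n q (4 * P) (g / (4 * P)) (g % (4 * P))) (tuple hn j c) then bk else 0)
      hσ.q_eq b4 (by omega) rfl rfl (by decide) ?_ ?_).mono ?_ ?_
  · simp
  · intro a ρ ha haρ hf hI
    have hρ := hσ.of_frame hf rfl
    have hjρ : ρ.reg rJ = j := (hf.1 rJ rfl).trans hj
    have hcρ : ρ.reg rC = c := (hf.1 rC rfl).trans hc
    have hbρ : ρ.reg rBk = bk := (hf.1 rBk rfl).trans hbk
    refine Runs.seq (((headCount_spec hp hρ hjρ hjP hcρ hcW haρ ha).mono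
      (Nat.mul_le_mul_left 100 (show j + 1 ≤ P + 1 by omega))) ?_)
    rintro τ ⟨h1, h2⟩ hfτ
    have hτ := hρ.of_frame hfτ rfl
    have haτ : τ.reg rA = a := (hfτ.1 rA rfl).trans haρ
    have hbτ : τ.reg rBk = bk := (hfτ.1 rBk rfl).trans hbρ
    have h5 : τ.arr 5 = ρ.arr 5 := hfτ.2 5 rfl
    set H := a * (c % n) % q % (4 * P) with hH
    have hHR : H < 4 * P := Nat.mod_lt _ (by omega)
    have hidx : a * (4 * P) + H < q * (4 * P) := by
      have : (a + 1) * (4 * P) ≤ q * (4 * P) := Nat.mul_le_mul_right _ ha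
      rw [Nat.add_mul] at this
      omega
    have hdiv : (a * (4 * P) + H) / (4 * P) = a := by
      rw [Nat.add_comm, Nat.add_mul_div_right _ _ (by omega), Nat.div_eq_of_lt hHR, Nat.zero_add]
    have hmod : (a * (4 * P) + H) % (4 * P) = H := by
      rw [Nat.mul_add_mod_self_right, Nat.mod_eq_of_lt hHR]
    have hold : ρ.arr 5 (a * (4 * P) + H) = σ.arr 5 (a * (4 * P) + H) := by
      rw [hI _ hidx, hdiv]
      simp
    have hwx := hW _ hidx
    refine (Runs.of_wp ?_).mono (show _ ≤ 60 by decide) fun _ => id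
    have hbb : bk * (if hashHits n q (4 * P) a c j = 1 then 1 else 0) ≤ bk := by
      split_ifs <;> omega
    simp [haτ, hbτ, h1, h2, hτ.R_eq, h5, hold]
    refine ⟨⟨⟨by omega, b3, by omega⟩, by omega, by omega⟩, ⟨⟨⟨⟨⟨by omega, b3, by omega⟩, by omega,
      by omega⟩, by omega⟩, ⟨by omega, ⟨?_, by omega, ?_⟩, ?_⟩, ?_⟩, ?_⟩⟩
    · exact (sum_ite_le _ _).trans (by omega)
    · split_ifs <;> omega
    · split_ifs <;> omega
    · split_ifs <;> omega
    · intro g hg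
      rcases eq_or_ne g (a * (4 * P) + H) with rfl | hne
      · rw [Function.update_self, hdiv, hmod]
        simp only [headIsolated_iff hn hj0, ← hH, le_refl, true_and]
      · rw [Function.update_of_ne hne, hI g hg]
        congr 1
        refine if_congr ⟨fun h => ⟨h.1.le, h.2⟩, fun h => ⟨lt_of_le_of_ne h.1 fun ha' => hne ?_, h.2⟩⟩
          rfl rfl
        have := ((headIsolated_iff hn hj0).1 h.2).1
        rw [ha', ← hH] at this
        rw [this, ← ha']
        exact (Nat.div_add_mod' g (4 * P)).symm
  · rw [Finset.sum_const, Finset.card_range, smul_eq_mul]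
    nlinarith
  · intro τ h g hg
    rw [h g hg]
    have : g / (4 * P) < q := by rwa [Nat.div_lt_iff_lt_mul (by omega)]
    simp [this]

end

/-! ### Scoring all rows -/

theorem sum_pow_le {n : ℕ} (hn : 2 ≤ n) (P : ℕ) : ∑ j ∈ Finset.range (P + 1), n ^ j ≤ 2 * n ^ P := by
  induction P with
  | zero => simp
  | succ P ih =>
    rw [Finset.sum_range_succ]
    have : 2 * n ^ P ≤ n ^ (P + 1) := by
      rw [pow_succ, mul_comm]
      exact Nat.mul_le_mul_left _ hn
    omega

theorem Params.pow_le {W n p P q : ℕ} {K : ℕ → ℕ} (h : Params W n p P q K) {j : ℕ}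
    (hj : j ≤ P + 1) : n ^ j ≤ W :=
  h.le_pow (by have := h.le_p; omega) le_rfl

theorem Params.slot_le {W n p P q : ℕ} {K : ℕ → ℕ} (h : Params W n p P q K) {j c : ℕ}
    (hj : j ≤ P) (hc : c < n ^ j) : c * (P + 1) + j ≤ W := by
  have hn := h.two_le
  obtain ⟨-, hPn, -⟩ := h.bounds
  have h1 : c * (P + 1) ≤ n ^ P * n :=
    Nat.mul_le_mul (hc.le.trans (Nat.pow_le_pow_right (by omega) hj)) hPn
  have h2 : n ≤ n ^ P * n := Nat.le_mul_of_pos_left _ (by positivity)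
  refine h.le_pow (e := P + 2) (by have := h.le_p; omega) ?_
  calc c * (P + 1) + j ≤ n ^ P * n * 2 := by omega
    _ ≤ n ^ P * n * n := Nat.mul_le_mul_left _ hn
    _ = n ^ (P + 2) := by ring

section

attribute [local simp] wp Expr.eval Expr.Fits Op.eval div_pow_succ

/-- The rule for loops over the active levels. -/
theorem forLevels_spec {W n p P q : ℕ} {K : ℕ → ℕ} {σ : State} (hp : Params W n p P q K)
    (hσ : Ctx n p P q K σ) {c : Cmd} (T : ℕ) (I : ℕ → State → Prop)
    (hc : (forLevels c).keeps = true) (hcJ : c.wr rJ = false) (hcPw : c.wr rPw = false)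
    (h0 : I 0 σ) (hJ : ∀ k τ x, I k τ → I k (τ.setReg rJ x))
    (hPw : ∀ k τ x, I k τ → I k (τ.setReg rPw x))
    (hstep : ∀ j ≤ P, K j ≠ 0 → ∀ τ, Ctx n p P q K τ → Frame (forLevels c) σ τ → τ.reg rJ = j →
      τ.reg rPw = n ^ j → I j τ → Runs W c τ (n ^ j * T) (I (j + 1)))
    (hskip : ∀ j ≤ P, K j = 0 → ∀ τ, I j τ → I (j + 1) τ) :
    Runs W (forLevels c) σ (n ^ P * (2 * T + 50)) (I (P + 1)) := by
  obtain ⟨b1, b2, b3, b4, b5, b6, b7, b8, b9⟩ := hp.bounds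
  have hn0 : 0 < n := by have := hp.two_le; omega
  refine Runs.mono (T := 2 + (∑ k ∈ Finset.range (P + 1), ((n ^ k * T + 8) + 8) + 6))
    (Q := I (P + 1)) ?_ ?_ fun _ => id
  · refine Runs.seq ((Runs.of_wp (Q := fun τ => τ = σ.setReg rPw 1) ?_).mono (by decide) ?_)
    · simp
      omega
    · rintro τ₀ hτ₀ hfτ₀
      have hτ : Ctx n p P q K τ₀ := by
        rw [hτ₀]
        constructor <;> simp [hσ.n_eq, hσ.P_eq, hσ.q_eq, hσ.R_eq, hσ.L_eq, hσ.G_eq, hσ.X_eq]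
        exact hσ.K_eq
      have hkeep : (forUp rJ rL (.seq (.ite (.get 2 (.reg rJ)) c .skip)
          (.set rPw (.bin .mul (.reg rPw) (.reg rN))))).keeps = true := by
        simpa [forLevels, Cmd.keeps, Cmd.wr, Cmd.wa] using hc
      refine (Runs.forUp (N := P + 1) (T := fun j => n ^ j * T + 8) (I := fun j τ =>
        I j τ ∧ τ.reg rPw = n ^ j) hτ.L_eq (by omega) (by omega) ?_ ?_ (by decide) ?_ ?_).mono
        le_rfl fun τ h => h.1
      · simp [Cmd.wr, hcJ]
      · have := hkeep
        simp only [Cmd.keeps, Bool.not_eq_true', Bool.or_eq_false_iff, forUp, Cmd.wr] at this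
        simp [Cmd.wr, this]
      · rw [hτ₀]
        refine ⟨hJ _ _ _ (hPw _ _ _ h0), by simp⟩
      · rintro j ρ hj hjρ hfρ ⟨hI, hpw⟩
        have hρ := hτ.of_frame hfρ hkeep
        have hjP : j ≤ P := by omega
        have hfσ : Frame (forLevels c) σ ρ := by
          refine Frame.trans (hfτ₀.mono ?_ ?_) (hfρ.mono ?_ ?_) <;> intro r hr <;>
            simp_all [forLevels, Cmd.wr, Cmd.wa]
        have hKj := hρ.K_eq j hjP
        have hKW : K j ≤ W := (hp.K_le j hjP).trans (by omega)
        have hbody : Runs W (.ite (.get 2 (.reg rJ)) c .skip) ρ (n ^ j * T + 4)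
            (I (j + 1)) := by
          by_cases h : K j = 0
          · have h' : Runs W .skip ρ 1 (I (j + 1)) := Runs.of_wp (c := .skip) (hskip j hjP h ρ hI)
            refine (Runs.ite (T := 1) ?_ (fun h2 => absurd ?_ h2) fun _ => h').mono ?_ fun _ => id
            · simp [hjρ, hKj]
              omega
            · simp [hjρ, hKj, h]
            · simp [Expr.cost]
          · refine (Runs.ite ?_ (fun _ => hstep j hjP h ρ hρ hfσ hjρ hpw hI)
              fun h2 => absurd h2 ?_).mono ?_ fun _ => id
            · simp [hjρ, hKj]
              omega
            · simp [hjρ, hKj, h]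
            · simp [Expr.cost]
              omega
        have hjρ' : ∀ τ, Frame (.ite (.get 2 (.reg rJ)) c .skip) ρ τ → τ.reg rPw = n ^ j ∧
            τ.reg rN = n := by
          intro τ hf
          have hN : c.wr rN = false := by
            simp only [Cmd.keeps, Bool.not_eq_true', Bool.or_eq_false_iff, forUp, Cmd.wr] at hkeep
            simp [hkeep]
          exact ⟨(hf.1 rPw (by simp [Cmd.wr, hcPw])).trans hpw,
            (hf.1 rN (by simp [Cmd.wr, hN])).trans hρ.n_eq⟩
        refine (Runs.seq (T' := 4) (hbody.mono le_rfl ?_)).mono (by omega) fun _ => id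
        intro τ hIτ hfτ
        obtain ⟨h1, h2⟩ := hjρ' τ hfτ
        refine (Runs.of_wp ?_).mono (by decide) fun _ => id
        have h3 : n ^ (j + 1) ≤ W := hp.pow_le (by omega)
        simp [h1, h2, h3, b1, hp.pow_le (show j ≤ P + 1 by omega), ← pow_succ]
        exact hJ _ _ _ (hPw _ _ _ hIτ)
  · have h1 : ∑ k ∈ Finset.range (P + 1), ((n ^ k * T + 8) + 8) ≤
        ∑ k ∈ Finset.range (P + 1), n ^ k * (T + 16) := by
      refine Finset.sum_le_sum fun k _ => ?_
      have : 1 ≤ n ^ k := Nat.one_le_pow _ _ hn0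
      nlinarith
    rw [← Finset.sum_mul] at h1
    have h2 := Nat.mul_le_mul_right (T + 16) (sum_pow_le hp.two_le P)
    have : 1 ≤ n ^ P := Nat.one_le_pow _ _ hn0
    nlinarith

/-- The rule for loops over the surviving tuples of a level. -/
theorem forAlive_spec {W n p P q j : ℕ} {K : ℕ → ℕ} {σ : State} (hp : Params W n p P q K)
    (hσ : Ctx n p P q K σ) (hj : σ.reg rJ = j) (hjP : j ≤ P) (hpw : σ.reg rPw = n ^ j)
    {c : Cmd} (T : ℕ) (A : ℕ → Prop) [DecidablePred A] (I : ℕ → State → Prop)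
    (hc : (forAlive c).keeps = true) (hcC : c.wr rC = false) (hcJ : c.wr rJ = false)
    (hcPw : c.wr rPw = false)
    (h0 : I 0 σ) (hC : ∀ k τ x, I k τ → I k (τ.setReg rC x))
    (hA : ∀ k < n ^ j, ∀ τ, Frame (forAlive c) σ τ → I k τ →
      τ.arr 4 (k * (P + 1) + j) = if A k then 0 else 1)
    (hstep : ∀ k < n ^ j, A k → ∀ τ, Ctx n p P q K τ → Frame (forAlive c) σ τ → τ.reg rJ = j →
      τ.reg rC = k → I k τ → Runs W c τ T (I (k + 1)))
    (hskip : ∀ k < n ^ j, ¬ A k → ∀ τ, I k τ → I (k + 1) τ) :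
    Runs W (forAlive c) σ (n ^ j * (T + 20) + 6) (I (n ^ j)) := by
  obtain ⟨b1, b2, b3, b4, b5, b6, b7, b8, b9⟩ := hp.bounds
  refine (Runs.forUp (N := n ^ j) (T := fun _ => T + 12) (I := I) hpw
    (hp.pow_le (by omega)) (by omega) ?_ ?_ (by decide) (hC _ _ _ h0) ?_).mono ?_ fun _ => id
  · simp [Cmd.wr, hcC]
  · simp [Cmd.wr, hcPw]
  · intro k τ hk hkτ hf hI
    have hτ := hσ.of_frame hf hc
    have hjτ : τ.reg rJ = j := (hf.1 rJ (by simp [forUp, Cmd.wr, hcJ])).trans hj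
    have hdead := hA k hk τ hf hI
    have hslot := hp.slot_le hjP hk
    have hkW : k ≤ W := hk.le.trans (hp.pow_le (by omega))
    have hfit : (Expr.bin .eq (.get 4 .slot) (.const 0)).Fits W τ := by
      simp [Expr.slot, hkτ, hjτ, hτ.L_eq, hdead, hkW]
      refine ⟨⟨⟨⟨?_, ?_⟩, ?_, ?_⟩, ?_⟩, ?_⟩
      any_goals omega
      · split_ifs <;> omega
      · split_ifs <;> omega
    by_cases h : A k
    · refine (Runs.ite hfit (fun _ => (hstep k hk h τ hτ hf hjτ hkτ hI).mono le_rfl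
        fun τ hτ => hC _ _ _ hτ) fun h2 => absurd h2 ?_).mono ?_ fun _ => id
      · simp [Expr.slot, hkτ, hjτ, hτ.L_eq, hdead, h]
      · simp only [Expr.cost, Expr.slot]
        omega
    · refine (Runs.ite (T := 1) hfit (fun h2 => absurd ?_ h2) fun _ =>
        Runs.of_wp (c := .skip) ?_).mono ?_ fun _ => id
      · simp [Expr.slot, hkτ, hjτ, hτ.L_eq, hdead, h]
      · exact hC _ _ _ (hskip k hk h τ hI)
      · simp only [Expr.cost, Expr.slot]
        omega
  · simp only [Finset.sum_const, Finset.card_range, smul_eq_mul]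
    exact le_rfl

end

/-- The array of removed tuples agrees with the set of surviving tuples. -/
def Stored (n P : ℕ) (K : ℕ → ℕ) (L : List (Fin n → Bool)) (hn : 0 < n) (σ : State) : Prop :=
  ∀ j ≤ P, K j ≠ 0 → ∀ c < n ^ j,
    σ.arr 4 (c * (P + 1) + j) = if tuple hn j c ∈ alive n j (K j) L then 0 else 1

section

attribute [local simp] wp Expr.eval Expr.Fits Op.eval div_pow_succ

theorem scoreLevel_spec {W n p P q j bk : ℕ} {K : ℕ → ℕ} {L : List (Fin n → Bool)} {σ : State}
    (hp : Params W n p P q K) (hn : 0 < n) (hσ : Ctx n p P q K σ) (hj : σ.reg rJ = j)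
    (hj0 : 0 < j) (hjP : j ≤ P) (hpw : σ.reg rPw = n ^ j) (hK : K j ≠ 0)
    (hst : Stored n P K L hn σ) (hbk : σ.reg rBk = bk)
    (hW : ∀ g < q * (4 * P), σ.arr 5 g + n ^ j * bk ≤ W) :
    Runs W (forAlive scoreTuple) σ (n ^ j * (200 * (P + 1) * q + 20) + 6) fun τ =>
      ∀ g < q * (4 * P), τ.arr 5 g = σ.arr 5 g + bk * ((alive n j (K j) L).filter
        (HeadIsolated (hashRow n q (4 * P) (g / (4 * P)) (g % (4 * P))))).card := by
  refine (forAlive_spec hp hσ hj hjP hpw (200 * (P + 1) * q)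
    (fun c => tuple hn j c ∈ alive n j (K j) L)
    (fun k τ => ∀ g < q * (4 * P), τ.arr 5 g = σ.arr 5 g + ∑ c ∈ Finset.range k,
      if tuple hn j c ∈ alive n j (K j) L ∧ HeadIsolated (hashRow n q (4 * P) (g / (4 * P))
        (g % (4 * P))) (tuple hn j c) then bk else 0) rfl rfl rfl rfl (by simp) (by simp)
    ?_ ?_ ?_).mono le_rfl ?_
  · intro k hk τ hf _
    rw [hf.2 4 rfl]
    exact hst j hjP hK k hk
  · intro k hk hA τ hτ hf hjτ hkτ hI
    refine (scoreTuple_spec hp hn hτ hjτ hj0 hjP hkτ (hk.le.trans (hp.pow_le (by omega)))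
      ((hf.1 rBk rfl).trans hbk) ?_).mono le_rfl ?_
    · intro g hg
      refine le_trans ?_ (hW g hg)
      rw [hI g hg, Nat.add_assoc]
      refine Nat.add_le_add_left ?_ _
      calc _ ≤ k * bk + bk := by
            refine Nat.add_le_add_right ?_ _
            refine (Finset.sum_le_card_nsmul _ _ bk fun c _ => ?_).trans (by simp)
            split_ifs <;> omega
        _ = (k + 1) * bk := by ring
        _ ≤ _ := Nat.mul_le_mul_right _ hk
    · intro ρ hρ g hg
      rw [hρ g hg, hI g hg, Finset.sum_range_succ, Nat.add_assoc]
      simp [hA]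
  · intro k hk hA τ hI g hg
    rw [hI g hg, Finset.sum_range_succ]
    simp [hA]
  · intro τ hI g hg
    rw [hI g hg, sum_tuple hn j fun f => if f ∈ alive n j (K j) L ∧
      HeadIsolated (hashRow n q (4 * P) (g / (4 * P)) (g % (4 * P))) f then bk else 0,
      Finset.sum_ite, Finset.sum_const_zero, Finset.sum_const, smul_eq_mul, Nat.add_zero, mul_comm]
    congr 3
    ext f
    simp

/-- The largest numbers that occur are the scores. -/
theorem Params.score_le {W n p P q : ℕ} {K : ℕ → ℕ} (hp : Params W n p P q K) :
    (P + 2) * (n ^ P * ((P + 1) * n ^ (p + 4) * P)) ≤ W := by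
  obtain ⟨-, hPn, -⟩ := hp.bounds
  have h2 := hp.two_le
  have h3 := hp.le_p
  have h4 : n ^ P ≤ n ^ p := Nat.pow_le_pow_right (by omega) h3
  refine hp.le_pow (e := 2 * p + 8) (by omega) ?_
  calc (P + 2) * (n ^ P * ((P + 1) * n ^ (p + 4) * P))
      ≤ (n * n) * (n ^ p * (n * n ^ (p + 4) * n)) := by
        gcongr <;> nlinarith
    _ = n ^ (2 * p + 8) := by ring

theorem computeScores_spec {W n p P q : ℕ} {K : ℕ → ℕ} {L : List (Fin n → Bool)} {σ : State}
    (hp : Params W n p P q K) (hn : 0 < n) (hσ : Ctx n p P q K σ)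
    (hst : Stored n P K L hn σ)
    (hβ : ∀ j ≤ P, K j ≠ 0 → σ.arr 3 j ≤ (P + 1) * n ^ (p + 4)) :
    Runs W computeScores σ (2000 * (n ^ P * (P * q))) fun τ =>
      ∀ g < q * (4 * P), τ.arr 5 g = score n q P K (σ.arr 3) L g := by
  obtain ⟨b1, b2, b3, b4, b5, b6, b7, b8, b9⟩ := hp.bounds
  have hscore := hp.score_le
  have hclear : Runs W (forUp rG rGt (.put 5 (.reg rG) (.const 0))) σ (q * (4 * P) * 11 + 6)
      fun τ => ∀ g < q * (4 * P), τ.arr 5 g = 0 := by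
    refine (Runs.forUp (N := q * (4 * P)) (T := fun _ => 3)
      (I := fun k τ => ∀ g < k, τ.arr 5 g = 0) hσ.G_eq b6 (by omega) rfl rfl (by decide)
      (by simp) ?_).mono (by simp) fun _ => id
    intro k τ hk hkτ hf hI
    refine (Runs.of_wp ?_).mono (by decide) fun _ => id
    simp [hkτ]
    refine ⟨by omega, fun g hg => ?_⟩
    rcases eq_or_ne g k with rfl | hne
    · simp
    · rw [Function.update_of_ne hne, hI g (by omega)]
  refine (Runs.seq (T' := n ^ P * (2 * (200 * (P + 1) * q + 50) + 50))
    (hclear.mono le_rfl ?_)).mono ?_ fun _ => id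
  · intro τ h0 hf
    have hτ := hσ.of_frame hf rfl
    have hstτ : τ.arr 4 = σ.arr 4 := hf.2 4 rfl
    have h3τ : τ.arr 3 = σ.arr 3 := hf.2 3 rfl
    refine (forLevels_spec hp hτ (200 * (P + 1) * q + 50) (fun k ρ => ∀ g < q * (4 * P),
      ρ.arr 5 g = ∑ j ∈ Finset.range k, σ.arr 3 j * K j * ((alive n j (K j) L).filter
        (HeadIsolated (hashRow n q (4 * P) (g / (4 * P)) (g % (4 * P))))).card)
      rfl rfl rfl ?_ (by simp) (by simp) ?_ ?_).mono le_rfl ?_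
    · simpa using h0
    · intro j hjP hK ρ hρ hfρ hjρ hpw hI
      have h3 : ρ.arr 3 = σ.arr 3 := (hfρ.2 3 rfl).trans h3τ
      have h4 : ρ.arr 4 = σ.arr 4 := (hfρ.2 4 rfl).trans hstτ
      have hKj := hp.K_le j hjP
      have hbk : ∀ i ≤ P, K i ≠ 0 → σ.arr 3 i * K i ≤ (P + 1) * n ^ (p + 4) * P := fun i hi hKi =>
        Nat.mul_le_mul (hβ i hi hKi) ((hp.K_le i hi).trans hi)
      have hnP : 1 ≤ n ^ P := Nat.one_le_pow _ _ hn
      have hBW : (P + 1) * n ^ (p + 4) * P ≤ W := by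
        refine le_trans ?_ hscore
        exact (Nat.le_mul_of_pos_left _ hnP).trans (Nat.le_mul_of_pos_left _ (by omega))
      have hβW : σ.arr 3 j ≤ W :=
        ((hβ j hjP hK).trans (Nat.le_mul_of_pos_right _ hp.one_le)).trans hBW
      refine (Runs.seq (T := 7) (T' := n ^ j * (200 * (P + 1) * q + 20) + 6)
        ((Runs.of_wp (Q := fun π => π = ρ.setReg rBk (σ.arr 3 j * K j)) ?_).mono
          (by decide) ?_)).mono ?_ fun _ => id
      · simp [hjρ, h3, hρ.K_eq j hjP, hβW, (hbk j hjP hK).trans hBW]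
        omega
      · rintro π hπ hfπ
        have hπc := hρ.of_frame hfπ rfl
        have h5 : π.arr 5 = ρ.arr 5 := by rw [hπ]; rfl
        refine (scoreLevel_spec (L := L) (bk := σ.arr 3 j * K j) hp hn hπc
          ((hfπ.1 rJ rfl).trans hjρ) (by omega) hjP
          ((hfπ.1 rPw rfl).trans hpw) hK ?_ (by simp [hπ]) ?_).mono le_rfl ?_
        · intro i hi hKi c hc
          rw [hπ, State.setReg_arr, h4]
          exact hst i hi hKi c hc
        · intro g hg
          rw [h5, hI g hg]
          refine le_trans ?_ hscore
          have e1 : ∀ i ≤ P, K i ≠ 0 → ∀ x ≤ n ^ i, σ.arr 3 i * K i * x ≤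
              n ^ P * ((P + 1) * n ^ (p + 4) * P) := fun i hi hKi x hx => by
            rw [mul_comm]
            exact Nat.mul_le_mul (hx.trans (Nat.pow_le_pow_right hn hi)) (hbk i hi hKi)
          have e2 : ∑ i ∈ Finset.range j, σ.arr 3 i * K i * ((alive n i (K i) L).filter
              (HeadIsolated (hashRow n q (4 * P) (g / (4 * P)) (g % (4 * P))))).card ≤
              j * (n ^ P * ((P + 1) * n ^ (p + 4) * P)) := by
            refine (Finset.sum_le_card_nsmul _ _ (n ^ P * ((P + 1) * n ^ (p + 4) * P))
              fun i hi => ?_).trans (le_of_eq (by simp))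
            have hi := Finset.mem_range.1 hi
            by_cases hKi : K i = 0
            · simp [hKi]
            · exact e1 i (by omega) hKi _ ((Finset.card_filter_le _ _).trans (card_alive_le _ _ _ _))
          have e3 := e1 j hjP hK _ le_rfl
          calc _ ≤ j * (n ^ P * ((P + 1) * n ^ (p + 4) * P)) +
                n ^ P * ((P + 1) * n ^ (p + 4) * P) := by
                refine Nat.add_le_add e2 ?_
                rwa [mul_comm (n ^ j)]
            _ = (j + 1) * (n ^ P * ((P + 1) * n ^ (p + 4) * P)) := by ring
            _ ≤ _ := Nat.mul_le_mul_right _ (by omega)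
        · intro υ hυ g hg
          rw [hυ g hg, h5, hI g hg, Finset.sum_range_succ]
      · have : 1 ≤ n ^ j := Nat.one_le_pow _ _ hn
        nlinarith
    · intro j hjP hK ρ hI g hg
      rw [hI g hg, Finset.sum_range_succ, hK]
      simp
    · intro ρ hI g hg
      exact hI g hg
  · have h1 : 1 ≤ n ^ P := Nat.one_le_pow _ _ hn
    have h2 : 1 ≤ P * q := Nat.mul_pos hp.one_le hp.prime.pos
    have h3 : q ≤ P * q := Nat.le_mul_of_pos_left _ hp.one_le
    have h4 : P * q ≤ n ^ P * (P * q) := Nat.le_mul_of_pos_left _ h1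
    have h5 : n ^ P * q ≤ n ^ P * (P * q) := Nat.mul_le_mul_left _ h3
    have h6 : n ^ P ≤ n ^ P * (P * q) := Nat.le_mul_of_pos_right _ h2
    calc _ = 44 * (P * q) + 6 + (400 * (n ^ P * (P * q)) + 400 * (n ^ P * q) + 150 * n ^ P) := by
          ring
      _ ≤ _ := by omega

end

/-! ### Choosing a row and testing a tuple against it -/

section

attribute [local simp] wp Expr.eval Expr.Fits Op.eval div_pow_succ

theorem findBest_spec {W n p P q : ℕ} {K : ℕ → ℕ} {σ : State} (hp : Params W n p P q K)
    (hσ : Ctx n p P q K σ) (hW : ∀ g < q * (4 * P), σ.arr 5 g ≤ W) :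
    Runs W findBest σ (200 * (P * q)) fun τ => τ.reg rArg < q * (4 * P) ∧
      ∀ g < q * (4 * P), σ.arr 5 g ≤ σ.arr 5 (τ.reg rArg) := by
  obtain ⟨b1, b2, b3, b4, b5, b6, b7, b8, b9⟩ := hp.bounds
  have hG : 0 < q * (4 * P) := Nat.mul_pos hp.prime.pos (by have := hp.one_le; omega)
  refine (Runs.seq (T := 5) (T' := q * (4 * P) * 24 + 6)
    ((Runs.of_wp (Q := fun τ => τ.reg rBest = σ.arr 5 0 ∧ τ.reg rArg = 0) ?_).mono
      (by decide) ?_)).mono ?_ fun _ => id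
  · simp [hW 0 hG]
  · rintro τ ⟨h1, h2⟩ hf
    have hτ := hσ.of_frame hf rfl
    have h5 : τ.arr 5 = σ.arr 5 := hf.2 5 rfl
    refine (Runs.forUp (N := q * (4 * P)) (T := fun _ => 16) (I := fun k ρ =>
      ρ.reg rBest = σ.arr 5 (ρ.reg rArg) ∧ ρ.reg rArg < q * (4 * P) ∧
      ∀ g < k, σ.arr 5 g ≤ ρ.reg rBest) hτ.G_eq b6 (by omega) rfl rfl (by decide) ?_ ?_).mono
      ?_ ?_
    · simp [h1, h2]
      exact ⟨hp.prime.pos, hp.one_le⟩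
    · rintro k ρ hk hkρ hfρ ⟨i1, i2, i3⟩
      have h5ρ : ρ.arr 5 = σ.arr 5 := (hfρ.2 5 rfl).trans h5
      refine (Runs.of_wp ?_).mono (by decide) fun _ => id
      have hk5 := hW k hk
      have hb := hW _ i2
      simp [hkρ, h5ρ, i1, hb, hk5, hk, i2]
      refine ⟨⟨by omega, by split_ifs <;> omega⟩, fun h => ⟨by omega, fun g hg => ?_⟩,
        fun h g hg => ?_⟩
      · rcases Nat.lt_or_eq_of_le hg with hg | rfl
        · have := i3 g hg
          omega
        · exact le_rfl
      · rcases Nat.lt_or_eq_of_le hg with hg | rfl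
        · have := i3 g hg
          omega
        · exact h
    · simp
    · rintro ρ ⟨i1, i2, i3⟩
      exact ⟨i2, fun g hg => i1 ▸ i3 g hg⟩
  · have : q * (4 * P) = 4 * (P * q) := by ring
    have : 1 ≤ P * q := Nat.mul_pos hp.one_le hp.prime.pos
    omega

theorem writeRow_spec {W n p P q g m : ℕ} {K : ℕ → ℕ} {σ : State} (hp : Params W n p P q K)
    (hσ : Ctx n p P q K σ) (hg : σ.reg rArg = g) (hgq : g < q * (4 * P)) (hm : σ.reg rM = m)
    (hmW : (m + 1) * n ≤ W) :
    Runs W writeRow σ (100 * n) fun τ => (∀ i < m * n, τ.arr 1 i = σ.arr 1 i) ∧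
      ∀ x : Fin n, τ.arr 1 (m * n + x) =
        if hashRow n q (4 * P) (g / (4 * P)) (g % (4 * P)) x then 1 else 0 := by
  obtain ⟨b1, b2, b3, b4, b5, b6, b7, b8, b9⟩ := hp.bounds
  have hP := hp.one_le
  have hn := hp.two_le
  have ha : g / (4 * P) < q := by rwa [Nat.div_lt_iff_lt_mul (by omega)]
  have hmn : m * n + n ≤ W := by rwa [Nat.add_mul, Nat.one_mul] at hmW
  have hmW' : m ≤ m * n := Nat.le_mul_of_pos_right _ (by omega)
  have hs : g % (4 * P) < 4 * P := Nat.mod_lt _ (by omega)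
  refine (Runs.seq (T := 12) (T' := n * 58 + 6)
    ((Runs.of_wp (Q := fun τ => τ.reg rA = g / (4 * P) ∧ τ.reg rH = g % (4 * P)) ?_).mono
      (by decide) ?_)).mono (by omega) fun _ => id
  · simp [hg, hσ.R_eq]
    omega
  · rintro τ ⟨h1, h2⟩ hf
    have hτ := hσ.of_frame hf rfl
    have hmτ : τ.reg rM = m := (hf.1 rM rfl).trans hm
    have h1τ : τ.arr 1 = σ.arr 1 := hf.2 1 rfl
    refine (Runs.forUp (N := n) (T := fun _ => 50) (I := fun k ρ =>
      (∀ i < m * n, ρ.arr 1 i = σ.arr 1 i) ∧ ∀ x : Fin n, x.val < k → ρ.arr 1 (m * n + x) =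
        if hashRow n q (4 * P) (g / (4 * P)) (g % (4 * P)) x then 1 else 0)
      hτ.n_eq b1 (by omega) rfl rfl (by decide) ?_ ?_).mono ?_ ?_
    · simp [h1τ]
    · rintro k ρ hk hkρ hfρ ⟨i1, i2⟩
      have hρ := hτ.of_frame hfρ rfl
      have haρ : ρ.reg rA = g / (4 * P) := (hfρ.1 rA rfl).trans h1
      have hHρ : ρ.reg rH = g % (4 * P) := (hfρ.1 rH rfl).trans h2
      have hmρ : ρ.reg rM = m := (hfρ.1 rM rfl).trans hmτ
      have hak : g / (4 * P) * k ≤ W := (Nat.mul_le_mul ha.le hk.le).trans b5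
      have hh : g / (4 * P) * k % q % (4 * P) ≤ W := (Nat.mod_lt _ (by omega)).le.trans b3
      refine (Runs.of_wp ?_).mono (by decide) fun _ => id
      simp only [wp]
      refine ⟨?_, ⟨fits_hash ?_ ?_ ?_ ?_ ?_, ?_, ?_⟩, ?_⟩ <;>
        simp [eval_hash, hρ.n_eq, hρ.q_eq, hρ.R_eq, haρ, hHρ, hmρ, hkρ, b1, b3, b4, hak,
          ha.le.trans b4, hs.le.trans b3]
      · omega
      · omega
      · split_ifs <;> omega
      · refine ⟨fun i hi => ?_, fun x hx => ?_⟩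
        · rw [Function.update_of_ne (by omega), i1 i hi]
        · rcases Nat.lt_succ_iff_lt_or_eq.1 (Nat.lt_succ_of_le hx) with hx | hx
          · rw [Function.update_of_ne (by omega), i2 x hx]
          · rw [hx, Function.update_self]
            simp [hashRow, hx]
    · simp
    · rintro ρ ⟨i1, i2⟩
      exact ⟨i1, fun x => i2 x x.2⟩

/-- The number of ones of the row among the first `t` entries of the tuple. -/
def rowHits {n : ℕ} (row : Fin n → Bool) (hn : 0 < n) (c t : ℕ) : ℕ :=
  ∑ i ∈ Finset.range t, if row ⟨c / n ^ i % n, Nat.mod_lt _ hn⟩ then 1 else 0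

/-- The number of ones of the row among the first `min t k` entries of the tuple. -/
def lowHits {n : ℕ} (row : Fin n → Bool) (hn : 0 < n) (c k t : ℕ) : ℕ :=
  ∑ i ∈ Finset.range t, if row ⟨c / n ^ i % n, Nat.mod_lt _ hn⟩ ∧ i < k then 1 else 0

theorem rowHits_succ {n : ℕ} (row : Fin n → Bool) (hn : 0 < n) (c t : ℕ) :
    rowHits row hn c (t + 1) = rowHits row hn c t +
      if row ⟨c / n ^ t % n, Nat.mod_lt _ hn⟩ then 1 else 0 :=
  Finset.sum_range_succ _ _

theorem lowHits_succ {n : ℕ} (row : Fin n → Bool) (hn : 0 < n) (c k t : ℕ) :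
    lowHits row hn c k (t + 1) = lowHits row hn c k t +
      if row ⟨c / n ^ t % n, Nat.mod_lt _ hn⟩ ∧ t < k then 1 else 0 :=
  Finset.sum_range_succ _ _

theorem hits_iff {n j k c : ℕ} {row : Fin n → Bool} (hn : 0 < n) (hk : k ≤ j) :
    (rowHits row hn c j = 1 ∧ lowHits row hn c k j = 1) ↔
      ∃ i : Fin j, i.val < k ∧ Isolates row (tuple hn j c) i := by
  rw [rowHits, lowHits,
    sum_ite_eq_one_and_iff (fun i => row ⟨c / n ^ i % n, Nat.mod_lt _ hn⟩ = true) hk]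
  constructor
  · rintro ⟨i, hi, h⟩
    refine ⟨⟨i, by omega⟩, hi, fun l => ?_⟩
    rw [Bool.eq_iff_iff, decide_eq_true_iff, Fin.ext_iff]
    exact h l l.2
  · rintro ⟨i, hi, h⟩
    refine ⟨i, hi, fun l hl => ?_⟩
    have := h ⟨l, hl⟩
    rwa [Bool.eq_iff_iff, decide_eq_true_iff, Fin.ext_iff] at this

theorem rowCount_spec {W n p P q j c m : ℕ} {K : ℕ → ℕ} {σ : State} {row : Fin n → Bool}
    (hp : Params W n p P q K) (hn : 0 < n) (hσ : Ctx n p P q K σ) (hj : σ.reg rJ = j)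
    (hjP : j ≤ P) (hc : σ.reg rC = c) (hcW : c ≤ W) (hm : σ.reg rM = m) (hmW : (m + 1) * n ≤ W)
    (hrow : ∀ x : Fin n, σ.arr 1 (m * n + x) = if row x then 1 else 0) :
    Runs W rowCount σ (100 * (j + 1)) fun τ =>
      τ.reg rCnt = rowHits row hn c j ∧ τ.reg rCntk = lowHits row hn c (K j) j := by
  obtain ⟨b1, b2, b3, b4, b5, b6, b7, b8, b9⟩ := hp.bounds
  have hP := hp.one_le
  have hmn : m * n + n ≤ W := by rwa [Nat.add_mul, Nat.one_mul] at hmW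
  have hmW' : m ≤ m * n := Nat.le_mul_of_pos_right _ (by omega)
  refine (Runs.seq (T := 10) (T' := j * 58 + 6)
    ((Runs.of_wp (Q := fun τ => τ.reg rCnt = 0 ∧ τ.reg rCntk = 0 ∧ τ.reg rCur = c) ?_).mono
      (by decide) ?_)).mono (by omega) fun _ => id
  · simp [hc, hcW]
  · rintro τ ⟨h1, h2, h3⟩ hf
    have hτ := hσ.of_frame hf rfl
    have hmτ : τ.reg rM = m := (hf.1 rM rfl).trans hm
    have hjτ : τ.reg rJ = j := (hf.1 rJ rfl).trans hj
    have h1τ : τ.arr 1 = σ.arr 1 := hf.2 1 rfl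
    refine (Runs.forUp (N := j) (T := fun _ => 50) (I := fun t ρ =>
      ρ.reg rCnt = rowHits row hn c t ∧ ρ.reg rCntk = lowHits row hn c (K j) t ∧
        ρ.reg rCur = c / n ^ t)
      hjτ (by omega) (by omega) rfl rfl (by decide) ?_ ?_).mono ?_ ?_
    · simp [h1, h2, h3, rowHits, lowHits]
    · rintro t ρ ht htρ hfρ ⟨i1, i2, i3⟩
      have hρ := hτ.of_frame hfρ rfl
      have hmρ : ρ.reg rM = m := (hfρ.1 rM rfl).trans hmτ
      have hjρ : ρ.reg rJ = j := (hfρ.1 rJ rfl).trans hjτ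
      have h1ρ : ρ.arr 1 = σ.arr 1 := (hfρ.2 1 rfl).trans h1τ
      have hcc : ∀ k, c / n ^ k ≤ W := fun k => (Nat.div_le_self _ _).trans hcW
      have hd := Nat.mod_lt (c / n ^ t) hn
      have hbit : σ.arr 1 (m * n + c / n ^ t % n) =
        if row ⟨c / n ^ t % n, Nat.mod_lt _ hn⟩ then 1 else 0 := hrow ⟨_, hd⟩
      have hr : rowHits row hn c t ≤ t := sum_ite_le _ _
      have hl : lowHits row hn c (K j) t ≤ t := sum_ite_le _ _
      have hK := hp.K_le j hjP
      refine (Runs.of_wp ?_).mono (by decide) fun _ => id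
      simp [hρ.n_eq, hmρ, hjρ, htρ, h1ρ, i1, i2, i3, hcc, b1, hρ.K_eq j hjP, hbit, rowHits_succ,
        lowHits_succ]
      cases row ⟨c / n ^ t % n, Nat.mod_lt _ hn⟩ <;> by_cases htk : t < K j <;> simp [htk] <;> omega
    · simp
    · rintro ρ ⟨i1, i2, i3⟩
      exact ⟨i1, i2⟩

theorem slot_inj {P c c' j j' : ℕ} (hj : j ≤ P) (hj' : j' ≤ P)
    (h : c * (P + 1) + j = c' * (P + 1) + j') : c = c' ∧ j = j' := by
  have h1 := congrArg (· / (P + 1)) h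
  have h2 := congrArg (· % (P + 1)) h
  simp only [Nat.mul_add_mod_self_right] at h2
  rw [Nat.mod_eq_of_lt (by omega), Nat.mod_eq_of_lt (by omega)] at h2
  simp only [Nat.add_comm (_ * _)] at h1
  rw [Nat.add_mul_div_right _ _ (by omega), Nat.add_mul_div_right _ _ (by omega),
    Nat.div_eq_of_lt (by omega), Nat.div_eq_of_lt (by omega)] at h1
  omega

theorem updateTuple_spec {W n p P q j c m : ℕ} {K : ℕ → ℕ} {σ : State} {row : Fin n → Bool}
    (hp : Params W n p P q K) (hn : 0 < n) (hσ : Ctx n p P q K σ) (hj : σ.reg rJ = j)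
    (hjP : j ≤ P) (hc : σ.reg rC = c) (hcj : c < n ^ j) (hm : σ.reg rM = m)
    (hmW : (m + 1) * n ≤ W)
    (hrow : ∀ x : Fin n, σ.arr 1 (m * n + x) = if row x then 1 else 0)
    (hlev : σ.reg rLev + 1 ≤ W) :
    Runs W updateTuple σ (200 * (P + 1)) fun τ =>
      (∀ i, i ≠ c * (P + 1) + j → τ.arr 4 i = σ.arr 4 i) ∧
      τ.arr 4 (c * (P + 1) + j) =
        (if ∃ i : Fin j, i.val < K j ∧ Isolates row (tuple hn j c) i then 1 else 0) ∧
      τ.reg rLev = σ.reg rLev +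
        if ∃ i : Fin j, i.val < K j ∧ Isolates row (tuple hn j c) i then 0 else 1 := by
  obtain ⟨b1, b2, b3, b4, b5, b6, b7, b8, b9⟩ := hp.bounds
  have hcW : c ≤ W := hcj.le.trans (hp.pow_le (by omega))
  have hslot := hp.slot_le hjP hcj
  refine (Runs.seq (T := 100 * (j + 1)) (T' := 100)
    ((rowCount_spec hp hn hσ hj hjP hc hcW hm hmW hrow).mono le_rfl ?_)).mono (by omega)
    fun _ => id
  rintro τ ⟨h1, h2⟩ hf
  have hτ := hσ.of_frame hf rfl
  have hjτ : τ.reg rJ = j := (hf.1 rJ rfl).trans hj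
  have hcτ : τ.reg rC = c := (hf.1 rC rfl).trans hc
  have h4τ : τ.arr 4 = σ.arr 4 := hf.2 4 rfl
  have hlτ : τ.reg rLev = σ.reg rLev := hf.1 rLev rfl
  have hr : rowHits row hn c j ≤ j := sum_ite_le _ _
  have hl : lowHits row hn c (K j) j ≤ j := sum_ite_le _ _
  refine (Runs.of_wp ?_).mono (by decide) fun _ => id
  simp only [← hits_iff hn (hp.K_le j hjP)]
  simp [Expr.slot, hjτ, hcτ, hτ.L_eq, h1, h2, h4τ, hlτ, hcW]
  by_cases e1 : rowHits row hn c j = 1 <;> by_cases e2 : lowHits row hn c (K j) j = 1 <;>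
    simp [e1, e2] <;>
    exact ⟨by omega, by omega, by omega, fun i hi => Function.update_of_ne hi _ _⟩

end

/-! ### Updating the survivors and the weights -/

/-- The array of removed tuples is up to date with the list `f j c` of rows for the tuple with code
`c` at level `j`. -/
def StoredFor (n P : ℕ) (K : ℕ → ℕ) (f : ℕ → ℕ → List (Fin n → Bool)) (hn : 0 < n)
    (σ : State) : Prop :=
  ∀ j ≤ P, K j ≠ 0 → ∀ c < n ^ j,
    σ.arr 4 (c * (P + 1) + j) = if tuple hn j c ∈ alive n j (K j) (f j c) then 0 else 1

theorem mem_alive_append {n j k : ℕ} {L : List (Fin n → Bool)} {row : Fin n → Bool}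
    {f : Fin j → Fin n} : f ∈ alive n j k (L ++ [row]) ↔
      f ∈ alive n j k L ∧ ¬ ∃ i : Fin j, i.val < k ∧ Isolates row f i := by
  rw [alive_append, Finset.mem_filter]

section

attribute [local simp] wp Expr.eval Expr.Fits Op.eval div_pow_succ

theorem updateLevel_spec {W n p P q j m : ℕ} {K : ℕ → ℕ} {σ : State} {row : Fin n → Bool}
    {L : List (Fin n → Bool)}
    (hp : Params W n p P q K) (hn : 0 < n) (hσ : Ctx n p P q K σ) (hj : σ.reg rJ = j)
    (hjP : j ≤ P) (hpw : σ.reg rPw = n ^ j) (hKj : K j ≠ 0) (hm : σ.reg rM = m)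
    (hmW : (m + 1) * n ≤ W)
    (hrow : ∀ x : Fin n, σ.arr 1 (m * n + x) = if row x then 1 else 0)
    (hst : StoredFor n P K (fun i _ => if i < j then L ++ [row] else L) hn σ) :
    Runs W (.seq (.set rLev (.const 0)) (forAlive updateTuple)) σ
      (n ^ j * (200 * (P + 1) + 20) + 8) fun τ =>
      StoredFor n P K (fun i _ => if i < j + 1 then L ++ [row] else L) hn τ ∧
      τ.reg rLev = (alive n j (K j) (L ++ [row])).card := by
  have hset : Runs W (.set rLev (.const 0)) σ 2 fun τ => τ = σ.setReg rLev 0 :=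
    Runs.of_wp (c := .set rLev (.const 0)) (by simp)
  refine (Runs.seq (T' := n ^ j * (200 * (P + 1) + 20) + 6)
    (hset.mono le_rfl ?_)).mono (by omega) fun _ => id
  intro τ hτ hf
  have hτc := hσ.of_frame hf rfl
  have hstτ : StoredFor n P K (fun i _ => if i < j then L ++ [row] else L) hn τ := by
    rw [hτ]
    exact hst
  refine (forAlive_spec hp hτc ((hf.1 rJ rfl).trans hj) hjP ((hf.1 rPw rfl).trans hpw)
    (200 * (P + 1)) (fun c => tuple hn j c ∈ alive n j (K j) L)
    (fun k ρ => StoredFor n P K (fun i c => if i < j ∨ (i = j ∧ c < k) then L ++ [row] else L) hn ρ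
      ∧ ρ.reg rLev = ∑ c ∈ Finset.range k,
        if tuple hn j c ∈ alive n j (K j) (L ++ [row]) then 1 else 0)
    rfl rfl rfl rfl ?_ ?_ ?_ ?_ ?_).mono le_rfl ?_
  · simpa [hτ] using hstτ
  · rintro k ρ x ⟨i1, i2⟩
    exact ⟨i1, by simpa using i2⟩
  · rintro k hk ρ - ⟨i1, -⟩
    rw [i1 j hjP hKj k hk]
    simp
  · rintro k hk hA ρ hρ hfρ hjρ hkρ ⟨i1, i2⟩
    have hlev : ρ.reg rLev + 1 ≤ W := by
      have h1 : ρ.reg rLev ≤ k := by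
        rw [i2]
        exact sum_ite_le _ _
      have h2 := hp.pow_le (show j ≤ P + 1 by omega)
      omega
    refine (updateTuple_spec (row := row) hp hn hρ hjρ hjP hkρ hk ((hfρ.1 rM rfl).trans
      ((hf.1 rM rfl).trans hm)) hmW ?_ hlev).mono le_rfl ?_
    · intro x
      rw [hfρ.2 1 rfl, hf.2 1 rfl]
      exact hrow x
    · rintro π ⟨h1, h2, h3⟩
      refine ⟨fun i hi hKi c hc => ?_, ?_⟩
      · by_cases hs : c = k ∧ i = j
        · obtain ⟨rfl, rfl⟩ := hs
          rw [h2]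
          beta_reduce
          rw [if_pos (show i < i ∨ (i = i ∧ c < c + 1) by omega)]
          simp only [mem_alive_append, hA, true_and]
          split_ifs <;> rfl
        · rw [h1 _ fun h => hs (slot_inj hi hjP h), i1 i hi hKi c hc]
          have : (i < j ∨ i = j ∧ c < k) ↔ (i < j ∨ i = j ∧ c < k + 1) := by omega
          simp only [this]
      · rw [h3, i2, Finset.sum_range_succ]
        congr 1
        simp only [mem_alive_append, hA, true_and]
        split_ifs <;> rfl
  · rintro k hk hA ρ ⟨i1, i2⟩
    have hA' : tuple hn j k ∉ alive n j (K j) (L ++ [row]) := fun h => hA (mem_alive_append.1 h).1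
    refine ⟨fun i hi hKi c hc => ?_, ?_⟩
    · rw [i1 i hi hKi c hc]
      by_cases hs : c = k ∧ i = j
      · obtain ⟨rfl, rfl⟩ := hs
        beta_reduce
        rw [if_neg (show ¬ (i < i ∨ (i = i ∧ c < c)) by omega),
          if_pos (show i < i ∨ (i = i ∧ c < c + 1) by omega), if_neg hA, if_neg hA']
      · have : (i < j ∨ i = j ∧ c < k) ↔ (i < j ∨ i = j ∧ c < k + 1) := by omega
        simp only [this]
    · rw [i2, Finset.sum_range_succ, if_neg hA', Nat.add_zero]
  · rintro ρ ⟨i1, i2⟩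
    refine ⟨fun i hi hKi c hc => ?_, ?_⟩
    · rw [i1 i hi hKi c hc]
      have : (i < j ∨ i = j ∧ c < n ^ j) ↔ i < j + 1 := by
        constructor
        · omega
        · intro h
          rcases Nat.lt_succ_iff_lt_or_eq.1 h with h | rfl
          · exact Or.inl h
          · exact Or.inr ⟨rfl, hc⟩
      simp only [this]
    · rw [i2, sum_tuple hn j fun f => if f ∈ alive n j (K j) (L ++ [row]) then 1 else 0]
      simp

/-- The largest weight that may occur, with room for its product with another small number. -/
theorem Params.weight_le {W n p P q : ℕ} {K : ℕ → ℕ} (hp : Params W n p P q K) :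
    2 * ((P + 1) * n ^ (p + 4) * n) ≤ W := by
  obtain ⟨-, hPn, -⟩ := hp.bounds
  have h2 := hp.two_le
  have h3 := hp.le_p
  refine hp.le_pow (e := p + 7) (by omega) ?_
  calc 2 * ((P + 1) * n ^ (p + 4) * n) ≤ n * (n * n ^ (p + 4) * n) := by gcongr
    _ = n ^ (p + 7) := by ring

theorem sum_card_alive_le {W n p P q k : ℕ} {K : ℕ → ℕ} (hp : Params W n p P q K)
    (L : List (Fin n → Bool)) (hk : k ≤ P + 1) :
    ∑ j ∈ Finset.range k, (alive n j (K j) L).card ≤ W := by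
  have h1 : ∑ j ∈ Finset.range k, (alive n j (K j) L).card ≤ ∑ j ∈ Finset.range (P + 1), n ^ j :=
    (Finset.sum_le_sum fun j _ => card_alive_le _ _ _ _).trans
      (Finset.sum_le_sum_of_subset (Finset.range_mono hk))
  refine (h1.trans (sum_pow_le hp.two_le P)).trans ((?_ : _ ≤ n ^ (P + 1)).trans
    (hp.pow_le le_rfl))
  rw [pow_succ, mul_comm]
  exact Nat.mul_le_mul_left _ hp.two_le

theorem update_spec {W n p P q m : ℕ} {K : ℕ → ℕ} {σ : State} {row : Fin n → Bool}
    {L : List (Fin n → Bool)}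
    (hp : Params W n p P q K) (hn : 0 < n) (hσ : Ctx n p P q K σ) (hm : σ.reg rM = m)
    (hmW : (m + 1) * n ≤ W)
    (hrow : ∀ x : Fin n, σ.arr 1 (m * n + x) = if row x then 1 else 0)
    (hst : Stored n P K L hn σ)
    (hβ : ∀ j ≤ P, K j ≠ 0 → σ.arr 3 j ≤ (P + 1) * n ^ (p + 4)) :
    Runs W update σ (2000 * (n ^ P * P)) fun τ => Stored n P K (L ++ [row]) hn τ ∧
      τ.reg rTot = ∑ j ∈ Finset.range (P + 1), (alive n j (K j) (L ++ [row])).card ∧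
      ∀ j ≤ P, K j ≠ 0 → τ.arr 3 j = nextWeight n P K (σ.arr 3) (L ++ [row]) j := by
  obtain ⟨b1, b2, b3, b4, b5, b6, b7, b8, b9⟩ := hp.bounds
  have hset : Runs W (.set rTot (.const 0)) σ 2 fun τ => τ = σ.setReg rTot 0 :=
    Runs.of_wp (c := .set rTot (.const 0)) (by simp)
  refine (Runs.seq (T' := n ^ P * (2 * (200 * (P + 1) + 80) + 50))
    (hset.mono le_rfl ?_)).mono ?_ fun _ => id
  · intro τ hτ hf
    have hτc := hσ.of_frame hf rfl
    refine (forLevels_spec hp hτc (200 * (P + 1) + 80) (fun k ρ =>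
      StoredFor n P K (fun i _ => if i < k then L ++ [row] else L) hn ρ ∧
      ρ.reg rTot = ∑ j ∈ Finset.range k, (alive n j (K j) (L ++ [row])).card ∧
      ∀ i ≤ P, K i ≠ 0 → ρ.arr 3 i = if i < k then nextWeight n P K (σ.arr 3) (L ++ [row]) i
        else σ.arr 3 i) rfl rfl rfl ?_ ?_ ?_ ?_ ?_).mono le_rfl ?_
    · rw [hτ]
      exact ⟨by simpa [StoredFor, Stored] using hst, by simp, by simp⟩
    · rintro k ρ x ⟨i1, i2, i3⟩
      exact ⟨i1, by simpa using i2, i3⟩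
    · rintro k ρ x ⟨i1, i2, i3⟩
      exact ⟨i1, by simpa using i2, i3⟩
    · rintro j hjP hKj ρ hρ hfρ hjρ hpw ⟨i1, i2, i3⟩
      have h1ρ : ρ.arr 1 = σ.arr 1 := (hfρ.2 1 rfl).trans (hf.2 1 rfl)
      refine (Runs.seq (T := n ^ j * (200 * (P + 1) + 20) + 8) (T' := 32)
        ((updateLevel_spec hp hn hρ hjρ hjP hpw hKj
        ((hfρ.1 rM rfl).trans ((hf.1 rM rfl).trans hm)) hmW (fun x => by rw [h1ρ]; exact hrow x)
        i1).mono le_rfl ?_)).mono ?_ fun _ => id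
      · rintro π ⟨s1, s2⟩ hfπ
        have hπ := hρ.of_frame hfπ rfl
        have hjπ : π.reg rJ = j := (hfπ.1 rJ rfl).trans hjρ
        have hTπ := (hfπ.1 rTot rfl).trans i2
        have h3π : π.arr 3 = ρ.arr 3 := hfπ.2 3 rfl
        have h3j : π.arr 3 j = σ.arr 3 j := by
          rw [h3π, i3 j hjP hKj, if_neg (by omega)]
        have hcW := sum_card_alive_le hp (L ++ [row]) (show j + 1 ≤ P + 1 by omega)
        rw [Finset.sum_range_succ] at hcW
        have hw := hp.weight_le
        have hβj := hβ j hjP hKj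
        have hKn : K j ≤ n := (hp.K_le j hjP).trans (by omega)
        have e1 : σ.arr 3 j * K j ≤ (P + 1) * n ^ (p + 4) * n := Nat.mul_le_mul hβj hKn
        have e2 : σ.arr 3 j ≤ (P + 1) * n ^ (p + 4) * n :=
          hβj.trans (Nat.le_mul_of_pos_right _ hn)
        have e3 : σ.arr 3 j * K j / (16 * P) ≤ σ.arr 3 j * K j := Nat.div_le_self _ _
        have hP := hp.one_le
        have s1' : ∀ i ≤ P, K i ≠ 0 → ∀ c < n ^ i, π.arr 4 (c * (P + 1) + i) =
            if tuple hn i c ∈ alive n i (K i) (if i ≤ j then L ++ [row] else L) then 0 else 1 := by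
          simpa [StoredFor] using s1
        have h16 : 4 * (4 * P) = 16 * P := by ring
        have hKeq := hπ.K_eq j hjP
        refine (Runs.of_wp ?_).mono (by decide) fun _ => id
        simp [s2, hTπ, hjπ, h3j, hKeq, hπ.R_eq, h16]
        refine ⟨⟨by omega, by omega, hcW⟩, by omega, fun hne => ?_, fun he => ?_⟩
        · refine ⟨by omega, by omega, s1', ?_, fun i hi hKi => ?_⟩
          · rw [Finset.sum_range_succ]
          · rcases eq_or_ne i j with rfl | hij
            · rw [Function.update_self, if_pos (by omega), nextWeight, if_neg]
              exact (Finset.card_ne_zero.2 (Finset.nonempty_iff_ne_empty.2 hne))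
            · rw [Function.update_of_ne hij, h3π, i3 i hi hKi]
              have : i < j ↔ i ≤ j := by omega
              simp only [this]
        · refine ⟨s1', ?_, fun i hi hKi => ?_⟩
          · rw [Finset.sum_range_succ]
          · rcases eq_or_ne i j with rfl | hij
            · rw [h3j, if_pos le_rfl, nextWeight, if_pos (by rw [he]; rfl)]
            · rw [h3π, i3 i hi hKi]
              have : i < j ↔ i ≤ j := by omega
              simp only [this]
      · have : 1 ≤ n ^ j := Nat.one_le_pow _ _ hn
        nlinarith
    · rintro j hjP hKj ρ ⟨i1, i2, i3⟩
      have hlt : ∀ i, K i ≠ 0 → (i < j ↔ i < j + 1) := by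
        intro i hKi
        have : i ≠ j := fun h => hKi (h ▸ hKj)
        omega
      refine ⟨fun i hi hKi c hc => ?_, ?_, fun i hi hKi => ?_⟩
      · rw [i1 i hi hKi c hc]
        simp only [hlt i hKi]
      · rw [i2, Finset.sum_range_succ]
        simp [alive, hKj]
      · rw [i3 i hi hKi]
        simp only [hlt i hKi]
    · rintro ρ ⟨i1, i2, i3⟩
      refine ⟨fun i hi hKi c hc => ?_, i2, fun i hi hKi => ?_⟩
      · rw [i1 i hi hKi c hc]
        beta_reduce
        rw [if_pos (show i < P + 1 by omega)]
      · rw [i3 i hi hKi, if_pos (by omega)]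
  · have h1 : 1 ≤ n ^ P := Nat.one_le_pow _ _ hn
    have h2 : 1 ≤ P := hp.one_le
    have h3 : n ^ P ≤ n ^ P * P := Nat.le_mul_of_pos_right _ h2
    calc _ = 2 + (400 * (n ^ P * P) + 610 * n ^ P) := by ring
      _ ≤ _ := by omega

end

/-! ### Recognizing injective tuples -/

/-- The number of pairs `(i, l)`, `i < s`, `l < j`, of positions with equal entries. -/
def pairHits (n c j s : ℕ) : ℕ :=
  ∑ i ∈ Finset.range s, ∑ l ∈ Finset.range j, if c / n ^ i % n = c / n ^ l % n then 1 else 0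

theorem injective_iff {n j c : ℕ} (hn : 0 < n) :
    (tuple hn j c).Injective ↔ pairHits n c j j = j := by
  have hge : ∀ i ∈ Finset.range j, 1 ≤ ∑ l ∈ Finset.range j,
      if c / n ^ i % n = c / n ^ l % n then 1 else 0 := fun i hi => by
    refine le_trans ?_ (Finset.single_le_sum (f := fun l =>
      if c / n ^ i % n = c / n ^ l % n then 1 else 0) (fun _ _ => Nat.zero_le _) hi)
    simp
  have h1 : pairHits n c j j = j ↔ ∀ i ∈ Finset.range j, 1 = ∑ l ∈ Finset.range j,
      if c / n ^ i % n = c / n ^ l % n then 1 else 0 := by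
    rw [← Finset.sum_eq_sum_iff_of_le hge]
    simp [pairHits, eq_comm]
  rw [h1]
  constructor
  · intro h i hi
    rw [eq_comm, sum_ite_eq_one_iff]
    have hi := Finset.mem_range.1 hi
    refine ⟨i, hi, fun l hl => ⟨fun h' => ?_, fun h' => h' ▸ rfl⟩⟩
    have := @h ⟨i, hi⟩ ⟨l, hl⟩ (Fin.ext h')
    exact (congrArg Fin.val this).symm
  · intro h i l hil
    have h2 := h i (Finset.mem_range.2 i.2)
    rw [eq_comm, sum_ite_eq_one_iff] at h2
    obtain ⟨a, -, ha⟩ := h2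
    have h3 := (ha i i.2).1 rfl
    have h4 := (ha l l.2).1 (congrArg Fin.val hil)
    exact Fin.ext (h3.trans h4.symm)

section

attribute [local simp] wp Expr.eval Expr.Fits Op.eval div_pow_succ

theorem pairCount_spec {W n p P q j c : ℕ} {K : ℕ → ℕ} {σ : State} (hp : Params W n p P q K)
    (hσ : Ctx n p P q K σ) (hj : σ.reg rJ = j) (hjP : j ≤ P) (hc : σ.reg rC = c) (hcW : c ≤ W) :
    Runs W pairCount σ (100 * ((P + 1) * (P + 1))) fun τ => τ.reg rCnt = pairHits n c j j := by
  obtain ⟨b1, b2, b3, b4, b5, b6, b7, b8, b9⟩ := hp.bounds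
  have hn := hp.two_le
  have hcc : ∀ k, c / n ^ k ≤ W := fun k => (Nat.div_le_self _ _).trans hcW
  have hjj : j * j ≤ W := (Nat.mul_le_mul (by omega) (by omega)).trans b7
  have hpair : ∀ s, pairHits n c j s ≤ s * j := fun s => by
    refine (Finset.sum_le_card_nsmul _ _ j fun i _ => ?_).trans (by simp)
    exact sum_ite_le _ _
  refine (Runs.seq (T := 6) (T' := j * (j * 38 + 26) + 6)
    ((Runs.of_wp (Q := fun τ => τ.reg rCnt = 0 ∧ τ.reg rCur = c) ?_).mono
      (by decide) ?_)).mono ?_ fun _ => id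
  · simp [hc, hcW]
  · rintro τ ⟨h1, h2⟩ hf
    have hτ := hσ.of_frame hf rfl
    have hjτ : τ.reg rJ = j := (hf.1 rJ rfl).trans hj
    have hcτ : τ.reg rC = c := (hf.1 rC rfl).trans hc
    refine (Runs.forUp (N := j) (T := fun _ => j * 38 + 18) (I := fun s ρ =>
      ρ.reg rCnt = pairHits n c j s ∧ ρ.reg rCur = c / n ^ s)
      hjτ (by omega) (by omega) rfl rfl (by decide) ?_ ?_).mono ?_ ?_
    · simp [h1, h2, pairHits]
    · rintro s ρ hs hsρ hfρ ⟨i1, i2⟩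
      have hρ := hτ.of_frame hfρ rfl
      have hjρ : ρ.reg rJ = j := (hfρ.1 rJ rfl).trans hjτ
      have hcρ : ρ.reg rC = c := (hfρ.1 rC rfl).trans hcτ
      have hset : Runs W (.set rCurr (.reg rC)) ρ 2 fun π => π = ρ.setReg rCurr c :=
        Runs.of_wp (c := .set rCurr (.reg rC)) (by simp [hcρ, hcW])
      refine (Runs.seq (T := 2 + (j * 38 + 6)) (T' := 4) ((Runs.seq (T' := j * 38 + 6)
        (hset.mono le_rfl ?_) : Runs W _ ρ _ fun π => π.reg rCnt = pairHits n c j (s + 1)).mono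
        le_rfl ?_)).mono (by omega) fun _ => id
      · rintro π hπ hfπ
        have hπc := hρ.of_frame hfπ rfl
        refine (Runs.forUp (N := j) (T := fun _ => 30) (I := fun t υ =>
          υ.reg rCurr = c / n ^ t ∧ υ.reg rCnt = pairHits n c j s +
            ∑ l ∈ Finset.range t, if c / n ^ s % n = c / n ^ l % n then 1 else 0)
          ((hfπ.1 rJ rfl).trans hjρ) (by omega) (by omega) rfl rfl (by decide) ?_ ?_).mono ?_ ?_
        · simp [hπ, i1]
        · rintro t υ ht htυ hfυ ⟨k1, k2⟩
          have hυ := hπc.of_frame hfυ rfl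
          have hcur : υ.reg rCur = c / n ^ s :=
            (hfυ.1 rCur rfl).trans ((hfπ.1 rCur rfl).trans i2)
          have hle : pairHits n c j s + ∑ l ∈ Finset.range (t + 1),
              (if c / n ^ s % n = c / n ^ l % n then 1 else 0) ≤ W := by
            refine le_trans (Nat.add_le_add (hpair s) (sum_ite_le _ _)) ?_
            have : (s + 1) * j ≤ j * j := Nat.mul_le_mul_right _ hs
            rw [Nat.add_mul] at this
            omega
          rw [Finset.sum_range_succ, ← Nat.add_assoc, ← k2] at hle
          refine (Runs.of_wp ?_).mono (by decide) fun _ => id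
          have hle1 : (if c / n ^ s % n = c / n ^ t % n then 1 else 0) ≤ W := by
            split_ifs <;> omega
          rw [Finset.sum_range_succ, ← Nat.add_assoc, ← k2]
          simp [k1, hcur, hυ.n_eq, hcc, b1, hle, hle1]
          omega
        · simp
        · rintro υ ⟨k1, k2⟩
          rw [k2, pairHits, pairHits, Finset.sum_range_succ]
      · rintro π hπ hfπ
        have hcur : π.reg rCur = c / n ^ s := (hfπ.1 rCur rfl).trans i2
        have hN := (hρ.of_frame hfπ rfl).n_eq
        refine (Runs.of_wp ?_).mono (by decide) fun _ => id
        simp [hcur, hN, hπ, hcc, b1]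
    · simp
    · rintro ρ ⟨i1, i2⟩
      exact i1
  · have h1 : j * (j * 38 + 26) ≤ (P + 1) * ((P + 1) * 38 + 26) :=
      Nat.mul_le_mul (by omega) (by omega)
    nlinarith

end

/-! ### The greedy algorithm -/

section

attribute [local simp] wp Expr.eval Expr.Fits Op.eval div_pow_succ

theorem initTuple_spec {W n p P q j c : ℕ} {K : ℕ → ℕ} {σ : State} (hp : Params W n p P q K)
    (hn : 0 < n) (hσ : Ctx n p P q K σ) (hj : σ.reg rJ = j) (hjP : j ≤ P) (hc : σ.reg rC = c)
    (hcj : c < n ^ j) (hK : K j ≠ 0) (htot : σ.reg rTot + 1 ≤ W) :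
    Runs W initTuple σ (200 * ((P + 1) * (P + 1))) fun τ =>
      (∀ i, i ≠ c * (P + 1) + j → τ.arr 4 i = σ.arr 4 i) ∧
      τ.arr 4 (c * (P + 1) + j) = (if tuple hn j c ∈ alive n j (K j) [] then 0 else 1) ∧
      τ.reg rTot = σ.reg rTot + if tuple hn j c ∈ alive n j (K j) [] then 1 else 0 := by
  obtain ⟨b1, b2, b3, b4, b5, b6, b7, b8, b9⟩ := hp.bounds
  have hcW : c ≤ W := hcj.le.trans (hp.pow_le (by omega))
  have hslot := hp.slot_le hjP hcj
  have hsq : 1 ≤ (P + 1) * (P + 1) := Nat.mul_pos (by omega) (by omega)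
  refine (Runs.seq (T := 100 * ((P + 1) * (P + 1))) (T' := 100)
    ((pairCount_spec hp hσ hj hjP hc hcW).mono le_rfl ?_)).mono (by omega) fun _ => id
  intro τ h1 hf
  have hτ := hσ.of_frame hf rfl
  have hjτ : τ.reg rJ = j := (hf.1 rJ rfl).trans hj
  have hcτ : τ.reg rC = c := (hf.1 rC rfl).trans hc
  have h4τ : τ.arr 4 = σ.arr 4 := hf.2 4 rfl
  have hlτ : τ.reg rTot = σ.reg rTot := hf.1 rTot rfl
  have hpair : pairHits n c j j ≤ W := by
    refine (Finset.sum_le_card_nsmul _ _ j fun i _ => sum_ite_le _ _).trans ?_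
    simp only [Finset.card_range, smul_eq_mul]
    exact (Nat.mul_le_mul (by omega) (by omega)).trans b7
  have hmem : tuple hn j c ∈ alive n j (K j) [] ↔ pairHits n c j j = j := by
    rw [← injective_iff hn, mem_alive]
    simp [Nat.pos_of_ne_zero hK]
  refine (Runs.of_wp ?_).mono (by decide) fun _ => id
  simp only [hmem]
  simp [Expr.slot, hjτ, hcτ, hτ.L_eq, h1, h4τ, hlτ, hcW, hpair]
  by_cases e1 : pairHits n c j j = j <;> simp [e1] <;>
    exact ⟨by omega, by omega, by omega, fun i hi => Function.update_of_ne hi _ _⟩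

theorem initLevel_spec {W n p P q j : ℕ} {K : ℕ → ℕ} {σ : State}
    (hp : Params W n p P q K) (hn : 0 < n) (hσ : Ctx n p P q K σ) (hj : σ.reg rJ = j)
    (hjP : j ≤ P) (hpw : σ.reg rPw = n ^ j) (hKj : K j ≠ 0)
    (htot : σ.reg rTot + n ^ j ≤ W) :
    Runs W (forUp rC rPw initTuple) σ (n ^ j * (200 * ((P + 1) * (P + 1)) + 8) + 6) fun τ =>
      (∀ i ≤ P, i ≠ j → ∀ c, τ.arr 4 (c * (P + 1) + i) = σ.arr 4 (c * (P + 1) + i)) ∧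
      (∀ c < n ^ j, τ.arr 4 (c * (P + 1) + j) =
        if tuple hn j c ∈ alive n j (K j) [] then 0 else 1) ∧
      τ.reg rTot = σ.reg rTot + (alive n j (K j) []).card := by
  obtain ⟨b1, b2, b3, b4, b5, b6, b7, b8, b9⟩ := hp.bounds
  refine (Runs.forUp (N := n ^ j) (T := fun _ => 200 * ((P + 1) * (P + 1))) (I := fun k τ =>
      (∀ i ≤ P, i ≠ j → ∀ c, τ.arr 4 (c * (P + 1) + i) = σ.arr 4 (c * (P + 1) + i)) ∧
      (∀ c < k, τ.arr 4 (c * (P + 1) + j) =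
        if tuple hn j c ∈ alive n j (K j) [] then 0 else 1) ∧
      τ.reg rTot = σ.reg rTot + ∑ c ∈ Finset.range k,
        if tuple hn j c ∈ alive n j (K j) [] then 1 else 0) hpw (hp.pow_le (by omega)) (by omega)
      rfl rfl (by decide) ?_ ?_).mono ?_ ?_
  · simp
  · rintro k τ hk hkτ hf ⟨i1, i2, i3⟩
    have hτ := hσ.of_frame hf rfl
    have htotτ : τ.reg rTot + 1 ≤ W := by
      have h1 : ∑ c ∈ Finset.range k, (if tuple hn j c ∈ alive n j (K j) [] then 1 else 0) ≤ k :=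
        sum_ite_le _ _
      omega
    refine (initTuple_spec hp hn hτ ((hf.1 rJ rfl).trans hj) hjP hkτ hk hKj htotτ).mono le_rfl ?_
    rintro ρ ⟨h1, h2, h3⟩
    refine ⟨fun i hi hij c => ?_, fun c hc => ?_, ?_⟩
    · rw [State.setReg_arr, h1 _ fun h => hij (slot_inj hi hjP h).2, i1 i hi hij c]
    · rw [State.setReg_arr]
      rcases Nat.lt_succ_iff_lt_or_eq.1 hc with hc | rfl
      · rw [h1 _ fun h => hc.ne (slot_inj hjP hjP h).1, i2 c hc]
      · exact h2
    · simp only [State.setReg_reg]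
      rw [if_neg (by decide), h3, i3, Finset.sum_range_succ]
      omega
  · simp
  · rintro τ ⟨i1, i2, i3⟩
    refine ⟨i1, i2, ?_⟩
    rw [i3, sum_tuple hn j fun f => if f ∈ alive n j (K j) [] then 1 else 0]
    simp

theorem init_spec {W n p P q : ℕ} {K : ℕ → ℕ} {σ : State}
    (hp : Params W n p P q K) (hn : 0 < n) (hN : σ.reg rN = n) (hQ : σ.reg rQ = P)
    (hPr : σ.reg rPr = q) (hX : σ.reg rX = n ^ (p + 4)) (hK : ∀ j ≤ P, σ.arr 2 j = K j) :
    Runs W init σ (4000 * (n ^ P * (P * q))) fun τ => Ctx n p P q K τ ∧ Stored n P K [] hn τ ∧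
      τ.reg rTot = ∑ j ∈ Finset.range (P + 1), (alive n j (K j) []).card ∧
      ∀ j ≤ P, K j ≠ 0 → τ.arr 3 j = n ^ (p + 4 - j) := by
  obtain ⟨b1, b2, b3, b4, b5, b6, b7, b8, b9⟩ := hp.bounds
  refine (Runs.seq (T := 16) (T' := n ^ P * (2 * (200 * ((P + 1) * (P + 1)) + 30) + 50))
    ((Runs.of_wp (Q := fun τ => Ctx n p P q K τ ∧ τ.reg rTot = 0) ?_).mono
      (by decide) ?_)).mono ?_ fun _ => id
  · simp [hQ, hPr]
    have hP := hp.one_le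
    refine ⟨by omega, by omega, by omega, ?_⟩
    constructor <;> simp [hN, hQ, hPr, hX]
    exact hK
  · rintro τ ⟨hτ, h0⟩ hf
    refine Runs.mono (Runs.frame (forLevels_spec hp hτ (200 * ((P + 1) * (P + 1)) + 30) (fun k ρ =>
      (∀ j ≤ P, j < k → K j ≠ 0 → ∀ c < n ^ j,
        ρ.arr 4 (c * (P + 1) + j) = if tuple hn j c ∈ alive n j (K j) [] then 0 else 1) ∧
      ρ.reg rTot = ∑ j ∈ Finset.range k, (alive n j (K j) []).card ∧
      ∀ j ≤ P, j < k → K j ≠ 0 → ρ.arr 3 j = n ^ (p + 4 - j)) rfl rfl rfl ?_ ?_ ?_ ?_ ?_)) le_rfl ?_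
    · exact ⟨by simp, by simpa using h0, by simp⟩
    · rintro k ρ x ⟨i1, i2, i3⟩
      exact ⟨i1, by simpa using i2, i3⟩
    · rintro k ρ x ⟨i1, i2, i3⟩
      exact ⟨i1, by simpa using i2, i3⟩
    · rintro j hjP hKj ρ hρ hfρ hjρ hpw ⟨i1, i2, i3⟩
      have hput : Runs W (.put 3 (.reg rJ) (.bin .div (.reg rX) (.reg rPw))) ρ 5 fun π =>
          π = ρ.setArr 3 j (n ^ (p + 4 - j)) := by
        refine (Runs.of_wp ?_).mono (by decide) fun _ => id
        have h1 : n ^ (p + 4) ≤ W := hp.le_pow (by omega) le_rfl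
        have h2 : n ^ j ≤ W := hp.pow_le (by omega)
        have h3 : n ^ (p + 4) / n ^ j = n ^ (p + 4 - j) :=
          Nat.pow_div (by have := hp.le_p; omega) hn
        simp [hjρ, hpw, hρ.X_eq, h1, h2, h3]
        have h4 : n ^ (p + 4 - j) ≤ W := hp.le_pow (by omega) le_rfl
        omega
      refine (Runs.seq (T' := n ^ j * (200 * ((P + 1) * (P + 1)) + 8) + 6)
        (hput.mono le_rfl ?_)).mono ?_ fun _ => id
      · rintro π hπ hfπ
        have hπc := hρ.of_frame hfπ rfl
        have hTπ : π.reg rTot = _ := (hfπ.1 rTot rfl).trans i2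
        have h4π : π.arr 4 = ρ.arr 4 := hfπ.2 4 rfl
        refine (Runs.frame (initLevel_spec hp hn hπc ((hfπ.1 rJ rfl).trans hjρ) hjP
          ((hfπ.1 rPw rfl).trans hpw) hKj ?_)).mono le_rfl ?_
        · have h1 : ∑ i ∈ Finset.range j, (alive n i (K i) []).card + n ^ j ≤
              ∑ i ∈ Finset.range (P + 1), n ^ i := by
            refine le_trans ?_ (Finset.sum_le_sum_of_subset
              (Finset.range_mono (show j + 1 ≤ P + 1 by omega)))
            rw [Finset.sum_range_succ]
            exact Nat.add_le_add_right (Finset.sum_le_sum fun i _ => card_alive_le _ _ _ _) _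
          rw [hTπ]
          refine (h1.trans (sum_pow_le hp.two_le P)).trans ((?_ : _ ≤ n ^ (P + 1)).trans
            (hp.pow_le le_rfl))
          rw [pow_succ, mul_comm]
          exact Nat.mul_le_mul_left _ hp.two_le
        · rintro υ ⟨⟨k1, k2, k3⟩, hfυ⟩
          have h3υ : υ.arr 3 = π.arr 3 := hfυ.2 3 rfl
          refine ⟨fun i hi hij hKi c hc => ?_, ?_, fun i hi hij hKi => ?_⟩
          · rcases Nat.lt_succ_iff_lt_or_eq.1 hij with hij | rfl
            · rw [k1 i hi hij.ne, h4π, i1 i hi hij hKi c hc]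
            · exact k2 c hc
          · rw [k3, hTπ, Finset.sum_range_succ]
          · rw [h3υ, hπ]
            rcases Nat.lt_succ_iff_lt_or_eq.1 hij with hij | rfl
            · simp [Function.update_of_ne hij.ne, i3 i hi hij hKi]
            · simp
      · have : 1 ≤ n ^ j := Nat.one_le_pow _ _ hn
        nlinarith
    · rintro j hjP hKj ρ ⟨i1, i2, i3⟩
      have hlt : ∀ i, K i ≠ 0 → i < j + 1 → i < j := by
        intro i hKi hi
        have : i ≠ j := fun h => hKi (h ▸ hKj)
        omega
      refine ⟨fun i hi hij hKi => i1 i hi (hlt i hKi hij) hKi, ?_,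
        fun i hi hij hKi => i3 i hi (hlt i hKi hij) hKi⟩
      rw [i2, Finset.sum_range_succ]
      simp [alive, hKj]
    · rintro ρ ⟨⟨i1, i2, i3⟩, hfρ⟩
      exact ⟨hτ.of_frame hfρ rfl, fun i hi hKi c hc => i1 i hi (by omega) hKi c hc, i2,
        fun i hi hKi => i3 i hi (by omega) hKi⟩
  · have h1 : 1 ≤ n ^ P := Nat.one_le_pow _ _ hn
    have h2 : 1 ≤ P * q := Nat.mul_pos hp.one_le hp.prime.pos
    have h3 : (P + 1) * (P + 1) ≤ 2 * (P * q) := by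
      calc (P + 1) * (P + 1) ≤ (2 * P) * q :=
            Nat.mul_le_mul (by have := hp.one_le; omega) (b2.trans hp.le_q)
        _ = _ := by ring
    calc _ ≤ n ^ P * 16 + n ^ P * (2 * (200 * (2 * (P * q)) + 30) + 50) := by
          refine Nat.add_le_add (by omega) (Nat.mul_le_mul_left _ ?_)
          omega
      _ = n ^ P * (800 * (P * q) + 126) := by ring
      _ ≤ n ^ P * (4000 * (P * q)) := Nat.mul_le_mul_left _ (by omega)
      _ = _ := by ring

end

section

attribute [local simp] wp Expr.eval Expr.Fits Op.eval

/-- The greedy algorithm ends with a list of at most `N` rows that leaves no tuple, where `N` is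
any bound for the numbers in `WellWeighted.length_le`. -/
theorem greedy_spec {W n p P q m N : ℕ} {K : ℕ → ℕ} {σ : State}
    (hp : Params W n p P q K) (hN : σ.reg rN = n) (hQ : σ.reg rQ = P)
    (hPr : σ.reg rPr = q) (hX : σ.reg rX = n ^ (p + 4)) (hK : ∀ j ≤ P, σ.arr 2 j = K j)
    (hm : σ.reg rM = m) (hmW : (m + N) * n ≤ W)
    (hlt : ∀ j ≤ P, K j ≠ 0 → 512 * ((P : ℝ) * j / K j * Real.log (n / j)) < N) :
    Runs W greedy σ (10000 * ((N + 1) * (n ^ P * (P * q)))) fun τ =>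
      ∃ L : List (Fin n → Bool), L.length ≤ N ∧ (∀ j ≤ P, alive n j (K j) L = ∅) ∧
        τ.reg rM = m + L.length ∧ (∀ i < m * n, τ.arr 1 i = σ.arr 1 i) ∧
        ∀ (r : ℕ) (hr : r < L.length) (x : Fin n),
          τ.arr 1 ((m + r) * n + x) = if L[r] x then 1 else 0 := by
  have hn : 0 < n := by have := hp.two_le; omega
  set Z := n ^ P * (P * q) with hZ
  have hnP : 1 ≤ n ^ P := Nat.one_le_pow _ _ hn
  have hPq : 1 ≤ P * q := Nat.mul_pos hp.one_le hp.prime.pos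
  have hZ1 : P * q ≤ Z := Nat.le_mul_of_pos_left _ hnP
  have hZ2 : n ≤ Z := (hp.le_q.trans (Nat.le_mul_of_pos_left _ hp.one_le)).trans hZ1
  have hZ3 : n ^ P * P ≤ Z := Nat.mul_le_mul_left _ (Nat.le_mul_of_pos_right _ hp.prime.pos)
  obtain ⟨b1, b2, b3, b4, b5, b6, b7, b8, b9⟩ := hp.bounds
  refine (Runs.seq (T := 4000 * Z) (T' := ∑ k ∈ Finset.range N, (5000 * Z + 2) + 2)
    ((init_spec hp hn hN hQ hPr hX hK).mono le_rfl ?_)).mono ?_ fun _ => id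
  · rintro τ ⟨hτ, hst, htot, hβ⟩ hf
    have h1τ : τ.arr 1 = σ.arr 1 := hf.2 1 rfl
    refine (Runs.loop N (fun _ => 5000 * Z) (fun k ρ => ∃ L : List (Fin n → Bool), L.length = k ∧
      Ctx n p P q K ρ ∧ Stored n P K L hn ρ ∧
      ρ.reg rTot = ∑ j ∈ Finset.range (P + 1), (alive n j (K j) L).card ∧
      WellWeighted n p P K (ρ.arr 3) L ∧ ρ.reg rM = m + k ∧
      (∀ i < m * n, ρ.arr 1 i = σ.arr 1 i) ∧ ∀ (r : ℕ) (hr : r < L.length) (x : Fin n),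
          ρ.arr 1 ((m + r) * n + x) = if L[r] x then 1 else 0) ?_ ?_ ?_ ?_).mono le_rfl ?_
    · exact ⟨[], rfl, hτ, hst, htot, WellWeighted.init hn hp.le_p hβ, (hf.1 rM rfl).trans hm,
        by simp [h1τ], by simp⟩
    · rintro k ρ - ⟨L, -, -, -, htot, -⟩
      change ρ.reg rTot ≤ W
      rw [htot]
      exact sum_card_alive_le hp L le_rfl
    · rintro k ρ - ⟨L, hL, hρ, -, htot, hww, -⟩ hne
      change ρ.reg rTot ≠ 0 at hne
      rw [htot] at hne
      obtain ⟨j, hj, hj0⟩ := Finset.exists_ne_zero_of_sum_ne_zero hne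
      have hjP : j ≤ P := Nat.lt_succ_iff.1 (Finset.mem_range.1 hj)
      have ha := Finset.card_pos.1 (Nat.pos_of_ne_zero hj0)
      have h1 := hww.length_le hp.two_le hp.one_le hp.two_mul_le hp.le_p hp.K_le hjP ha
      have h2 := hlt j hjP (mem_alive.1 ha.choose_spec).1.ne'
      rw [hL] at h1
      exact_mod_cast h1.trans_lt h2
    · rintro k ρ hk ⟨L, hL, hρ, hst, htot, hww, hM, hlow, hrows⟩ - -
      have hkW : (m + k + 1) * n ≤ W := (Nat.mul_le_mul_right _ (by omega)).trans hmW
      refine (Runs.seq (T := 2000 * Z) (T' := 200 * Z + (100 * Z + (2000 * Z + 4)))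
        ((computeScores_spec hp hn hρ hst hww.weight_le).mono le_rfl ?_)).mono (by omega)
        fun _ => id
      intro σ₁ h₁ hf₁
      have hσ₁ := hρ.of_frame hf₁ rfl
      have hscoreW : ∀ g < q * (4 * P), σ₁.arr 5 g ≤ W := by
        intro g hg
        rw [h₁ g hg]
        refine le_trans ?_ hp.score_le
        refine (Finset.sum_le_card_nsmul _ _ (n ^ P * ((P + 1) * n ^ (p + 4) * P))
          fun j hj => ?_).trans ?_
        · have hjP : j ≤ P := Nat.lt_succ_iff.1 (Finset.mem_range.1 hj)
          by_cases hKj : K j = 0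
          · simp [hKj]
          · rw [mul_comm]
            exact Nat.mul_le_mul ((Finset.card_filter_le _ _).trans ((card_alive_le _ _ _ _).trans
              (Nat.pow_le_pow_right hn hjP))) (Nat.mul_le_mul (hww.weight_le j hjP hKj)
              ((hp.K_le j hjP).trans hjP))
        · rw [Finset.card_range, smul_eq_mul]
          exact Nat.mul_le_mul_right _ (by omega)
      refine Runs.seq ((findBest_spec hp hσ₁ hscoreW).mono (by omega) ?_)
      rintro σ₂ ⟨hg, hmax⟩ hf₂
      have hσ₂ := hσ₁.of_frame hf₂ rfl
      set g := σ₂.reg rArg with hgdef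
      set row := hashRow n q (4 * P) (g / (4 * P)) (g % (4 * P)) with hrow
      have hM₂ : σ₂.reg rM = m + k := (hf₂.1 rM rfl).trans ((hf₁.1 rM rfl).trans hM)
      refine Runs.seq ((writeRow_spec hp hσ₂ rfl hg hM₂ hkW).mono (by omega) ?_)
      rintro σ₃ ⟨hold, hnew⟩ hf₃
      have hσ₃ := hσ₂.of_frame hf₃ rfl
      have h1₃ : σ₂.arr 1 = ρ.arr 1 := (hf₂.2 1 rfl).trans (hf₁.2 1 rfl)
      have h3₃ : σ₃.arr 3 = ρ.arr 3 :=
        (hf₃.2 3 rfl).trans ((hf₂.2 3 rfl).trans (hf₁.2 3 rfl))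
      have h4₃ : σ₃.arr 4 = ρ.arr 4 :=
        (hf₃.2 4 rfl).trans ((hf₂.2 4 rfl).trans (hf₁.2 4 rfl))
      have hM₃ : σ₃.reg rM = m + k := (hf₃.1 rM rfl).trans hM₂
      have hst₃ : Stored n P K L hn σ₃ := by
        intro j hj hKj c hc
        rw [h4₃]
        exact hst j hj hKj c hc
      refine Runs.seq ((update_spec (row := row) hp hn hσ₃ hM₃ hkW hnew hst₃
        (by rw [h3₃]; exact hww.weight_le)).mono (by omega) ?_)
      rintro σ₄ ⟨hst₄, htot₄, hβ₄⟩ hf₄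
      have hσ₄ := hσ₃.of_frame hf₄ rfl
      have hM₄ : σ₄.reg rM = m + k := (hf₄.1 rM rfl).trans hM₃
      have h1₄ : σ₄.arr 1 = σ₃.arr 1 := hf₄.2 1 rfl
      have hww₄ : WellWeighted n p P K (σ₄.arr 3) (L ++ [row]) := by
        refine (hww.step hp.two_le hp.one_le hp.two_mul_le hp.le_p hp.prime hp.le_q hp.K_le
          (fun g' hg' => ?_) hrow).congr fun j hj hKj => ?_
        · rw [← h₁ g' hg', ← h₁ g hg]
          exact hmax g' hg'
        · rw [hβ₄ j hj hKj, h3₃]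
      have hmk : m + k + 1 ≤ W := (Nat.le_mul_of_pos_right _ hn).trans hkW
      have hlast : Runs W (.set rM (.bin .add (.reg rM) (.const 1))) σ₄ 4 fun π =>
          π = σ₄.setReg rM (m + k + 1) := by
        refine (Runs.of_wp ?_).mono (by decide) fun _ => id
        simp [hM₄]
        omega
      refine hlast.frame.mono le_rfl ?_
      rintro π ⟨hπ, hfπ⟩
      refine ⟨L ++ [row], by simp [hL], hσ₄.of_frame hfπ rfl, ?_, ?_, ?_, ?_, ?_, ?_⟩
      · rw [hπ]
        exact hst₄
      · rw [← htot₄]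
        exact hfπ.1 rTot rfl
      · rw [hπ]
        exact hww₄
      · simp [hπ, Nat.add_assoc]
      · intro i hi
        rw [hπ, State.setReg_arr, h1₄, hold i (hi.trans_le (Nat.mul_le_mul_right _ (by omega))),
          h1₃, hlow i hi]
      · intro r hr x
        rw [hπ, State.setReg_arr, h1₄]
        rw [List.length_append, List.length_singleton] at hr
        rcases Nat.lt_succ_iff_lt_or_eq.1 hr with hr' | rfl
        · rw [List.getElem_append_left hr', ← hrows r hr' x, ← h1₃]
          refine hold _ ?_
          calc (m + r) * n + x < (m + r) * n + n := by omega
            _ = (m + r + 1) * n := by ring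
            _ ≤ (m + k) * n := Nat.mul_le_mul_right _ (by omega)
        · have h5 := hnew x
          rw [← hL] at h5
          rw [h5]
          simp [hrow, hgdef]
    · rintro ρ ⟨⟨k, hk, L, hL, -, -, htot, -, hM, hlow, hrows⟩, h0⟩
      change ρ.reg rTot = 0 at h0
      rw [htot, Finset.sum_eq_zero_iff] at h0
      exact ⟨L, by omega, fun j hj => Finset.card_eq_zero.1 (h0 j (Finset.mem_range.2 (by omega))),
        by rw [hM, hL], hlow, hrows⟩
  · rw [Finset.sum_const, Finset.card_range, smul_eq_mul]
    have : 1 ≤ Z := hPq.trans hZ1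
    nlinarith

end

end RAM

/-! ### Bounds for the size -/

theorem le_sizeBound {n p : ℕ} {v : ℕ → ℕ} {j : ℕ} (hj : 1 ≤ j) (hjp : j ≤ p) :
    sizeCoeff p v j * Real.log (n / j) ≤ sizeBound n p v := by
  have := le_ciSup (f := fun i : Fin p => sizeCoeff p v (i.val + 1) *
    Real.log ((n : ℝ) / ((i.val + 1 : ℕ) : ℝ))) (Set.finite_range _).bddAbove ⟨j - 1, by omega⟩
  simpa only [Nat.sub_add_cancel hj, sizeBound] using this

/-- The second term in the minimum lies between `j ^ 2` and `2 j ^ 2`. -/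
theorem sq_le_second_term (j : ℝ) : j ^ 2 ≤ Real.exp 1 * j ^ 2 / Real.logb 2 (Real.exp 1) ∧
    Real.exp 1 * j ^ 2 / Real.logb 2 (Real.exp 1) ≤ 2 * j ^ 2 := by
  have h1 : Real.exp 1 * j ^ 2 / Real.logb 2 (Real.exp 1) = Real.exp 1 * Real.log 2 * j ^ 2 := by
    rw [Real.logb, Real.log_exp]
    field_simp
  have he1 := Real.exp_one_gt_d9
  have he2 := Real.exp_one_lt_d9
  have hl1 := Real.log_two_gt_d9
  have hl2 := Real.log_two_lt_d9
  rw [h1]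
  constructor
  · refine le_mul_of_one_le_left (sq_nonneg _) ?_
    nlinarith
  · refine mul_le_mul_of_nonneg_right ?_ (sq_nonneg _)
    nlinarith

theorem cast_sub_succ {j v : ℕ} (hv : v ≤ j) : ((j + 1 - v : ℕ) : ℝ) = (j : ℝ) - v + 1 := by
  rw [Nat.cast_sub (by omega)]
  push_cast
  ring

theorem le_sizeCoeff {p j : ℕ} {v : ℕ → ℕ} (hv : v j ≤ j) {x : ℝ} (h2 : x ≤ (j : ℝ) ^ 2)
    (h1 : x * (j + 1 - v j : ℕ) ≤ 8 * (p * j)) : x ≤ sizeCoeff p v j := by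
  rw [sizeCoeff, le_min_iff, ← cast_sub_succ hv]
  have hk : (0 : ℝ) < (j + 1 - v j : ℕ) := by
    have : 0 < j + 1 - v j := by omega
    exact_mod_cast this
  refine ⟨?_, h2.trans (sq_le_second_term _).1⟩
  rw [le_div_iff₀ hk]
  refine h1.trans ?_
  have he1 := Real.exp_one_gt_d9
  have : (0 : ℝ) ≤ p * j := by positivity
  nlinarith

theorem sizeCoeff_le (p : ℕ) (v : ℕ → ℕ) (j : ℕ) : sizeCoeff p v j ≤ 2 * (j : ℝ) ^ 2 :=
  (min_le_right _ _).trans (sq_le_second_term _).2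

theorem log_div_nonneg {n j : ℕ} (hj : 1 ≤ j) (hjn : j ≤ n) : 0 ≤ Real.log ((n : ℝ) / j) := by
  refine Real.log_nonneg ?_
  rw [one_le_div (by exact_mod_cast hj)]
  exact_mod_cast hjn

theorem sizeBound_le {n p : ℕ} {v : ℕ → ℕ} (hp : 1 ≤ p) (hpn : p ≤ n) :
    sizeBound n p v ≤ 2 * (p : ℝ) ^ 2 * Real.log n := by
  have : Nonempty (Fin p) := ⟨⟨0, hp⟩⟩
  refine ciSup_le fun i => ?_
  have hi : i.val + 1 ≤ p := i.2
  have h1 : ((i.val + 1 : ℕ) : ℝ) ≤ p := by exact_mod_cast hi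
  have h0 : (1 : ℝ) ≤ ((i.val + 1 : ℕ) : ℝ) := by
    exact_mod_cast Nat.succ_le_succ (Nat.zero_le i.val)
  have hn : (1 : ℝ) ≤ n := by exact_mod_cast hp.trans hpn
  have h2 : Real.log ((n : ℝ) / ((i.val + 1 : ℕ) : ℝ)) ≤ Real.log n := by
    refine Real.log_le_log (by positivity) ?_
    exact div_le_self (by linarith) h0
  refine mul_le_mul ((sizeCoeff_le _ _ _).trans ?_) h2
    (log_div_nonneg (by omega) (by omega)) (by positivity)
  gcongr

theorem nat_le_sizeCoeff {p j : ℕ} {v : ℕ → ℕ} (hv : v j ≤ j) (hj : 1 ≤ j) (hjp : j ≤ p) :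
    (j : ℝ) ≤ sizeCoeff p v j := by
  have hj' : (1 : ℝ) ≤ j := by exact_mod_cast hj
  refine le_sizeCoeff hv (by nlinarith) ?_
  have h1 : (j + 1 - v j : ℕ) ≤ 2 * p := by omega
  have h2 : ((j + 1 - v j : ℕ) : ℝ) ≤ 2 * p := by exact_mod_cast h1
  have h3 : (0 : ℝ) ≤ p := Nat.cast_nonneg _
  nlinarith

theorem half_le_sizeBound {n p : ℕ} {v : ℕ → ℕ} (hn : 2 ≤ n) (hp : 1 ≤ p) (hv : v 1 ≤ 1) :
    (1 : ℝ) / 2 ≤ sizeBound n p v := by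
  refine le_trans ?_ (le_sizeBound (n := n) (v := v) le_rfl hp)
  have h1 : (1 : ℝ) ≤ sizeCoeff p v 1 := by
    simpa using nat_le_sizeCoeff hv le_rfl hp
  have h2 : Real.log 2 ≤ Real.log ((n : ℝ) / (1 : ℕ)) := by
    refine Real.log_le_log (by norm_num) ?_
    rw [Nat.cast_one, div_one]
    exact_mod_cast hn
  have h3 := Real.log_two_gt_d9
  nlinarith

theorem cast_le_sizeBound {n p : ℕ} {v : ℕ → ℕ} (hn : 2 ≤ n) (hpn : p ≤ n) (hnp : n < 2 * p)
    (hv : ∀ j, 1 ≤ j → j ≤ p → v j ≤ j) : (n : ℝ) ≤ 12 * sizeBound n p v := by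
  set j := p / 2 with hj
  have hj1 : 1 ≤ j := by omega
  have hjp : j ≤ p := by omega
  have h1 := nat_le_sizeCoeff (hv j hj1 hjp) hj1 hjp
  have hjr : (0 : ℝ) < j := by exact_mod_cast hj1
  have h2 : Real.log 2 ≤ Real.log ((n : ℝ) / j) := by
    refine Real.log_le_log (by norm_num) ?_
    rw [le_div_iff₀ hjr]
    have : 2 * j ≤ n := by omega
    exact_mod_cast this
  have h3 := Real.log_two_gt_d9
  have h4 : (n : ℝ) ≤ 6 * j := by
    have : n ≤ 6 * j := by omega
    exact_mod_cast this
  have h5 := le_sizeBound (n := n) (v := v) hj1 hjp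
  nlinarith

/-- If `j (j - v_j + 1) ≤ 4 p`, then a strong `j`-selector is cheap enough. -/
theorem sq_mul_log_le_sizeBound {n p j : ℕ} {v : ℕ → ℕ} (hv : v j ≤ j) (hj : 1 ≤ j) (hjp : j ≤ p)
    (hpn : p ≤ n) (h : j * (j + 1 - v j) ≤ 4 * p) :
    (j : ℝ) * j * Real.log (n / j) ≤ sizeBound n p v := by
  refine le_trans (mul_le_mul_of_nonneg_right ?_ (log_div_nonneg hj (hjp.trans hpn)))
    (le_sizeBound hj hjp)
  refine le_sizeCoeff hv (le_of_eq (by ring)) ?_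
  have h1 : (j : ℝ) * (j + 1 - v j : ℕ) ≤ 4 * p := by exact_mod_cast h
  have h2 : (0 : ℝ) ≤ j := Nat.cast_nonneg _
  have h3 : (0 : ℝ) ≤ p := Nat.cast_nonneg _
  nlinarith [mul_nonneg h2 h3]

/-- If `j (j - v_j + 1) > 4 p`, then the first term in the minimum is attained up to a constant. -/
theorem div_mul_log_le_sizeBound {n p j : ℕ} {v : ℕ → ℕ} (hv : v j ≤ j) (hj : 1 ≤ j) (hjp : j ≤ p)
    (hpn : p ≤ n) (h : 4 * p < j * (j + 1 - v j)) :
    (p : ℝ) * j / (j + 1 - v j : ℕ) * Real.log (n / j) ≤ sizeBound n p v := by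
  refine le_trans (mul_le_mul_of_nonneg_right ?_ (log_div_nonneg hj (hjp.trans hpn)))
    (le_sizeBound hj hjp)
  have hk : (0 : ℝ) < (j + 1 - v j : ℕ) := by
    have : 0 < j + 1 - v j := by omega
    exact_mod_cast this
  have h1 : 4 * (p : ℝ) ≤ j * (j + 1 - v j : ℕ) := by exact_mod_cast h.le
  have h2 : (0 : ℝ) ≤ j := Nat.cast_nonneg _
  have h3 : (0 : ℝ) ≤ p := Nat.cast_nonneg _
  refine le_sizeCoeff hv ?_ ?_
  · rw [div_le_iff₀ hk]
    nlinarith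
  · rw [div_mul_cancel₀ _ hk.ne']
    nlinarith [mul_nonneg h2 h3]

/-! ### The main program -/

namespace RAM

/-- Finds the least prime from `n` on, by trial division. -/
def findPrime : Cmd :=
  .seq (.seq (.set rPr (.reg rN)) (.set rI (.const 2)))
    (.loop (.bin .lt (.reg rI) (.reg rPr))
      (.ite (.mod (.reg rPr) (.reg rI)) (.set rI (.bin .add (.reg rI) (.const 1)))
        (.seq (.set rPr (.bin .add (.reg rPr) (.const 1))) (.set rI (.const 2)))))

/-- Computes `n ^ (p + 4)`. -/
def powers : Cmd :=
  .seq (.seq (.set rX (.const 1)) (.set rL (.bin .add (.reg 1) (.const 4))))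
    (forUp rI rL (.set rX (.bin .mul (.reg rX) (.reg rN))))

/-- The number `j - v_j + 1`. -/
def Expr.gap (i : Expr) : Expr := .bin .sub (.bin .add i (.const 1)) (.get 0 i)

/-- Finds the last level with `j (j - v_j + 1) ≤ 4 p`. -/
def findSplit : Cmd :=
  .seq (.seq (.set rQ (.const 0)) (.set rL (.bin .add (.reg 1) (.const 1))))
    (forUp rI rL (.ite (.bin .lt (.bin .mul (.const 4) (.reg 1))
      (.bin .mul (.reg rI) (.gap (.reg rI)))) .skip (.set rQ (.reg rI))))

/-- Activates the levels above the one found by `findSplit`, with `K j = j - v_j + 1`, except those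
with `v_j = 0`, of which nothing is required. -/
def setLevels : Cmd :=
  .seq (.seq (.set rL (.bin .add (.reg 1) (.const 1)))
    (forUp rI rL (.put 2 (.reg rI) (.bin .mul (.bin .mul (.bin .lt (.reg rQ) (.reg rI))
      (.bin .lt (.const 0) (.get 0 (.reg rI)))) (.gap (.reg rI))))))
    (.set rQ (.reg 1))

/-- Outputs the identity matrix. -/
def identityMatrix : Cmd :=
  forUp rI rN (.put 1 (.bin .add (.bin .mul (.reg rI) (.reg rN)) (.reg rI)) (.const 1))

/-- If `n < 2 p`, outputs the identity matrix. Otherwise the first run of `greedy` has the level `J`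
found by `findSplit` as its only active level, with `K J = 1`: it isolates every member of every set
of `J` columns, which serves all levels up to `J`. The second run appends rows for the levels above
`J`. -/
def superselector : Cmd :=
  .ite (.bin .lt (.reg rN) (.bin .mul (.const 2) (.reg 1))) identityMatrix
    (.seq findPrime (.seq powers (.seq findSplit (.seq (.put 2 (.reg rQ) (.const 1))
      (.seq greedy (.seq setLevels (.seq greedy (.set rN (.reg rM)))))))))

section

attribute [local simp] wp Expr.eval Expr.Fits Op.eval

theorem findPrime_spec {W n : ℕ} {σ : State} (hn : 2 ≤ n) (hN : σ.reg rN = n)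
    (hW : 2 * n + 1 ≤ W) :
    Runs W findPrime σ (200 * (n * n)) fun τ =>
      (τ.reg rPr).Prime ∧ n ≤ τ.reg rPr ∧ τ.reg rPr ≤ 2 * n := by
  -- Bertrand's postulate; the search cannot pass the prime `s`
  obtain ⟨s, hs, hns, hsn⟩ := Nat.exists_prime_lt_and_le_two_mul n (by omega)
  refine (Runs.seq (T := 4) (T' := ∑ k ∈ Finset.range (n * (2 * n) + 2 * n), (20 + 4) + 4)
    ((Runs.of_wp (Q := fun τ => τ.reg rPr = n ∧ τ.reg rI = 2) ?_).mono (by decide) ?_)).mono ?_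
    fun _ => id
  · simp [hN]
    omega
  · rintro τ ⟨h1, h2⟩ hf
    refine (Runs.loop (n * (2 * n) + 2 * n) (fun _ => 20) (fun k ρ => ∃ q d, ρ.reg rPr = q ∧
      ρ.reg rI = d ∧ n ≤ q ∧ q ≤ s ∧ 2 ≤ d ∧ d ≤ q ∧ (∀ e, 2 ≤ e → e < d → ¬ e ∣ q) ∧
      k ≤ (q - n) * (2 * n) + (d - 2)) ?_ ?_ ?_ ?_).mono le_rfl ?_
    · exact ⟨n, 2, h1, h2, le_rfl, hns.le, le_rfl, hn, fun e h h' => by omega, by simp⟩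
    · rintro k ρ - ⟨q, d, hq, hd, h3, h4, h5, h6, -, -⟩
      simp [hq, hd]
      refine ⟨by omega, by omega, ?_⟩
      split_ifs <;> omega
    · rintro k ρ - ⟨q, d, hq, hd, h3, h4, h5, h6, -, h7⟩ -
      have : (q - n) * (2 * n) ≤ n * (2 * n) := Nat.mul_le_mul_right _ (by omega)
      omega
    · rintro k ρ - ⟨q, d, hq, hd, h3, h4, h5, h6, h7, h8⟩ hlt -
      have hdq : d < q := by
        by_contra h
        simp [hq, hd, h] at hlt
      refine (Runs.of_wp ?_).mono (by decide) fun _ => id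
      simp [hq, hd]
      refine ⟨by omega, fun hmod => ⟨by omega, ?_⟩, fun hmod => ⟨by omega, ?_⟩⟩
      · refine ⟨h3, h4, by omega, hdq, fun e he he' hdvd => ?_, by omega⟩
        rcases Nat.lt_or_eq_of_le he' with h | rfl
        · exact h7 e he h hdvd
        · exact hmod (Nat.dvd_iff_mod_eq_zero.1 hdvd)
      · refine ⟨by omega, by omega, ?_, by omega, fun e he he' => by omega, ?_⟩
        · -- a composite number is not the prime `s`
          refine lt_of_le_of_ne h4 fun h => ?_
          rcases (Nat.dvd_prime (h ▸ hs)).1 (Nat.dvd_of_mod_eq_zero hmod) with h | h <;> omega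
        · have : (q + 1 - n) * (2 * n) = (q - n) * (2 * n) + 2 * n := by
            rw [show q + 1 - n = (q - n) + 1 by omega]
            ring
          omega
    · rintro ρ ⟨⟨k, -, q, d, hq, hd, h3, h4, h5, h6, h7, -⟩, hlt⟩
      have hdq : d = q := by
        by_contra h
        have : d < q := by omega
        simp [hq, hd, this] at hlt
      subst hdq
      rw [hq]
      refine ⟨?_, h3, by omega⟩
      rw [Nat.prime_def_lt']
      exact ⟨by omega, fun e he he' => h7 e he he'⟩
  · simp only [Finset.sum_const, Finset.card_range, smul_eq_mul]
    nlinarith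

theorem powers_spec {W n p : ℕ} {σ : State} (hn : 2 ≤ n) (hN : σ.reg rN = n) (hP : σ.reg 1 = p)
    (hW : n ^ (p + 4) ≤ W) :
    Runs W powers σ (100 * (p + 1)) fun τ => τ.reg rX = n ^ (p + 4) := by
  have h1 : p + 4 < n ^ (p + 4) := Nat.lt_pow_self (by omega)
  have hnW : n ≤ n ^ (p + 4) := Nat.le_self_pow (by omega) n
  refine (Runs.seq (T := 6) (T' := (p + 4) * 12 + 6)
    ((Runs.of_wp (Q := fun τ => τ.reg rX = 1 ∧ τ.reg rL = p + 4) ?_).mono (by decide) ?_)).mono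
    (by omega) fun _ => id
  · simp [hP]
    omega
  · rintro τ ⟨h2, h3⟩ hf
    refine (Runs.forUp (N := p + 4) (T := fun _ => 4) (I := fun k ρ => ρ.reg rX = n ^ k) h3
      (by omega) (by omega) rfl rfl (by decide) (by simp [h2]) ?_).mono (by simp) fun _ => id
    intro k ρ hk hkρ hfρ hI
    have hNρ : ρ.reg rN = n := (hfρ.1 rN rfl).trans ((hf.1 rN rfl).trans hN)
    refine (Runs.of_wp ?_).mono (by decide) fun _ => id
    have h4 : n ^ k ≤ W := (Nat.pow_le_pow_right (by omega) (by omega)).trans hW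
    have h5 : n ^ (k + 1) ≤ W := (Nat.pow_le_pow_right (by omega) (by omega)).trans hW
    simp [hI, hNρ, h4, ← pow_succ, h5]
    omega

theorem findSplit_spec {W p : ℕ} {w : ℕ → ℕ} {σ : State} (hP : σ.reg 1 = p) (hp : 1 ≤ p)
    (hw : σ.arr 0 = w) (hwp : ∀ i ≤ p, w i ≤ i) (hW : 4 * ((p + 1) * (p + 1)) ≤ W) :
    Runs W findSplit σ (100 * (p + 1)) fun τ => ∃ J, τ.reg rQ = J ∧ 1 ≤ J ∧ J ≤ p ∧
      J * (J + 1 - w J) ≤ 4 * p ∧ ∀ i ≤ p, J < i → 4 * p < i * (i + 1 - w i) := by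
  have hpp : p + 1 ≤ (p + 1) * (p + 1) := Nat.le_mul_of_pos_left _ (by omega)
  refine (Runs.seq (T := 6) (T' := (p + 1) * 30 + 6)
    ((Runs.of_wp (Q := fun τ => τ.reg rQ = 0 ∧ τ.reg rL = p + 1) ?_).mono (by decide) ?_)).mono
    (by omega) fun _ => id
  · simp [hP]
    omega
  · rintro τ ⟨h2, h3⟩ hf
    refine (Runs.forUp (N := p + 1) (T := fun _ => 22) (I := fun k ρ => ∃ J, ρ.reg rQ = J ∧
      J ≤ p ∧ J * (J + 1 - w J) ≤ 4 * p ∧ ∀ i < k, J < i → 4 * p < i * (i + 1 - w i)) h3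
      (by omega) (by omega) rfl rfl (by decide) ?_ ?_).mono (by simp) ?_
    · simp [h2]
    · rintro k ρ hk hkρ hfρ ⟨J, hJ, hJp, hJ1, hJ2⟩
      have hPρ : ρ.reg 1 = p := (hfρ.1 1 rfl).trans ((hf.1 1 rfl).trans hP)
      have hwρ : ρ.arr 0 = w := (hfρ.2 0 rfl).trans ((hf.2 0 rfl).trans hw)
      have hwk := hwp k (by omega)
      have hkk : k * (k + 1 - w k) ≤ (p + 1) * (p + 1) := Nat.mul_le_mul (by omega) (by omega)
      refine (Runs.of_wp ?_).mono (by decide) fun _ => id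
      simp [Expr.gap, hkρ, hPρ, hwρ, hJ]
      refine ⟨⟨by omega, by omega, by split_ifs <;> omega⟩, fun h => ⟨hJp, hJ1, fun i hi hJi => ?_⟩,
        fun h => ⟨by omega, by omega, h, fun i hi hki => by omega⟩⟩
      rcases Nat.lt_or_eq_of_le hi with hi | rfl
      · exact hJ2 i hi hJi
      · exact h
    · rintro ρ ⟨J, hJ, hJp, hJ1, hJ2⟩
      refine ⟨J, hJ, ?_, hJp, hJ1, fun i hi => hJ2 i (by omega)⟩
      by_contra h
      have := hJ2 1 (by omega) (by omega)
      omega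

theorem setLevels_spec {W p J : ℕ} {w : ℕ → ℕ} {σ : State} (hP : σ.reg 1 = p)
    (hQ : σ.reg rQ = J) (hJ : J ≤ p)
    (hw : σ.arr 0 = w) (hwp : ∀ i ≤ p, w i ≤ i) (hW : 4 * ((p + 1) * (p + 1)) ≤ W) :
    Runs W setLevels σ (100 * (p + 1)) fun τ => τ.reg rQ = p ∧
      ∀ i ≤ p, τ.arr 2 i = if J < i ∧ 0 < w i then i + 1 - w i else 0 := by
  have hpp : p + 1 ≤ (p + 1) * (p + 1) := Nat.le_mul_of_pos_left _ (by omega)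
  have hset : Runs W (.set rL (.bin .add (.reg 1) (.const 1))) σ 4 fun τ => τ.reg rL = p + 1 := by
    refine (Runs.of_wp ?_).mono (by decide) fun _ => id
    simp [hP]
    omega
  refine (Runs.seq (T := 4 + ((p + 1) * 32 + 6)) (T' := 2)
    ((Runs.seq (T' := (p + 1) * 32 + 6) (hset.mono le_rfl ?_) : Runs W _ σ _ fun τ =>
      ∀ i ≤ p, τ.arr 2 i = if J < i ∧ 0 < w i then i + 1 - w i else 0).mono le_rfl ?_)).mono
    (by omega) fun _ => id
  · intro τ h3 hf
    refine (Runs.forUp (N := p + 1) (T := fun _ => 24) (I := fun k ρ => ∀ i < k,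
      ρ.arr 2 i = if J < i ∧ 0 < w i then i + 1 - w i else 0) h3
      (by omega) (by omega) rfl rfl (by decide) (by simp) ?_).mono (by simp)
      fun ρ h i hi => h i (by omega)
    intro k ρ hk hkρ hfρ hI
    have hQρ : ρ.reg rQ = J := (hfρ.1 rQ rfl).trans ((hf.1 rQ rfl).trans hQ)
    have hwρ : ρ.arr 0 = w := (hfρ.2 0 rfl).trans ((hf.2 0 rfl).trans hw)
    have hwk := hwp k (by omega)
    refine (Runs.of_wp ?_).mono (by decide) fun _ => id
    simp only [wp, Expr.Fits, Expr.eval, Op.eval, Expr.gap, hkρ, hQρ, hwρ, State.setReg_arr,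
      State.setArr_arr, if_true]
    by_cases h1 : J < k <;> by_cases h2 : 0 < w k <;> simp [h1, h2] <;>
      refine ⟨by omega, by omega, fun i hi => ?_⟩ <;>
      (rcases Nat.lt_or_eq_of_le hi with hi | rfl
       · rw [Function.update_of_ne hi.ne, hI i hi]
       · simp [h1, h2])
  · intro τ h hf
    have hPτ : τ.reg 1 = p := (hf.1 1 rfl).trans hP
    refine (Runs.of_wp ?_).mono (by decide) fun _ => id
    simp [hPτ]
    exact ⟨by omega, h⟩

theorem identityMatrix_spec {W n : ℕ} {σ : State} (hn : 2 ≤ n) (hN : σ.reg rN = n)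
    (h0 : ∀ i, σ.arr 1 i = 0) (hW : 2 * (n * n) ≤ W) :
    Runs W identityMatrix σ (100 * n) fun τ => τ.reg rN = n ∧
      ∀ r < n, ∀ x < n, τ.arr 1 (r * n + x) = if x = r then 1 else 0 := by
  have hnn : n ≤ n * n := Nat.le_mul_of_pos_left _ (by omega)
  refine ((Runs.forUp (N := n) (T := fun _ => 10) (I := fun k ρ => ∀ r < n, ∀ x < n,
    ρ.arr 1 (r * n + x) = if x = r ∧ r < k then 1 else 0) hN
    (by omega) (by omega) rfl rfl (by decide) (by simp [h0]) ?_).frame).mono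
    (by simp; omega) ?_
  · intro k ρ hk hkρ hfρ hI
    have hNρ : ρ.reg rN = n := (hfρ.1 rN rfl).trans hN
    have hkn : k * n ≤ n * n := Nat.mul_le_mul_right _ hk.le
    refine (Runs.of_wp ?_).mono (by decide) fun _ => id
    simp [hkρ, hNρ]
    refine ⟨by omega, by omega, fun r hr x hx => ?_⟩
    by_cases h : r = k ∧ x = k
    · obtain ⟨rfl, rfl⟩ := h
      simp
    · rw [Function.update_of_ne, hI r hr x hx]
      · refine if_congr ?_ rfl rfl
        omega
      · intro h'
        have h1 := congrArg (· / n) h'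
        have h2 := congrArg (· % n) h'
        simp only [Nat.mul_add_mod_self_right, Nat.mod_eq_of_lt hx, Nat.mod_eq_of_lt hk] at h2
        simp only [Nat.add_comm (_ * n), Nat.add_mul_div_right _ _ (show 0 < n by omega),
          Nat.div_eq_of_lt hx, Nat.div_eq_of_lt hk] at h1
        omega
  · rintro τ ⟨h, hf⟩
    refine ⟨(hf.1 rN rfl).trans hN, fun r hr x hx => ?_⟩
    rw [h r hr x hx]
    simp [hr]

end

/-! ### Correctness and cost of the whole program -/

section

attribute [local simp] wp Expr.eval Expr.Fits Op.eval

/-- The case `n < 2 p`. -/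
theorem superselector_spec_of_lt {W n p : ℕ} {v : ℕ → ℕ} (hn : 2 ≤ n) (hpn : p ≤ n)
    (hnp : n < 2 * p) (hW : 2 * (n * n) ≤ W) :
    Runs W superselector (input n p v) (110 * n) fun τ => τ.reg rN = n ∧
      ∀ r < n, ∀ x < n, τ.arr 1 (r * n + x) = if x = r then 1 else 0 := by
  have hnn : 2 * n ≤ n * n := Nat.mul_le_mul_right _ hn
  refine (Runs.ite (T := 100 * n) ?_ (fun _ => identityMatrix_spec hn (by simp [input])
    (by simp [input]) hW) fun h => absurd h ?_).mono ?_ fun _ => id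
  · simp [input, hnp]
    omega
  · simp [input, hnp]
  · simp only [Expr.cost]
    omega

/-- The case `2 p ≤ n`; `N` bounds the number of rows of each of the two parts. -/
theorem superselector_spec_of_le {W n p N : ℕ} {v : ℕ → ℕ} (hn : 2 ≤ n) (hp : 1 ≤ p)
    (hnp : 2 * p ≤ n) (hv : ∀ j, 1 ≤ j → j ≤ p → v j ≤ j) (hW : n ^ (2 * p + 20) ≤ W)
    (hNW : 2 * N * n ≤ W) (hN : 512 * sizeBound n p v < N) :
    Runs W superselector (input n p v) (100000 * ((N + 1) * (p * n ^ (p + 1)))) fun τ =>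
      ∃ (m : ℕ) (M : Matrix (Fin m) (Fin n) Bool), m ≤ 2 * N ∧ Outputs τ M ∧
        IsSuperSelector p v M := by
  -- the contents of array `0`
  set w : ℕ → ℕ := fun i => if 1 ≤ i ∧ i ≤ p then v i else 0 with hw
  have hwv : ∀ i, 1 ≤ i → i ≤ p → w i = v i := fun i h h' => by simp [hw, h, h']
  have hwp : ∀ i ≤ p, w i ≤ i := by
    intro i hi
    by_cases h : 1 ≤ i
    · rw [hwv i h hi]
      exact hv i h hi
    · simp [hw, h]
  have hpow : ∀ {x e : ℕ}, e ≤ 2 * p + 20 → x ≤ n ^ e → x ≤ W := fun he hx =>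
    (hx.trans (Nat.pow_le_pow_right (by omega) he)).trans hW
  have hn3 : n * n * n ≤ W := hpow (e := 3) (by omega) (le_of_eq (by ring))
  have hnn : 4 * n ≤ n * n * n := Nat.mul_le_mul_right _ (Nat.mul_le_mul hn hn)
  have hp2 : 4 * ((p + 1) * (p + 1)) ≤ W := by
    refine le_trans ?_ (hpow (e := 4) (by omega) le_rfl)
    calc 4 * ((p + 1) * (p + 1)) ≤ n ^ 2 * (n * n) :=
          Nat.mul_le_mul (Nat.pow_le_pow_left hn 2) (Nat.mul_le_mul (by omega) (by omega))
      _ = n ^ 4 := by ring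
  have hpn1 : n ≤ n ^ (p + 1) := Nat.le_self_pow (by omega) n
  set Y := p * n ^ (p + 1) with hY
  have hnY : n * n ≤ Y := by
    calc n * n = 1 * n ^ 2 := by ring
      _ ≤ p * n ^ (p + 1) := Nat.mul_le_mul hp (Nat.pow_le_pow_right (by omega) (by omega))
  have hpY : p + 1 ≤ Y := by nlinarith
  have hgY : ∀ P q, P ≤ p → q ≤ 2 * n → n ^ P * (P * q) ≤ 2 * Y := by
    intro P q hP hq
    calc n ^ P * (P * q) ≤ n ^ p * (p * (2 * n)) :=
          Nat.mul_le_mul (Nat.pow_le_pow_right (by omega) hP) (Nat.mul_le_mul hP hq)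
      _ = 2 * Y := by rw [hY]; ring
  refine Runs.mono (T := 5 + 1 + (200 * (n * n) + (100 * (p + 1) + (100 * (p + 1) + (3 +
    (20000 * ((N + 1) * Y) + (100 * (p + 1) + (20000 * ((N + 1) * Y) + 2)))))))) ?_ ?_ fun _ => id
  rotate_left
  · have h1 : Y ≤ (N + 1) * Y := Nat.le_mul_of_pos_left _ (by omega)
    omega
  refine Runs.ite ?_ (fun h => absurd ?_ h) fun _ => ?_
  · simp [input]
    split_ifs <;> omega
  · simp [input]
    omega
  have hf0 : ∀ {c : Cmd} {τ : State}, Frame c (input n p v) τ → c.wr 1 = false →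
      c.wa 0 = false → τ.reg 1 = p ∧ τ.arr 0 = w := by
    intro c τ hf h1 h2
    refine ⟨(hf.1 1 h1).trans (by simp [input]), (hf.2 0 h2).trans ?_⟩
    funext j
    simp [input, hw]
  refine Runs.seq ((findPrime_spec hn (by simp [input]) (by omega)).mono le_rfl ?_)
  rintro σ₁ ⟨hq, hnq, hqn⟩ hf₁
  generalize hqdef : σ₁.reg rPr = q at hq hnq hqn
  obtain ⟨hp₁, hw₁⟩ := hf0 hf₁ rfl rfl
  have hN₁ : σ₁.reg rN = n := (hf₁.1 rN rfl).trans (by simp [input])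
  have hM₁ : σ₁.reg rM = 0 := (hf₁.1 rM rfl).trans (by simp [input])
  have hK₁ : ∀ i, σ₁.arr 2 i = 0 := fun i => by rw [hf₁.2 2 rfl]; simp [input]
  refine Runs.seq ((powers_spec hn hN₁ hp₁ (hpow (by omega) le_rfl)).mono le_rfl ?_)
  intro σ₂ hX₂ hf₂
  refine Runs.seq ((findSplit_spec ((hf₂.1 1 rfl).trans hp₁) hp ((hf₂.2 0 rfl).trans hw₁) hwp
    hp2).mono le_rfl ?_)
  rintro σ₃ ⟨J, hJ, hJ1, hJp, hJ4, hJlt⟩ hf₃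
  have hput : Runs W (.put 2 (.reg rQ) (.const 1)) σ₃ 3 fun τ => τ = σ₃.setArr 2 J 1 := by
    refine (Runs.of_wp ?_).mono (by decide) fun _ => id
    simp [hJ]
    omega
  refine Runs.seq (hput.mono le_rfl ?_)
  intro σ₄ hσ₄ hf₄
  have hN₄ : σ₄.reg rN = n := (hf₄.1 rN rfl).trans ((hf₃.1 rN rfl).trans ((hf₂.1 rN rfl).trans hN₁))
  have hM₄ : σ₄.reg rM = 0 := (hf₄.1 rM rfl).trans ((hf₃.1 rM rfl).trans ((hf₂.1 rM rfl).trans hM₁))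
  have hq₄ : σ₄.reg rPr = q :=
    (hf₄.1 rPr rfl).trans ((hf₃.1 rPr rfl).trans ((hf₂.1 rPr rfl).trans hqdef))
  have hX₄ : σ₄.reg rX = n ^ (p + 4) := (hf₄.1 rX rfl).trans ((hf₃.1 rX rfl).trans hX₂)
  have hJ₄ : σ₄.reg rQ = J := (hf₄.1 rQ rfl).trans hJ
  have hp₄ : σ₄.reg 1 = p := (hf₄.1 1 rfl).trans ((hf₃.1 1 rfl).trans ((hf₂.1 1 rfl).trans hp₁))
  have hw₄ : σ₄.arr 0 = w := (hf₄.2 0 rfl).trans ((hf₃.2 0 rfl).trans ((hf₂.2 0 rfl).trans hw₁))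
  have hK₄ : ∀ i ≤ J, σ₄.arr 2 i = if i = J then 1 else 0 := by
    intro i _
    rw [hσ₄, State.setArr_arr, if_pos rfl, Function.update_apply, hf₃.2 2 rfl, hf₂.2 2 rfl, hK₁ i]
  have hpar₁ : Params W n p J q fun i => if i = J then 1 else 0 :=
    ⟨hn, hJ1, by omega, hJp, hq, hnq, hqn, fun i hi => by split_ifs <;> omega, hW⟩
  have hNn : N * n ≤ 2 * N * n := Nat.mul_le_mul_right _ (by omega)
  refine Runs.seq (((greedy_spec (N := N) hpar₁ hN₄ hJ₄ hq₄ hX₄ hK₄ hM₄ (by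
    rw [Nat.zero_add]
    exact hNn.trans hNW) ?_)).mono ?_ ?_)
  · intro j hj hKj
    have hjJ : j = J := by
      by_contra h
      simp [h] at hKj
    subst hjJ
    refine lt_of_le_of_lt (mul_le_mul_of_nonneg_left ?_ (by norm_num)) hN
    simp only [if_true, Nat.cast_one, div_one]
    rw [hwv j hJ1 hJp] at hJ4
    exact sq_mul_log_le_sizeBound (hv j hJ1 hJp) hJ1 hJp (by omega) hJ4
  · have := Nat.mul_le_mul_left (N + 1) (hgY J q hJp hqn)
    rw [Nat.mul_left_comm (N + 1) 2] at this
    omega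
  rintro σ₅ ⟨L₁, hL₁, ha₁, hM₅, -, hrows₁⟩ hf₅
  refine Runs.seq ((setLevels_spec ((hf₅.1 1 rfl).trans hp₄) ((hf₅.1 rQ rfl).trans hJ₄) hJp
    ((hf₅.2 0 rfl).trans hw₄) hwp hp2).mono le_rfl ?_)
  rintro σ₆ ⟨hQ₆, hK₆⟩ hf₆
  have hM₆ : σ₆.reg rM = L₁.length := by
    rw [hf₆.1 rM rfl, hM₅, Nat.zero_add]
  have hpar₂ : Params W n p p q fun i => if J < i ∧ 0 < w i then i + 1 - w i else 0 :=
    ⟨hn, hp, hnp, le_rfl, hq, hnq, hqn, fun i hi => by split_ifs <;> omega, hW⟩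
  refine Runs.seq (((greedy_spec (N := N) hpar₂ ((hf₆.1 rN rfl).trans ((hf₅.1 rN rfl).trans hN₄))
    hQ₆ ((hf₆.1 rPr rfl).trans ((hf₅.1 rPr rfl).trans hq₄))
    ((hf₆.1 rX rfl).trans ((hf₅.1 rX rfl).trans hX₄)) hK₆ hM₆
    ((Nat.mul_le_mul_right _ (by omega)).trans hNW) ?_)).mono ?_ ?_)
  · intro j hj hKj
    have hJj : J < j ∧ 0 < w j := by
      by_contra h
      simp [h] at hKj
    refine lt_of_le_of_lt (mul_le_mul_of_nonneg_left ?_ (by norm_num)) hN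
    rw [if_pos hJj]
    have hlt := hJlt j hj hJj.1
    rw [hwv j (by omega) hj] at hlt ⊢
    exact div_mul_log_le_sizeBound (hv j (by omega) hj) (by omega) hj (by omega) hlt
  · have := Nat.mul_le_mul_left (N + 1) (hgY p q le_rfl hqn)
    rw [Nat.mul_left_comm (N + 1) 2] at this
    omega
  rintro σ₇ ⟨L₂, hL₂, ha₂, hM₇, hlow, hrows₂⟩ hf₇
  have hNW' : 2 * N ≤ W := (Nat.le_mul_of_pos_right _ (by omega)).trans hNW
  have hlast : Runs W (.set rN (.reg rM)) σ₇ 2 fun τ =>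
      τ = σ₇.setReg rN (L₁.length + L₂.length) := by
    refine (Runs.of_wp ?_).mono (by decide) fun _ => id
    simp [hM₇]
    omega
  refine hlast.mono le_rfl ?_
  rintro τ rfl
  refine ⟨L₁.length + L₂.length, fun r => (L₁ ++ L₂)[r.val]'(by simp), by omega, ⟨by simp, ?_⟩,
    ?_⟩
  · intro r x
    rw [State.setReg_arr]
    beta_reduce
    by_cases hr : r.val < L₁.length
    · rw [List.getElem_append_left hr, ← hrows₁ r hr x, Nat.zero_add, hlow, hf₆.2 1 rfl]
      calc r.val * n + x < r.val * n + n := by omega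
        _ = (r.val + 1) * n := by ring
        _ ≤ L₁.length * n := Nat.mul_le_mul_right _ hr
    · rw [List.getElem_append_right (by omega), ← hrows₂ (r - L₁.length) (by omega) x]
      congr 3
      omega
  · have hmem : ∀ row ∈ L₁ ++ L₂, ∃ r : Fin (L₁.length + L₂.length),
        (L₁ ++ L₂)[r.val]'(by simp) = row := by
      intro row hrow
      obtain ⟨i, hi, h⟩ := List.mem_iff_getElem.1 hrow
      exact ⟨⟨i, by simpa using hi⟩, h⟩
    intro i hi1 hip
    by_cases hiJ : i ≤ J
    · refine isSelector_of_le (j := J) ?_ hiJ (by omega) (hv i hi1 hip)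
      refine isSelector_of_alive_eq_empty (L := L₁) le_rfl ?_ fun row hrow =>
        hmem row (List.mem_append_left _ hrow)
      have := ha₁ J le_rfl
      rw [if_pos rfl] at this
      rwa [Nat.add_sub_cancel_left]
    · rcases Nat.eq_zero_or_pos (v i) with h0 | h0
      · intro S _
        rw [h0]
        exact Nat.zero_le _
      · refine isSelector_of_alive_eq_empty (L := L₂) (hv i hi1 hip) ?_ fun row hrow =>
          hmem row (List.mem_append_right _ hrow)
        have := ha₂ i hip
        rw [if_pos ⟨by omega, by rwa [hwv i hi1 hip]⟩, hwv i hi1 hip] at this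
        exact this

end

end RAM

/-- The identity matrix is a superselector. -/
theorem isSuperSelector_one {n p : ℕ} {v : ℕ → ℕ} (hv : ∀ j, 1 ≤ j → j ≤ p → v j ≤ j) :
    IsSuperSelector p v (fun r c : Fin n => decide (c = r)) := by
  intro i hi1 hip S hS
  have h : {c : Fin n | c ∈ S ∧ ∃ r : Fin n, ∀ d ∈ S, decide (d = r) = decide (d = c)} = S := by
    ext c
    simp only [Set.mem_ofPred_eq, SetLike.mem_coe]
    exact ⟨fun h => h.1, fun h => ⟨h, c, fun d _ => rfl⟩⟩
  rw [h, Set.ncard_coe_finset, hS]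
  exact hv i hi1 hip

theorem theorem4 :
    ∃ (prog : RAM.Cmd) (K : ℕ) (A B : ℝ),
      ∀ (n p : ℕ) (v : ℕ → ℕ), 2 ≤ n → 1 ≤ p → p ≤ n →
        (∀ j : ℕ, 1 ≤ j → j ≤ p → v j ≤ j) →
        ∃ (t : ℕ) (τ : RAM.State) (m : ℕ) (M : Matrix (Fin m) (Fin n) Bool),
          RAM.Exec (n ^ (K * p)) prog (RAM.input n p v) t τ ∧
          (t : ℝ) ≤ B * ((p : ℝ) ^ 3 * (n : ℝ) ^ (p + 1) * Real.log (n : ℝ)) ∧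
          RAM.Outputs τ M ∧
          IsSuperSelector p v M ∧
          (m : ℝ) ≤ A * sizeBound n p v := by
  refine ⟨RAM.superselector, 22, 2000, 200000000, fun n p v hn hp hpn hv => ?_⟩
  have hnr : (2 : ℝ) ≤ n := by exact_mod_cast hn
  have hpr : (1 : ℝ) ≤ p := by exact_mod_cast hp
  have hlog2 := Real.log_two_gt_d9
  have hlog : (1 : ℝ) / 2 ≤ Real.log n := by
    have := Real.log_le_log (by norm_num) hnr
    linarith
  have hhalf := half_le_sizeBound (v := v) hn hp (hv 1 le_rfl hp)
  rcases Nat.lt_or_ge n (2 * p) with hnp | hnp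
  · have hW : 2 * (n * n) ≤ n ^ (22 * p) := by
      calc 2 * (n * n) ≤ n * (n * n) := Nat.mul_le_mul_right _ hn
        _ = n ^ 3 := by ring
        _ ≤ _ := Nat.pow_le_pow_right (by omega) (by omega)
    obtain ⟨t, τ, he, ht, h0, hM⟩ := RAM.superselector_spec_of_lt (v := v) hn hpn hnp hW
    refine ⟨t, τ, n, fun r c => decide (c = r), he, ?_, ⟨h0, fun r c => ?_⟩,
      isSuperSelector_one hv, ?_⟩
    · have h1 : (t : ℝ) ≤ 110 * n := by exact_mod_cast ht
      have h2 : (n : ℝ) ≤ (n : ℝ) ^ (p + 1) := le_self_pow₀ (by linarith) (by omega)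
      have h3 : (1 : ℝ) ≤ (p : ℝ) ^ 3 := one_le_pow₀ hpr
      calc (t : ℝ) ≤ 110 * n := h1
        _ ≤ 200000000 * (1 * n * (1 / 2)) := by linarith
        _ ≤ _ := by gcongr
    · rw [hM r r.2 c c.2]
      simp [Fin.ext_iff]
    · have := cast_le_sizeBound hn hpn hnp hv
      linarith
  · set N := ⌊512 * sizeBound n p v⌋₊ + 1 with hN
    have hN1 : 512 * sizeBound n p v < N := by
      rw [hN]
      exact_mod_cast Nat.lt_floor_add_one _
    have hN2 : (N : ℝ) ≤ 512 * sizeBound n p v + 1 := by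
      rw [hN]
      push_cast
      linarith [Nat.floor_le (show 0 ≤ 512 * sizeBound n p v by linarith)]
    have hub := sizeBound_le (v := v) hp hpn
    have hW : n ^ (2 * p + 20) ≤ n ^ (22 * p) := Nat.pow_le_pow_right (by omega) (by omega)
    have hNW : 2 * N * n ≤ n ^ (22 * p) := by
      have h1 : Real.log n ≤ n := (Real.log_le_sub_one_of_pos (by linarith)).trans (by linarith)
      have h2 : (p : ℝ) ≤ n := by exact_mod_cast hpn
      have h3 : (N : ℝ) ≤ 1024 * (n : ℝ) ^ 3 + 1 := by
        have : 2 * (p : ℝ) ^ 2 * Real.log n ≤ 2 * (n : ℝ) ^ 2 * n := by gcongr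
        nlinarith
      have h4 : N ≤ 1024 * n ^ 3 + 1 := by exact_mod_cast h3
      have h5 : 2 ^ 11 ≤ n ^ 11 := Nat.pow_le_pow_left hn 11
      have h6 : 1 ≤ n ^ 3 := Nat.one_le_pow _ _ (by omega)
      calc 2 * N * n ≤ n * (2 ^ 11 * n ^ 3) * n := by
            refine Nat.mul_le_mul_right _ (Nat.mul_le_mul hn ?_)
            omega
        _ ≤ n * (n ^ 11 * n ^ 3) * n := by gcongr
        _ = n ^ 16 := by ring
        _ ≤ _ := Nat.pow_le_pow_right (by omega) (by omega)
    obtain ⟨t, τ, he, ht, m, M, hm, hout, hM⟩ :=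
      RAM.superselector_spec_of_le hn hp hnp hv hW hNW hN1
    refine ⟨t, τ, m, M, he, ?_, hout, hM, ?_⟩
    · have h1 : (t : ℝ) ≤ 100000 * (((N : ℝ) + 1) * (p * (n : ℝ) ^ (p + 1))) := by
        exact_mod_cast ht
      have h2 : (1 : ℝ) / 2 ≤ (p : ℝ) ^ 2 * Real.log n :=
        hlog.trans (le_mul_of_one_le_left (by linarith) (one_le_pow₀ hpr))
      have h3 : (N : ℝ) + 1 ≤ 2000 * ((p : ℝ) ^ 2 * Real.log n) := by linarith
      calc (t : ℝ) ≤ _ := h1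
        _ ≤ 100000 * ((2000 * ((p : ℝ) ^ 2 * Real.log n)) * (p * (n : ℝ) ^ (p + 1))) := by gcongr
        _ = _ := by ring
    · have h1 : (m : ℝ) ≤ 2 * N := by exact_mod_cast hm
      linarith
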